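/- **Setting.** Let $n\ge 2$, $m\ge 0$, $a<b$, and let $N:S^{n-1}\times[a,b]\to\mathbb R^{n+m}$ be a smooth immersion (smooth up to the boundary) with induced metric $g$. Let $\bar g$ be the standard metric of the cylinder and $\bar D$ its Levi-Civita connection. The mean radius $r(z)$ is defined by $|N(S^{n-1}\times\{z\})|=|S^{n-1}|\,r(z)^{n-1}$ (area of the cross section counted by the pulled back area form). The second fundamental form $h_{ij}$ is vector valued, $\partial_i\partial_jN-\Gamma_{ij}^k\partial_kN=-h_{ij}$; $W$ is the Weingarten map $h_i^j=g^{jl}h_{il}$, $H=h_i^i$, $|A|^2=\langle h_{ij},h^{ij}\rangle$, $\nu^+=H/|H|$ and $h^+_{ij}=\langle h_{ij},\nu^+\rangle$; indices are raised with $g$, and repeated indices are summed. $N$ is an *$(\varepsilon,k)$-cylindrical (submanifold) neck* if on $S^{n-1}\times[a,b]$ * $\hat g=r^{-2}g$ satisfies $|\hat g-\bar g|_{\bar g}\le\varepsilon$ and $|\bar D^j\hat g|_{\bar g}\le\varepsilon$ for $1\le j\le k$; * $|(d/dz)^j\log r|\le\varepsilon$ for $1\le j\le k$; * there is a unit normal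 direction $\nu$ with $|W_\nu-r^{-1}\bar W|\le\varepsilon r^{-1}$ and $|W_-|\le\varepsilon r^{-1}$, and $|\nabla^lW|\le\varepsilon r^{-l-1}$ for $1\le l\le k$. Here $W_\nu$ and $W_-$ are the components of $W$ along $\nu$ and orthogonal to $\nu$, $\bar W$ is the Weingarten map of the standard cylinder (the identity on $TS^{n-1}$, $0$ on $\partial_z$), and $\nabla$ is the connection induced by $g$ and the normal connection. Let $u:[a,b]\to\mathbb R$ be $C^2$ and $\tau\ge0$, and let $\tilde N_\tau=N-\tau u(z)\nu^+$ be the bending deformation; quantities of $\tilde N_\tau$ carry a tilde (in particular $\tilde h_i^j=\tilde g^{jl}\tilde h_{il}$). At a given point we use coordinates $x^1,\dots,x^n$ of the cylinder centred there, where $x^1$ is the axial coordinate $z$ up to a constant and $x^2,\dots,x^n$ are coordinates of $S^{n-1}$ that are normal at the point for the round metric (there the metric coefficients are $\delta_{ab}$ and their first derivatives vanish). **Theorem.** Let $n\ge2$, $m\ge 0$ and $0<\theta<1$. There are $\varepsilon_0>0$ and $c>0$, depending only on $n,m,\theta$, with the following property. Let $k\ge1$, and $k\ge2$ unless $m=1$;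 let $0<\varepsilon<\varepsilon_0$. Let $N$ be an $(\varepsilon,k)$-cylindrical neck (for instance one in normal parametrization; that condition is not needed), and let $u,\tau$ satisfy $\tau(|u|+|u'|)\le\theta r$ on $[a,b]$. Then $\tilde N_\tau$ is an immersion, and at every point, in coordinates as above centred at it and for all $i,j$, with $e_1=\varepsilon\tau(|u|+|u'|)$ and $e_2=\tau^2(|u|^2+|u'|^2+|u''|^2)$: (i) $$\begin{aligned}\tilde h_{ij}={}&h_{ij}+\tau\delta^1_i\delta^1_ju''\nu^++\tau u\,h^{+,k}_j\partial_i\partial_kN+\tau\delta^1_ju'\partial_i\nu^++\tau\delta^1_iu'h^{+,k}_j\partial_kN+\tau u\,(\partial_ih^{+,k}_j)\partial_kN\\&-\tau u'(\delta^1_ih^{+,k}_j+\delta^1_jh^{+,k}_i-g^{1k}h^+_{ij})\partial_kN+R_{ij},\qquad |R_{ij}|\le c\,(e_1+r^{-1}e_2);\end{aligned}$$ (ii) $$\begin{aligned}\tilde h_i^j={}&h_i^j+\tau g^{1j}\delta^1_iu''\nu^+-\tau u\,h^{+,jk}\partial_i\partial_kN+\tau g^{1j}u'\partial_i\nu^++\tau\delta^1_iu'h^{+,jk}\partial_kN+\tau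 u\,(\partial_ih^{+,jk})\partial_kN\\&-\tau u'(\delta^1_ih^{+,jk}+g^{1j}h^{+,k}_i-g^{1k}h^{+,j}_i)\partial_kN+R_i^j,\qquad |R_i^j|\le c\,(r^{-2}e_1+r^{-3}e_2);\end{aligned}$$ (iii) $$\begin{aligned}\tilde H={}&H+\tau g^{11}u''\nu^+-\tau u\,h^{+,ik}\partial_i\partial_kN+\tau g^{1i}u'\partial_i\nu^++\tau u'h^{+,1k}\partial_kN+\tau u\,(\partial_ih^{+,ik})\partial_kN\\&-\tau u'(\delta^1_ih^{+,ik}+g^{1i}h^{+,k}_i-g^{1k}h^{+,i}_i)\partial_kN+R,\qquad |R|\le c\,(r^{-2}e_1+r^{-3}e_2);\end{aligned}$$ (iv) $$\Big||\tilde A|^2-\big(|A|^2+2\tau\delta^1_i\delta^1_ju''h^{+,ij}+2\tau u\,h^{+,k}_j\langle h_{ik},h^{ij}\rangle\big)\Big|\le c\,(r^{-3}e_1+r^{-4}e_2);$$ (v) $$\Big||\tilde H|^2-\big(|H|^2+2\tau u''g^{11}|H|+2\tau u\,h^{+,k}_jh^+_{ik}g^{ij}|H|\big)\Big|\le c\,(r^{-3}e_1+r^{-4}e_2).$$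 (Everything is evaluated at the point considered; $u$, $r$ and their derivatives at its $z$.) -/

import Mathlib

open scoped Topology ContDiff

namespace BendNeck

noncomputable section

/-- Euclidean space `ℝⁿ`. -/
abbrev E (n : ℕ) : Type := EuclideanSpace ℝ (Fin n)

/-! ### Calculus of immersed coordinate patches `F : ℝⁿ → V` -/

/-- The partial derivative `∂f / ∂xⁱ` at `x`. -/
def pd {n : ℕ} {W : Type} [NormedAddCommGroup W] [NormedSpace ℝ W]
    (i : Fin n) (f : E n → W) (x : E n) : W :=
  fderiv ℝ f x (EuclideanSpace.single i 1)

/-- The Christoffel symbols `Γ_{ij}^k` of a metric `G` given by its coefficient matrix. -/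
def christoffel {n : ℕ} (G : E n → Matrix (Fin n) (Fin n) ℝ) (x : E n) (i j k : Fin n) : ℝ :=
  (1 / 2) * ∑ l, (G x)⁻¹ k l *
    (pd i (fun y => G y j l) x + pd j (fun y => G y l i) x - pd l (fun y => G y i j) x)

/-- Covariant derivative of a tensor with `l` lower indices and values in `V`; the new index is
the first one. `P` is the projection onto the bundle in which the tensor takes its values (the
identity for scalar tensors, the normal projection for tensors with values in the normal
bundle). -/
def covDeriv {n l : ℕ} {V : Type} [NormedAddCommGroup V] [NormedSpace ℝ V]
    (Γ : E n → Fin n → Fin n → Fin n → ℝ) (P : E n → V → V)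
    (T : E n → (Fin l → Fin n) → V) (x : E n) (I : Fin (l + 1) → Fin n) : V :=
  P x (pd (I 0) (fun y => T y (Fin.tail I)) x)
    - ∑ a : Fin l, ∑ k : Fin n,
        Γ x (I 0) (Fin.tail I a) k • T x (Function.update (Fin.tail I) a k)

/-- The `j`-th iterated covariant derivative of a tensor with two lower indices. -/
def iterCovDeriv {n : ℕ} {V : Type} [NormedAddCommGroup V] [NormedSpace ℝ V]
    (Γ : E n → Fin n → Fin n → Fin n → ℝ) (P : E n → V → V)
    (T : E n → (Fin 2 → Fin n) → V) : (j : ℕ) → E n → (Fin (2 + j) → Fin n) → V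
  | 0 => T
  | j + 1 => covDeriv Γ P (iterCovDeriv Γ P T j)

/-- The norm of a tensor with `l` lower indices; `Ginv` is the matrix `g^{ij}`. -/
def tensorNorm {n l : ℕ} {V : Type} [NormedAddCommGroup V] [InnerProductSpace ℝ V]
    (Ginv : Matrix (Fin n) (Fin n) ℝ) (T : (Fin l → Fin n) → V) : ℝ :=
  Real.sqrt (∑ I : Fin l → Fin n, ∑ J : Fin l → Fin n,
    (∏ a, Ginv (I a) (J a)) * inner ℝ (T I) (T J))

section Patch

variable {n : ℕ} {V : Type} [NormedAddCommGroup V] [InnerProductSpace ℝ V]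

/-- The induced metric `g_{ij} = ⟨∂_i F, ∂_j F⟩`. -/
def metric (F : E n → V) (x : E n) : Matrix (Fin n) (Fin n) ℝ :=
  Matrix.of fun i j => inner ℝ (pd i F x) (pd j F x)

/-- The inverse metric `g^{ij}`. -/
def metricInv (F : E n → V) (x : E n) : Matrix (Fin n) (Fin n) ℝ := (metric F x)⁻¹

/-- The vector valued second fundamental form, with the sign convention
`∂_i ∂_j F - Γ_{ij}^k ∂_k F = - h_{ij}`. -/
def sff (F : E n → V) (x : E n) (i j : Fin n) : V :=
  -(pd i (pd j F) x - ∑ k, christoffel (metric F) x i j k • pd k F x)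

/-- The Weingarten map `h_i^j = g^{jl} h_{il}` (vector valued). -/
def weingarten (F : E n → V) (x : E n) (i j : Fin n) : V :=
  ∑ l, metricInv F x j l • sff F x i l

/-- The mean curvature vector `H = h_i^i`. -/
def meanCurv (F : E n → V) (x : E n) : V := ∑ i, weingarten F x i i

/-- `|A|² = g^{ik} g^{jl} ⟨h_{ij}, h_{kl}⟩`. -/
def normSqA (F : E n → V) (x : E n) : ℝ :=
  ∑ i, ∑ j, ∑ k, ∑ l, metricInv F x i k * metricInv F x j l *
    inner ℝ (sff F x i j) (sff F x k l)

/-- The principal normal direction `ν⁺ = H / |H|`. -/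
def nuPlus (F : E n → V) (x : E n) : V := ‖meanCurv F x‖⁻¹ • meanCurv F x

/-- `h⁺_{ij} = ⟨h_{ij}, ν⁺⟩`. -/
def hPlus (F : E n → V) (x : E n) (i j : Fin n) : ℝ := inner ℝ (sff F x i j) (nuPlus F x)

/-- `h^{+,k}_j = g^{kl} h⁺_{jl}`. -/
def hPlusMixed (F : E n → V) (x : E n) (j k : Fin n) : ℝ :=
  ∑ l, metricInv F x k l * hPlus F x j l

/-- `h^{+,jk} = g^{jp} g^{kq} h⁺_{pq}`. -/
def hPlusUp (F : E n → V) (x : E n) (j k : Fin n) : ℝ :=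
  ∑ p, ∑ q, metricInv F x j p * metricInv F x k q * hPlus F x p q

/-- `h^{ij} = g^{ip} g^{jq} h_{pq}` (vector valued). -/
def sffUp (F : E n → V) (x : E n) (i j : Fin n) : V :=
  ∑ p, ∑ q, (metricInv F x i p * metricInv F x j q) • sff F x p q

/-- The orthogonal projection onto the normal space of the patch. -/
def normalProj (F : E n → V) (x : E n) (v : V) : V :=
  v - ∑ i, ∑ j, (metricInv F x i j * inner ℝ v (pd i F x)) • pd j F x

/-- The `l`-th covariant derivative of the second fundamental form, for the Levi-Civita
connection and the normal connection. Lowering the tangential index with the parallel metric, it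
is `∇^l W`. -/
def nablaSff (F : E n → V) (l : ℕ) : E n → (Fin (2 + l) → Fin n) → V :=
  iterCovDeriv (christoffel (metric F)) (normalProj F) (fun x I => sff F x (I 0) (I 1)) l

end Patch

/-! ### Coordinates on the cylinder `S^d × ℝ`, where `d = n - 1` -/

/-- `σ` is a local parametrization of the unit sphere `S^d ⊆ ℝ^{d+1}` near `σ 0` which is
normal at `0` for the round metric: there the metric coefficients are `δ_{ab}` and their first
derivatives (so the Christoffel symbols) vanish. -/
structure IsNormalSphereChart {d : ℕ} (σ : E d → E (d + 1)) : Prop where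
  smooth : ContDiffAt ℝ ∞ σ 0
  mem_sphere : ∀ᶠ y in 𝓝 (0 : E d), ‖σ y‖ = 1
  metric_eq : metric σ 0 = 1
  deriv_metric_eq : ∀ a b c : Fin d, pd c (fun y => metric σ y a b) 0 = 0

/-- Coordinates on the cylinder around `(σ 0, z)`: the coordinate with index `0` (usually written
`x¹`) is the axial coordinate minus `z`, the other ones are the coordinates of `σ`. -/
def cylChart {d : ℕ} (σ : E d → E (d + 1)) (z : ℝ) (x : E (d + 1)) : E (d + 1) × ℝ :=
  (σ (WithLp.toLp 2 (fun a : Fin d => x a.succ)), z + x 0)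

/-- The standard metric of the cylinder `S^d × ℝ` in these coordinates. -/
def cylMetric {d : ℕ} (σ : E d → E (d + 1)) (z : ℝ) (x : E (d + 1)) :
    Matrix (Fin (d + 1)) (Fin (d + 1)) ℝ :=
  Matrix.of fun i j =>
    inner ℝ (pd i (fun y => (cylChart σ z y).1) x) (pd j (fun y => (cylChart σ z y).1) x)
      + pd i (fun y => (cylChart σ z y).2) x * pd j (fun y => (cylChart σ z y).2) x

/-- `δ^1_i`, the components of `dz`. -/
def dz {d : ℕ} (i : Fin (d + 1)) : ℝ := if i = 0 then 1 else 0

/-- The Weingarten map of the standard cylinder of radius one: the identity on the tangent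
space of the sphere, zero on the axial direction. -/
def cylWeingarten {d : ℕ} (i j : Fin (d + 1)) : ℝ := (if i = j then 1 else 0) - dz i * dz j

/-! ### Necks

A map on `S^d × [a, b]` is given by a map `N` on `ℝ^{d+1} × ℝ`, smooth near `S^d × [a, b]`; only
its values on `S^d × ℝ` near `S^d × [a, b]` are used. -/

section Neck

variable {d m : ℕ}

/-- The density, with respect to the measure of the round sphere, of the area of the cross section
`N (S^d × {z})`: the square root of the Gram determinant of the images of an orthonormal
basis of `T_p S^d = p^⊥`. -/
def areaDensity (N : E (d + 1) × ℝ → E (d + 1 + m)) (z : ℝ) (p : E (d + 1)) : ℝ :=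
  let e := stdOrthonormalBasis ℝ (Submodule.span ℝ {p})ᗮ
  let D := fderiv ℝ (fun y => N (y, z)) p
  Real.sqrt (Matrix.det (Matrix.of fun a b =>
    inner ℝ (D (e a : E (d + 1))) (D (e b : E (d + 1)))))

/-- The measure of the round unit sphere `S^d`. -/
def sphereMeasure (d : ℕ) : MeasureTheory.Measure (Metric.sphere (0 : E (d + 1)) 1) :=
  (MeasureTheory.volume : MeasureTheory.Measure (E (d + 1))).toSphere

/-- The mean radius `r(z)`, determined by `|Σ_z| = σ_d r(z)^d` where `|Σ_z|` is the area of the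
cross section and `σ_d` the area of the unit sphere `S^d`. -/
def meanRadius (N : E (d + 1) × ℝ → E (d + 1 + m)) (z : ℝ) : ℝ :=
  ((∫ p, areaDensity N z (p : E (d + 1)) ∂(sphereMeasure d)) /
    (sphereMeasure d).real Set.univ) ^ (1 / (d : ℝ))

/-- `N` in the coordinates `cylChart σ z`. -/
def patch (N : E (d + 1) × ℝ → E (d + 1 + m)) (σ : E d → E (d + 1)) (z : ℝ)
    (x : E (d + 1)) : E (d + 1 + m) :=
  N (cylChart σ z x)

/-- The conformal metric `ĝ = r(z)^{-2} g` in the coordinates `cylChart σ z`. -/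
def confMetric (N : E (d + 1) × ℝ → E (d + 1 + m)) (σ : E d → E (d + 1)) (z : ℝ)
    (x : E (d + 1)) : Matrix (Fin (d + 1)) (Fin (d + 1)) ℝ :=
  ((meanRadius N (z + x 0)) ^ 2)⁻¹ • metric (patch N σ z) x

/-- The (intrinsic) `(ε, k)` geometric neck conditions for the metric induced by `N`. All tensors
are evaluated at the centre `x = 0` of the coordinates, and the coordinates range over all normal
coordinates centred at any point of `S^d × [a, b]`. -/
structure IsGeometricNeck (ε : ℝ) (k : ℕ) (a b : ℝ) (N : E (d + 1) × ℝ → E (d + 1 + m)) :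
    Prop where
  smooth : ∀ (p : E (d + 1)) (z : ℝ), ‖p‖ = 1 → z ∈ Set.Icc a b → ContDiffAt ℝ ∞ N (p, z)
  immersion : ∀ z ∈ Set.Icc a b, ∀ σ : E d → E (d + 1), IsNormalSphereChart σ →
    LinearIndependent ℝ (fun i => pd i (patch N σ z) 0)
  radius_smooth : ∀ z ∈ Set.Icc a b, ContDiffAt ℝ ∞ (meanRadius N) z
  metric_close : ∀ z ∈ Set.Icc a b, ∀ σ : E d → E (d + 1), IsNormalSphereChart σ →
    tensorNorm (cylMetric σ z 0)⁻¹
      (fun I : Fin 2 → Fin (d + 1) =>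
        confMetric N σ z 0 (I 0) (I 1) - cylMetric σ z 0 (I 0) (I 1)) ≤ ε
  deriv_metric_close : ∀ z ∈ Set.Icc a b, ∀ σ : E d → E (d + 1), IsNormalSphereChart σ →
    ∀ j : ℕ, 1 ≤ j → j ≤ k →
      tensorNorm (cylMetric σ z 0)⁻¹
        (iterCovDeriv (christoffel (cylMetric σ z)) (fun _ v => v)
          (fun x I => confMetric N σ z x (I 0) (I 1)) j 0) ≤ ε
  radius_close : ∀ z ∈ Set.Icc a b, ∀ j : ℕ, 1 ≤ j → j ≤ k →
    |iteratedDeriv j (fun s => Real.log (meanRadius N s)) z| ≤ ε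

/-- `(ε, k)`-cylindrical submanifold neck: a geometric neck together with a unit normal
direction `ν` such that `|W_ν - r⁻¹ W̄| ≤ ε r⁻¹`, `|W_-| ≤ ε r⁻¹` and `|∇^l W| ≤ ε r^{-l-1}` for
`1 ≤ l ≤ k`, where `W_-` is the part of `W` normal to `ν`. -/
structure IsCylindricalNeck (ε : ℝ) (k : ℕ) (a b : ℝ) (N : E (d + 1) × ℝ → E (d + 1 + m)) :
    Prop extends IsGeometricNeck ε k a b N where
  curvature_close : ∃ ν : E (d + 1) × ℝ → E (d + 1 + m),
    ∀ z ∈ Set.Icc a b, ∀ σ : E d → E (d + 1), IsNormalSphereChart σ →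
      ‖ν (σ 0, z)‖ = 1 ∧
      (∀ i, inner ℝ (ν (σ 0, z)) (pd i (patch N σ z) 0) = 0) ∧
      tensorNorm (metricInv (patch N σ z) 0)
        (fun I : Fin 2 → Fin (d + 1) =>
          inner ℝ (sff (patch N σ z) 0 (I 0) (I 1)) (ν (σ 0, z))
            - (meanRadius N z)⁻¹ *
              ∑ l, cylWeingarten (I 0) l * metric (patch N σ z) 0 l (I 1))
        ≤ ε * (meanRadius N z)⁻¹ ∧
      tensorNorm (metricInv (patch N σ z) 0)
        (fun I : Fin 2 → Fin (d + 1) =>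
          sff (patch N σ z) 0 (I 0) (I 1)
            - (inner ℝ (sff (patch N σ z) 0 (I 0) (I 1)) (ν (σ 0, z)) : ℝ) • ν (σ 0, z))
        ≤ ε * (meanRadius N z)⁻¹
  deriv_curvature : ∀ z ∈ Set.Icc a b, ∀ σ : E d → E (d + 1), IsNormalSphereChart σ →
    ∀ l : ℕ, 1 ≤ l → l ≤ k →
      tensorNorm (metricInv (patch N σ z) 0) (nablaSff (patch N σ z) l 0)
        ≤ ε * ((meanRadius N z) ^ (l + 1))⁻¹

/-- The bending deformation `Ñ_τ = N - τ u(z) ν⁺` in the coordinates `cylChart σ z`. -/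
def bentPatch (N : E (d + 1) × ℝ → E (d + 1 + m)) (τ : ℝ) (u : ℝ → ℝ)
    (σ : E d → E (d + 1)) (z : ℝ) (x : E (d + 1)) : E (d + 1 + m) :=
  patch N σ z x - (τ * u (z + x 0)) • nuPlus (patch N σ z) x

end Neck

end

end BendNeck

open BendNeck

/-!
Both sides of each expansion scale by a power of the mean radius under homotheties, so one may
assume `r = 1` at the point. There a neck is `O(ε)`-close to the unit cylinder: the metric is close
to the identity, the second fundamental form to the Weingarten form of the cylinder times a unit
normal, and the derivatives of the second fundamental form are `O(ε)`. Hence `∂ν⁺` and `∂∂ν⁺` agree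
up to `O(ε)` with the expressions they have on a hypersurface, `h⁺ • ∂N` and its derivative; in
codimension one no second derivative of `h` enters, since the normal bundle is a line and `ν⁺` is
parallel up to sign.

Expanding the fundamental forms of `N - τ u ν⁺` in `τ`, the first-order terms are the displayed
ones up to an error `ε τ (|u| + |u'|)`, and the remaining terms are quadratic in `τ (u, u', u'')`.
The bound `τ (|u| + |u'|) ≤ θ r` with `θ < 1` keeps the bent metric uniformly coercive, so that it
can be inverted and its inverse expanded.
-/


namespace BendNeck

open Filter Asymptotics
open scoped Topology ContDiff

noncomputable section

section PartialDerivatives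

variable {n : ℕ} {W W' : Type} [NormedAddCommGroup W] [NormedSpace ℝ W]
  [NormedAddCommGroup W'] [InnerProductSpace ℝ W'] {x : E n} {i : Fin n}

lemma pd_congr {f g : E n → W} (h : f =ᶠ[𝓝 x] g) : pd i f x = pd i g x := by
  simp only [pd, h.fderiv_eq]

@[simp]
lemma pd_const (c : W) : pd i (fun _ => c) x = 0 := by simp [pd]

lemma pd_add {f g : E n → W} (hf : DifferentiableAt ℝ f x) (hg : DifferentiableAt ℝ g x) :
    pd i (fun y => f y + g y) x = pd i f x + pd i g x := by
  simp [pd, fderiv_fun_add hf hg]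

lemma pd_sub {f g : E n → W} (hf : DifferentiableAt ℝ f x) (hg : DifferentiableAt ℝ g x) :
    pd i (fun y => f y - g y) x = pd i f x - pd i g x := by
  simp [pd, fderiv_fun_sub hf hg]

lemma pd_sum {ι : Type*} {s : Finset ι} {f : ι → E n → W}
    (hf : ∀ a ∈ s, DifferentiableAt ℝ (f a) x) :
    pd i (fun y => ∑ a ∈ s, f a y) x = ∑ a ∈ s, pd i (f a) x := by
  simp [pd, fderiv_fun_sum hf]

lemma pd_smul {c : E n → ℝ} {f : E n → W} (hc : DifferentiableAt ℝ c x)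
    (hf : DifferentiableAt ℝ f x) :
    pd i (fun y => c y • f y) x = c x • pd i f x + pd i c x • f x := by
  simp [pd, fderiv_fun_smul hc hf]

lemma pd_const_smul (c : ℝ) (f : E n → W) :
    pd i (fun y => c • f y) x = c • pd i f x :=
  DFunLike.congr_fun (congrFun (fderiv_const_smul_field c) x) _

lemma pd_mul {c e : E n → ℝ} (hc : DifferentiableAt ℝ c x) (he : DifferentiableAt ℝ e x) :
    pd i (fun y => c y * e y) x = c x * pd i e x + pd i c x * e x :=
  pd_smul hc he

lemma pd_inner {f g : E n → W'} (hf : DifferentiableAt ℝ f x) (hg : DifferentiableAt ℝ g x) :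
    pd i (fun y => (inner ℝ (f y) (g y) : ℝ)) x
      = inner ℝ (pd i f x) (g x) + inner ℝ (f x) (pd i g x) := by
  rw [pd, fderiv_inner_apply ℝ hf hg, add_comm, pd, pd]

lemma contDiffAt_pd {f : E n → W} {p q : WithTop ℕ∞} (hf : ContDiffAt ℝ q f x)
    (hpq : p + 1 ≤ q) (i : Fin n) : ContDiffAt ℝ p (pd i f) x :=
  (hf.fderiv_right hpq).clm_apply contDiffAt_const

lemma contDiffAt_pd_infty {f : E n → W} (hf : ContDiffAt ℝ ∞ f x) (i : Fin n) :
    ContDiffAt ℝ ∞ (pd i f) x :=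
  contDiffAt_pd hf (by simp) i

lemma differentiableAt_pd {f : E n → W} (hf : ContDiffAt ℝ 2 f x) (i : Fin n) :
    DifferentiableAt ℝ (pd i f) x :=
  (contDiffAt_pd (p := 1) hf (by norm_num) i).differentiableAt one_ne_zero

lemma pd_pd_eq_fderiv_fderiv {f : E n → W} (hf : ContDiffAt ℝ 2 f x) (i j : Fin n) :
    pd i (pd j f) x
      = fderiv ℝ (fderiv ℝ f) x (EuclideanSpace.single i 1) (EuclideanSpace.single j 1) := by
  have hd : DifferentiableAt ℝ (fderiv ℝ f) x :=
    (hf.fderiv_right (m := 1) (by norm_num)).differentiableAt one_ne_zero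
  change fderiv ℝ (fun y => fderiv ℝ f y (EuclideanSpace.single j 1)) x _ = _
  rw [fderiv_clm_apply hd (by fun_prop)]
  simp

lemma pd_comm {f : E n → W} (hf : ContDiffAt ℝ 2 f x) (i j : Fin n) :
    pd i (pd j f) x = pd j (pd i f) x := by
  rw [pd_pd_eq_fderiv_fderiv hf, pd_pd_eq_fderiv_fderiv hf]
  exact (hf.isSymmSndFDerivAt (by simp)).eq _ _

lemma eventually_differentiableAt {f : E n → W} (hf : ContDiffAt ℝ 1 f x) :
    ∀ᶠ y in 𝓝 x, DifferentiableAt ℝ f y :=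
  (hf.eventually (by simp)).mono fun _ h => h.differentiableAt one_ne_zero

lemma pd_comp_apply_zero {d : ℕ} {f : ℝ → ℝ} {y : E (d + 1)} (hf : DifferentiableAt ℝ f (y 0))
    (i : Fin (d + 1)) : pd i (fun x : E (d + 1) => f (x 0)) y = dz i * deriv f (y 0) := by
  have hproj : HasFDerivAt (fun x : E (d + 1) => x 0)
      (EuclideanSpace.proj 0 : E (d + 1) →L[ℝ] ℝ) y :=
    (EuclideanSpace.proj (𝕜 := ℝ) (0 : Fin (d + 1))).hasFDerivAt
  have hcomp := hf.hasDerivAt.comp_hasFDerivAt y hproj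
  simp [pd, show (fun x : E (d + 1) => f (x 0)) = f ∘ fun x => x 0 from rfl, hcomp.fderiv, dz,
    eq_comm, mul_comm]

end PartialDerivatives

section Pointwise

variable {n : ℕ} {V : Type} [NormedAddCommGroup V] [InnerProductSpace ℝ V] {F : E n → V}
  {x : E n}

lemma metric_apply (F : E n → V) (x : E n) (i j : Fin n) :
    metric F x i j = inner ℝ (pd i F x) (pd j F x) := rfl

lemma metric_symm (F : E n → V) (x : E n) (i j : Fin n) : metric F x i j = metric F x j i := by
  rw [metric_apply, metric_apply, real_inner_comm]

lemma det_metric_ne_zero_iff :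
    (metric F x).det ≠ 0 ↔ LinearIndependent ℝ (fun i => pd i F x) :=
  Matrix.det_gram_ne_zero_iff_linearIndependent

lemma metricInv_symm (F : E n → V) (x : E n) (i j : Fin n) :
    metricInv F x i j = metricInv F x j i := by
  have h : (metric F x).IsSymm := Matrix.IsSymm.ext fun i j => metric_symm F x j i
  exact h.inv.apply j i

lemma sum_metricInv_mul_metric (hx : (metric F x).det ≠ 0) (i j : Fin n) :
    ∑ k, metricInv F x i k * metric F x k j = if i = j then 1 else 0 := by
  rw [← Matrix.mul_apply, metricInv, Matrix.nonsing_inv_mul _ (isUnit_iff_ne_zero.2 hx),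
    Matrix.one_apply]

lemma pd_metric (hF : ContDiffAt ℝ 2 F x) (k i j : Fin n) :
    pd k (fun y => metric F y i j) x
      = inner ℝ (pd k (pd i F) x) (pd j F x) + inner ℝ (pd i F x) (pd k (pd j F) x) :=
  pd_inner (differentiableAt_pd hF i) (differentiableAt_pd hF j)

lemma christoffel_metric (hF : ContDiffAt ℝ 2 F x) (i j k : Fin n) :
    christoffel (metric F) x i j k
      = ∑ l, metricInv F x k l * inner ℝ (pd i (pd j F) x) (pd l F x) := by
  rw [christoffel, Finset.mul_sum]
  refine Finset.sum_congr rfl fun l _ => ?_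
  rw [pd_metric hF, pd_metric hF, pd_metric hF, pd_comm hF i l, pd_comm hF j l, pd_comm hF j i,
    metricInv, real_inner_comm (pd i (pd j F) x) (pd l F x),
    real_inner_comm (pd l (pd i F) x) (pd j F x),
    real_inner_comm (pd l (pd j F) x) (pd i F x)]
  ring

/-- `v` is orthogonal to the image of `F` at `x`, i.e. to all `∂_k F`. -/
def IsNormalAt (F : E n → V) (x : E n) (v : V) : Prop :=
  ∀ k, (inner ℝ v (pd k F x) : ℝ) = 0

lemma sum_metricInv_mul_inner (hx : (metric F x).det ≠ 0) (c : Fin n → ℝ) (m : Fin n) :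
    ∑ i, ∑ j, metricInv F x i j * c i * inner ℝ (pd j F x) (pd m F x) = c m := by
  calc _ = ∑ i, c i * ∑ j, metricInv F x i j * metric F x j m := by
        simp only [Finset.mul_sum, metric_apply]
        exact Finset.sum_congr rfl fun i _ => Finset.sum_congr rfl fun j _ => by ring
    _ = c m := by simp [sum_metricInv_mul_metric hx]

lemma isNormalAt_normalProj (hx : (metric F x).det ≠ 0) (v : V) :
    IsNormalAt F x (normalProj F x v) := by
  intro k
  simp only [normalProj, inner_sub_left, sum_inner, real_inner_smul_left]
  rw [sum_metricInv_mul_inner hx (fun i => inner ℝ v (pd i F x)), sub_self]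

lemma IsNormalAt.normalProj_eq {v : V} (hv : IsNormalAt F x v) : normalProj F x v = v := by
  simp [normalProj, hv _]

lemma isLinearMap_normalProj (F : E n → V) (x : E n) : IsLinearMap ℝ (normalProj F x) where
  map_add v w := by
    simp only [normalProj, inner_add_left, mul_add, add_smul, Finset.sum_add_distrib]
    abel
  map_smul c v := by
    simp only [normalProj, real_inner_smul_left, mul_left_comm _ c, mul_smul, smul_sub,
      Finset.smul_sum]

lemma normalProj_sum {ι : Type*} (s : Finset ι) (f : ι → V) :
    normalProj F x (∑ a ∈ s, f a) = ∑ a ∈ s, normalProj F x (f a) :=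
  map_sum ((isLinearMap_normalProj F x).mk' _) f s

lemma IsNormalAt.inner_normalProj {w : V} (hw : IsNormalAt F x w) (v : V) :
    (inner ℝ (normalProj F x v) w : ℝ) = inner ℝ v w := by
  simp only [normalProj, inner_sub_left, sum_inner, real_inner_smul_left]
  simp [real_inner_comm w, hw _]

lemma sff_eq_neg_normalProj (hF : ContDiffAt ℝ 2 F x) (i j : Fin n) :
    sff F x i j = -normalProj F x (pd i (pd j F) x) := by
  simp only [sff, normalProj, christoffel_metric hF, Finset.sum_smul]
  rw [Finset.sum_comm]
  simp only [metricInv_symm F x]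

lemma sff_symm (hF : ContDiffAt ℝ 2 F x) (i j : Fin n) : sff F x i j = sff F x j i := by
  rw [sff_eq_neg_normalProj hF, sff_eq_neg_normalProj hF, pd_comm hF]

lemma isNormalAt_sff (hF : ContDiffAt ℝ 2 F x) (hx : (metric F x).det ≠ 0) (i j : Fin n) :
    IsNormalAt F x (sff F x i j) := by
  intro k
  rw [sff_eq_neg_normalProj hF, inner_neg_left, isNormalAt_normalProj hx, neg_zero]

lemma IsNormalAt.inner_pd_pd (hF : ContDiffAt ℝ 2 F x) {w : V} (hw : IsNormalAt F x w)
    (i j : Fin n) : (inner ℝ (pd i (pd j F) x) w : ℝ) = -inner ℝ (sff F x i j) w := by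
  rw [sff_eq_neg_normalProj hF, inner_neg_left, hw.inner_normalProj, neg_neg]

lemma isNormalAt_weingarten (hF : ContDiffAt ℝ 2 F x) (hx : (metric F x).det ≠ 0) (i j : Fin n) :
    IsNormalAt F x (weingarten F x i j) := by
  intro k
  simp [weingarten, sum_inner, real_inner_smul_left, isNormalAt_sff hF hx _ _ _]

lemma isNormalAt_meanCurv (hF : ContDiffAt ℝ 2 F x) (hx : (metric F x).det ≠ 0) :
    IsNormalAt F x (meanCurv F x) := by
  intro k
  simp [meanCurv, sum_inner, isNormalAt_weingarten hF hx _ _ _]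

lemma isNormalAt_nuPlus (hF : ContDiffAt ℝ 2 F x) (hx : (metric F x).det ≠ 0) :
    IsNormalAt F x (nuPlus F x) := by
  intro k
  rw [nuPlus, real_inner_smul_left, isNormalAt_meanCurv hF hx, mul_zero]

lemma hPlus_symm (hF : ContDiffAt ℝ 2 F x) (i j : Fin n) : hPlus F x i j = hPlus F x j i := by
  rw [hPlus, hPlus, sff_symm hF]

lemma norm_nuPlus (hH : meanCurv F x ≠ 0) : ‖nuPlus F x‖ = 1 := by
  simp [nuPlus, norm_smul, hH]

lemma norm_meanCurv_smul_nuPlus (hH : meanCurv F x ≠ 0) :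
    ‖meanCurv F x‖ • nuPlus F x = meanCurv F x := by
  simp [nuPlus, smul_smul, hH]

lemma IsNormalAt.mem_orthogonal_span {v : V} (hv : IsNormalAt F x v) :
    v ∈ (Submodule.span ℝ (Set.range fun i => pd i F x))ᗮ := by
  rw [Submodule.mem_orthogonal']
  intro u hu
  induction hu using Submodule.span_induction with
  | mem u hu => obtain ⟨k, rfl⟩ := hu; exact hv k
  | zero => exact inner_zero_right _
  | add a b _ _ ha hb => rw [inner_add_right, ha, hb, add_zero]
  | smul c a _ ha => rw [real_inner_smul_right, ha, mul_zero]

lemma finrank_orthogonal_span_pd [FiniteDimensional ℝ V] (hx : (metric F x).det ≠ 0) :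
    n + Module.finrank ℝ (Submodule.span ℝ (Set.range fun i => pd i F x))ᗮ
      = Module.finrank ℝ V := by
  have hspan : Module.finrank ℝ (Submodule.span ℝ (Set.range fun i => pd i F x)) = n := by
    simpa using finrank_span_eq_card (det_metric_ne_zero_iff.1 hx)
  simpa only [hspan] using
    Submodule.finrank_add_finrank_orthogonal (Submodule.span ℝ (Set.range fun i => pd i F x))

lemma IsNormalAt.eq_inner_smul_of_finrank (hV : Module.finrank ℝ V = n + 1)
    (hx : (metric F x).det ≠ 0) {v w : V} (hv : IsNormalAt F x v) (hw : IsNormalAt F x w)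
    (hw_norm : ‖w‖ = 1) : v = (inner ℝ v w : ℝ) • w := by
  have : FiniteDimensional ℝ V := Module.finite_of_finrank_eq_succ hV
  have hline : Module.finrank ℝ (Submodule.span ℝ (Set.range fun i => pd i F x))ᗮ = 1 := by
    have := finrank_orthogonal_span_pd hx
    omega
  have hne : (⟨w, hw.mem_orthogonal_span⟩ :
      (Submodule.span ℝ (Set.range fun i => pd i F x))ᗮ) ≠ 0 := by
    intro h
    have hw_zero : w = 0 := congrArg Subtype.val h
    simp [hw_zero] at hw_norm
  obtain ⟨c, hc⟩ :=
    (finrank_eq_one_iff_of_nonzero' _ hne).1 hline ⟨v, hv.mem_orthogonal_span⟩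
  obtain rfl : c • w = v := congrArg Subtype.val hc
  rw [real_inner_smul_left, real_inner_self_eq_norm_sq, hw_norm, one_pow, mul_one]

lemma sum_metricInv_mul_hPlusMixed (j k : Fin n) :
    ∑ l, metricInv F x j l * hPlusMixed F x l k = hPlusUp F x j k := by
  simp only [hPlusMixed, hPlusUp, Finset.mul_sum, mul_assoc]

lemma inner_weingarten_nuPlus (i j : Fin n) :
    (inner ℝ (weingarten F x i j) (nuPlus F x) : ℝ) = hPlusMixed F x i j := by
  simp [weingarten, sum_inner, real_inner_smul_left, hPlusMixed, hPlus]

lemma normSqA_eq_sum_inner_weingarten (hF : ContDiffAt ℝ 2 F x) :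
    normSqA F x = ∑ i, ∑ j, (inner ℝ (weingarten F x i j) (weingarten F x j i) : ℝ) := by
  have hinner (i j : Fin n) : (inner ℝ (weingarten F x i j) (weingarten F x j i) : ℝ)
      = ∑ l, ∑ k, metricInv F x i k * metricInv F x j l * inner ℝ (sff F x i l) (sff F x k j) := by
    simp only [weingarten, sum_inner, inner_sum, real_inner_smul_left, real_inner_smul_right]
    rw [Finset.sum_comm]
    refine Finset.sum_congr rfl fun l _ => Finset.sum_congr rfl fun k _ => ?_
    rw [sff_symm hF j k]
    ring
  simp only [normSqA, hinner]
  refine Finset.sum_congr rfl fun i _ => ?_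
  rw [Finset.sum_congr rfl fun j _ => Finset.sum_comm, Finset.sum_comm]
  simp only [metricInv_symm F x]

lemma sum_hPlusMixed_smul_sffUp (hF : ContDiffAt ℝ 2 F x) (i k : Fin n) :
    ∑ j, hPlusMixed F x j k • sffUp F x i j = ∑ j, hPlusUp F x j k • weingarten F x j i := by
  have hsffUp (j : Fin n) : sffUp F x i j = ∑ q, metricInv F x j q • weingarten F x q i := by
    simp only [sffUp, weingarten, Finset.smul_sum, smul_smul]
    rw [Finset.sum_comm]
    exact Finset.sum_congr rfl fun q _ => Finset.sum_congr rfl fun p _ => by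
      rw [sff_symm hF p q, mul_comm]
  simp only [hsffUp, Finset.smul_sum, smul_smul]
  rw [Finset.sum_comm]
  refine Finset.sum_congr rfl fun q _ => ?_
  simp only [← Finset.sum_smul, ← sum_metricInv_mul_hPlusMixed, metricInv_symm F x q,
    mul_comm (hPlusMixed F x _ k)]

lemma sum_hPlusMixed_mul_inner_sffUp (hF : ContDiffAt ℝ 2 F x) :
    ∑ i, ∑ j, ∑ k, hPlusMixed F x j k * (inner ℝ (sff F x i k) (sffUp F x i j) : ℝ)
      = ∑ i, ∑ j, ∑ k, hPlusUp F x i k * (inner ℝ (weingarten F x i j) (sff F x j k) : ℝ) := by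
  have hinner (i k : Fin n) :
      ∑ j, hPlusMixed F x j k * (inner ℝ (sff F x i k) (sffUp F x i j) : ℝ)
        = ∑ j, hPlusUp F x j k * inner ℝ (weingarten F x j i) (sff F x i k) := by
    simpa only [inner_sum, real_inner_smul_right, real_inner_comm (sff F x i k)] using
      congrArg (fun v => (inner ℝ (sff F x i k) v : ℝ)) (sum_hPlusMixed_smul_sffUp hF i k)
  calc _ = ∑ i, ∑ k, ∑ j, hPlusMixed F x j k * (inner ℝ (sff F x i k) (sffUp F x i j) : ℝ) :=
        Finset.sum_congr rfl fun i _ => Finset.sum_comm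
    _ = ∑ i, ∑ j, ∑ k, hPlusUp F x j k * (inner ℝ (weingarten F x j i) (sff F x i k) : ℝ) := by
        simp only [hinner]
        exact Finset.sum_congr rfl fun i _ => Finset.sum_comm
    _ = _ := Finset.sum_comm

end Pointwise

section Regularity

lemma contDiffAt_matrix_det {X : Type*} [NormedAddCommGroup X] [NormedSpace ℝ X] {x : X} {n : ℕ}
    {p : WithTop ℕ∞} {A : X → Matrix (Fin n) (Fin n) ℝ}
    (hA : ∀ i j, ContDiffAt ℝ p (fun y => A y i j) x) : ContDiffAt ℝ p (fun y => (A y).det) x := by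
  simp only [Matrix.det_apply']
  exact ContDiffAt.sum fun σ _ => contDiffAt_const.mul (contDiffAt_prod fun i _ => hA _ _)

lemma contDiffAt_matrix_inv {X : Type*} [NormedAddCommGroup X] [NormedSpace ℝ X] {x : X} {n : ℕ}
    {p : WithTop ℕ∞} {A : X → Matrix (Fin n) (Fin n) ℝ}
    (hA : ∀ i j, ContDiffAt ℝ p (fun y => A y i j) x) (hx : (A x).det ≠ 0) (i j : Fin n) :
    ContDiffAt ℝ p (fun y => (A y)⁻¹ i j) x := by
  simp only [Matrix.inv_def, Ring.inverse_eq_inv', Matrix.smul_apply, smul_eq_mul,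
    Matrix.adjugate_apply]
  refine ((contDiffAt_matrix_det hA).inv hx).mul (contDiffAt_matrix_det fun a b => ?_)
  obtain rfl | h := eq_or_ne a j
  · simpa only [Matrix.updateRow_self] using contDiffAt_const
  · simpa only [Matrix.updateRow_ne h] using hA a b

variable {n : ℕ} {V : Type} [NormedAddCommGroup V] [InnerProductSpace ℝ V] {F : E n → V}
  {x : E n}

lemma contDiffAt_metric {p q : WithTop ℕ∞} (hF : ContDiffAt ℝ q F x) (hpq : p + 1 ≤ q)
    (i j : Fin n) : ContDiffAt ℝ p (fun y => metric F y i j) x :=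
  (contDiffAt_pd hF hpq i).inner ℝ (contDiffAt_pd hF hpq j)

lemma contDiffAt_metricInv {p q : WithTop ℕ∞} (hF : ContDiffAt ℝ q F x) (hpq : p + 1 ≤ q)
    (hx : (metric F x).det ≠ 0) (i j : Fin n) :
    ContDiffAt ℝ p (fun y => metricInv F y i j) x :=
  contDiffAt_matrix_inv (contDiffAt_metric hF hpq) hx i j

lemma contDiffAt_metricInv_infty (hF : ContDiffAt ℝ ∞ F x) (hx : (metric F x).det ≠ 0)
    (i j : Fin n) : ContDiffAt ℝ ∞ (fun y => metricInv F y i j) x :=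
  contDiffAt_metricInv hF (by simp) hx i j

lemma eventually_det_metric_ne_zero (hF : ContDiffAt ℝ 1 F x)
    (hx : (metric F x).det ≠ 0) : ∀ᶠ y in 𝓝 x, (metric F y).det ≠ 0 :=
  (contDiffAt_matrix_det (contDiffAt_metric (p := 0) hF (by simp))).continuousAt.eventually_ne hx

lemma contDiffAt_christoffel_metric (hF : ContDiffAt ℝ ∞ F x) (hx : (metric F x).det ≠ 0)
    (i j k : Fin n) : ContDiffAt ℝ ∞ (fun y => christoffel (metric F) y i j k) x := by
  have hg (a b c : Fin n) : ContDiffAt ℝ ∞ (pd a fun y => metric F y b c) x :=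
    contDiffAt_pd_infty (contDiffAt_metric hF (by simp) b c) a
  unfold christoffel
  exact contDiffAt_const.mul (ContDiffAt.sum fun l _ =>
    (contDiffAt_metricInv_infty hF hx k l).mul (((hg _ _ _).add (hg _ _ _)).sub (hg _ _ _)))

lemma contDiffAt_sff (hF : ContDiffAt ℝ ∞ F x) (hx : (metric F x).det ≠ 0) (i j : Fin n) :
    ContDiffAt ℝ ∞ (fun y => sff F y i j) x := by
  unfold sff
  exact ((contDiffAt_pd_infty (contDiffAt_pd_infty hF j) i).sub (ContDiffAt.sum fun k _ =>
    (contDiffAt_christoffel_metric hF hx i j k).smul (contDiffAt_pd_infty hF k))).neg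

lemma contDiffAt_meanCurv (hF : ContDiffAt ℝ ∞ F x) (hx : (metric F x).det ≠ 0) :
    ContDiffAt ℝ ∞ (meanCurv F) x := by
  unfold meanCurv weingarten
  exact ContDiffAt.sum fun i _ => ContDiffAt.sum fun l _ =>
    (contDiffAt_metricInv_infty hF hx i l).smul (contDiffAt_sff hF hx i l)

lemma eventually_meanCurv_ne_zero (hF : ContDiffAt ℝ ∞ F x) (hx : (metric F x).det ≠ 0)
    (hH : meanCurv F x ≠ 0) : ∀ᶠ y in 𝓝 x, meanCurv F y ≠ 0 :=
  (contDiffAt_meanCurv hF hx).continuousAt.eventually_ne hH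

lemma contDiffAt_nuPlus (hF : ContDiffAt ℝ ∞ F x) (hx : (metric F x).det ≠ 0)
    (hH : meanCurv F x ≠ 0) : ContDiffAt ℝ ∞ (nuPlus F) x := by
  have h := contDiffAt_meanCurv hF hx
  exact ((h.norm ℝ hH).inv (norm_ne_zero_iff.2 hH)).smul h

lemma contDiffAt_normalProj (hF : ContDiffAt ℝ ∞ F x) (hx : (metric F x).det ≠ 0)
    {f : E n → V} (hf : ContDiffAt ℝ ∞ f x) :
    ContDiffAt ℝ ∞ (fun y => normalProj F y (f y)) x := by
  unfold normalProj
  exact hf.sub (ContDiffAt.sum fun i _ => ContDiffAt.sum fun j _ =>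
    ((contDiffAt_metricInv_infty hF hx i j).mul (hf.inner ℝ (contDiffAt_pd_infty hF i))).smul
      (contDiffAt_pd_infty hF j))

lemma contDiffAt_hPlus (hF : ContDiffAt ℝ ∞ F x) (hx : (metric F x).det ≠ 0)
    (hH : meanCurv F x ≠ 0) (i j : Fin n) : ContDiffAt ℝ ∞ (fun y => hPlus F y i j) x :=
  (contDiffAt_sff hF hx i j).inner ℝ (contDiffAt_nuPlus hF hx hH)

lemma contDiffAt_hPlusMixed (hF : ContDiffAt ℝ ∞ F x) (hx : (metric F x).det ≠ 0)
    (hH : meanCurv F x ≠ 0) (i j : Fin n) : ContDiffAt ℝ ∞ (fun y => hPlusMixed F y i j) x := by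
  unfold hPlusMixed
  exact ContDiffAt.sum fun l _ =>
    (contDiffAt_metricInv_infty hF hx _ _).mul (contDiffAt_hPlus hF hx hH _ _)

end Regularity

section NormalFields

lemma pd_matrix_inv {n p : ℕ} {A : E n → Matrix (Fin p) (Fin p) ℝ} {x : E n}
    (hA : ∀ a b, ContDiffAt ℝ 1 (fun y => A y a b) x) (hx : (A x).det ≠ 0) (j : Fin n)
    (a b : Fin p) :
    pd j (fun y => (A y)⁻¹ a b) x
      = -∑ c, ∑ e, (A x)⁻¹ a c * pd j (fun y => A y c e) x * (A x)⁻¹ e b := by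
  have hA' (a b) : DifferentiableAt ℝ (fun y => A y a b) x := (hA a b).differentiableAt one_ne_zero
  have hI (a b) : DifferentiableAt ℝ (fun y => (A y)⁻¹ a b) x :=
    (contDiffAt_matrix_inv hA hx a b).differentiableAt one_ne_zero
  have hprod (e) : ∑ c, pd j (fun y => (A y)⁻¹ a c) x * A x c e
      = -∑ c, (A x)⁻¹ a c * pd j (fun y => A y c e) x := by
    have h0 : pd j (fun y => ∑ c, (A y)⁻¹ a c * A y c e) x = 0 := by
      rw [pd_congr (g := fun _ => (1 : Matrix (Fin p) (Fin p) ℝ) a e), pd_const]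
      filter_upwards [(contDiffAt_matrix_det hA).continuousAt.eventually_ne hx] with y hy
      rw [← Matrix.mul_apply, Matrix.nonsing_inv_mul _ (isUnit_iff_ne_zero.2 hy)]
    rw [pd_sum fun c _ => (hI a c).fun_mul (hA' c e)] at h0
    simp only [pd_mul (hI a _) (hA' _ e), Finset.sum_add_distrib] at h0
    linarith
  calc pd j (fun y => (A y)⁻¹ a b) x
      = ∑ c, pd j (fun y => (A y)⁻¹ a c) x * ∑ e, A x c e * (A x)⁻¹ e b := by
        simp [← Matrix.mul_apply, Matrix.mul_nonsing_inv _ (isUnit_iff_ne_zero.2 hx),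
          Matrix.one_apply]
    _ = ∑ e, (∑ c, pd j (fun y => (A y)⁻¹ a c) x * A x c e) * (A x)⁻¹ e b := by
        simp only [Finset.mul_sum, Finset.sum_mul, mul_assoc]
        exact Finset.sum_comm
    _ = _ := by
        simp only [hprod, neg_mul, Finset.sum_mul, Finset.sum_neg_distrib]
        rw [Finset.sum_comm]

variable {n : ℕ} {V : Type} [NormedAddCommGroup V] [InnerProductSpace ℝ V] {F : E n → V}
  {x : E n}

lemma pd_metricInv (hF : ContDiffAt ℝ 2 F x) (hx : (metric F x).det ≠ 0) (j a b : Fin n) :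
    pd j (fun y => metricInv F y a b) x
      = -∑ c, ∑ e, metricInv F x a c * pd j (fun y => metric F y c e) x * metricInv F x e b :=
  pd_matrix_inv (contDiffAt_metric hF (by norm_num)) hx j a b

lemma pd_metricInv_eq_christoffel (hF : ContDiffAt ℝ 2 F x) (hx : (metric F x).det ≠ 0)
    (j a b : Fin n) :
    pd j (fun y => metricInv F y a b) x
      = -(∑ c, metricInv F x a c * christoffel (metric F) x j c b)
        - ∑ c, metricInv F x b c * christoffel (metric F) x j c a := by
  simp only [pd_metricInv hF hx, pd_metric hF, christoffel_metric hF, Finset.mul_sum, mul_add,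
    add_mul, Finset.sum_add_distrib, neg_add, sub_eq_add_neg]
  congr 2
  · refine Finset.sum_congr rfl fun c _ => Finset.sum_congr rfl fun e _ => ?_
    rw [metricInv_symm F x e b]
    ring
  · rw [Finset.sum_comm]
    refine Finset.sum_congr rfl fun c _ => Finset.sum_congr rfl fun e _ => ?_
    rw [metricInv_symm F x c b, real_inner_comm]
    ring

lemma inner_pd_of_eventually_isNormalAt (hF : ContDiffAt ℝ 2 F x) {Y : E n → V}
    (hY : DifferentiableAt ℝ Y x) (hn : ∀ᶠ y in 𝓝 x, IsNormalAt F y (Y y)) (k l : Fin n) :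
    (inner ℝ (pd k Y x) (pd l F x) : ℝ) = inner ℝ (Y x) (sff F x k l) := by
  have h0 : pd k (fun y => (inner ℝ (Y y) (pd l F y) : ℝ)) x = 0 := by
    rw [pd_congr (g := fun _ => 0) (hn.mono fun y hy => hy l), pd_const]
  rw [pd_inner hY (differentiableAt_pd hF l), real_inner_comm (pd k (pd l F) x) (Y x),
    hn.self_of_nhds.inner_pd_pd hF, real_inner_comm (Y x)] at h0
  linarith

lemma pd_eq_normalProj_add (hF : ContDiffAt ℝ 2 F x) {Y : E n → V}
    (hY : DifferentiableAt ℝ Y x) (hn : ∀ᶠ y in 𝓝 x, IsNormalAt F y (Y y)) (k : Fin n) :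
    pd k Y x = normalProj F x (pd k Y x)
      + ∑ i, ∑ j, (metricInv F x i j * inner ℝ (Y x) (sff F x k i)) • pd j F x := by
  simp only [normalProj, inner_pd_of_eventually_isNormalAt hF hY hn, sub_add_cancel]

lemma nablaSff_one (j a b : Fin n) :
    nablaSff F 1 x ![j, a, b] = normalProj F x (pd j (fun y => sff F y a b) x)
      - ((∑ k, christoffel (metric F) x j a k • sff F x k b)
        + ∑ k, christoffel (metric F) x j b k • sff F x a k) := by
  have h : nablaSff F 1 x ![j, a, b] = normalProj F x (pd j (fun y => sff F y a b) x)
      - ∑ c : Fin 2, ∑ k, christoffel (metric F) x j ((![a, b] : Fin 2 → Fin n) c) k •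
        sff F x (Function.update (![a, b] : Fin 2 → Fin n) c k 0)
          (Function.update (![a, b] : Fin 2 → Fin n) c k 1) := rfl
  rw [h, Fin.sum_univ_two]
  simp

lemma nablaSff_two (i j a b : Fin n) :
    nablaSff F 2 x ![i, j, a, b]
      = normalProj F x (pd i (fun y => nablaSff F 1 y ![j, a, b]) x)
      - ((∑ k, christoffel (metric F) x i j k • nablaSff F 1 x ![k, a, b])
        + (∑ k, christoffel (metric F) x i a k • nablaSff F 1 x ![j, k, b])
        + ∑ k, christoffel (metric F) x i b k • nablaSff F 1 x ![j, a, k]) := by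
  have h : nablaSff F 2 x ![i, j, a, b]
      = normalProj F x (pd i (fun y => nablaSff F 1 y ![j, a, b]) x)
      - ∑ c : Fin 3, ∑ k, christoffel (metric F) x i ((![j, a, b] : Fin 3 → Fin n) c) k •
        nablaSff F 1 x (Function.update (![j, a, b] : Fin 3 → Fin n) c k) := rfl
  rw [h, Fin.sum_univ_three]
  congr 3

lemma contDiffAt_nablaSff_one (hF : ContDiffAt ℝ ∞ F x) (hx : (metric F x).det ≠ 0)
    (j a b : Fin n) : ContDiffAt ℝ ∞ (fun y => nablaSff F 1 y ![j, a, b]) x := by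
  simp only [nablaSff_one]
  have hΓh (a b c d : Fin n) (e : Fin n) :
      ContDiffAt ℝ ∞ (fun y => christoffel (metric F) y a b e • sff F y c d) x :=
    (contDiffAt_christoffel_metric hF hx a b e).smul (contDiffAt_sff hF hx c d)
  exact (contDiffAt_normalProj hF hx (contDiffAt_pd_infty (contDiffAt_sff hF hx a b) j)).sub
    ((ContDiffAt.sum fun _ _ => hΓh _ _ _ _ _).add (ContDiffAt.sum fun _ _ => hΓh _ _ _ _ _))

lemma isNormalAt_nablaSff_one (hF : ContDiffAt ℝ 2 F x) (hx : (metric F x).det ≠ 0)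
    (j a b : Fin n) : IsNormalAt F x (nablaSff F 1 x ![j, a, b]) := by
  intro k
  simp [nablaSff_one, inner_sub_left, inner_add_left, sum_inner, real_inner_smul_left,
    isNormalAt_normalProj hx _ _, isNormalAt_sff hF hx _ _ _]

lemma sum_pd_metricInv_smul_sff (hF : ContDiffAt ℝ 2 F x) (hx : (metric F x).det ≠ 0)
    (j : Fin n) :
    ∑ a, ∑ b, pd j (fun y => metricInv F y a b) x • sff F x a b
      = -∑ a, ∑ b, metricInv F x a b • ((∑ k, christoffel (metric F) x j a k • sff F x k b)
          + ∑ k, christoffel (metric F) x j b k • sff F x a k) := by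
  simp only [pd_metricInv_eq_christoffel hF hx, sub_smul, neg_smul, Finset.sum_sub_distrib,
    Finset.sum_neg_distrib, smul_add, Finset.sum_add_distrib, Finset.sum_smul, Finset.smul_sum,
    smul_smul]
  rw [neg_add_rev, ← sub_eq_add_neg]
  refine congrArg₂ (fun v w => -v - w) (Finset.sum_congr rfl fun a _ => Finset.sum_comm) ?_
  calc _ = ∑ b, ∑ a, ∑ k, (metricInv F x b k * christoffel (metric F) x j k a) • sff F x a b :=
        Finset.sum_comm
    _ = ∑ b, ∑ a, ∑ k, (metricInv F x b a * christoffel (metric F) x j a k) • sff F x k b :=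
        Finset.sum_congr rfl fun b _ => Finset.sum_comm
    _ = _ := by
        rw [Finset.sum_comm]
        simp only [metricInv_symm F x]

lemma pd_meanCurv_eq_sum (hF : ContDiffAt ℝ 2 F x) (hx : (metric F x).det ≠ 0)
    (hh : ∀ a b, DifferentiableAt ℝ (fun y => sff F y a b) x) (j : Fin n) :
    pd j (meanCurv F) x = ∑ a, ∑ b, (metricInv F x a b • pd j (fun y => sff F y a b) x
      + pd j (fun y => metricInv F y a b) x • sff F x a b) := by
  have hI (a b) : DifferentiableAt ℝ (fun y => metricInv F y a b) x :=
    (contDiffAt_metricInv (p := 1) hF (by norm_num) hx a b).differentiableAt one_ne_zero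
  have hIh (a b) : DifferentiableAt ℝ (fun y => metricInv F y a b • sff F y a b) x :=
    (hI a b).fun_smul (hh a b)
  unfold meanCurv weingarten
  rw [pd_sum fun a _ => DifferentiableAt.fun_sum fun b _ => hIh a b]
  refine Finset.sum_congr rfl fun a _ => ?_
  rw [pd_sum fun b _ => hIh a b]
  exact Finset.sum_congr rfl fun b _ => pd_smul (hI a b) (hh a b)

lemma normalProj_pd_meanCurv (hF : ContDiffAt ℝ 2 F x) (hx : (metric F x).det ≠ 0)
    (hh : ∀ a b, DifferentiableAt ℝ (fun y => sff F y a b) x) (j : Fin n) :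
    normalProj F x (pd j (meanCurv F) x)
      = ∑ a, ∑ b, metricInv F x a b • nablaSff F 1 x ![j, a, b] := by
  have hP := isLinearMap_normalProj F x
  simp only [pd_meanCurv_eq_sum hF hx hh, normalProj_sum, hP.map_add, hP.map_smul,
    (isNormalAt_sff hF hx _ _).normalProj_eq, Finset.sum_add_distrib]
  simp only [sum_pd_metricInv_smul_sff hF hx, nablaSff_one, smul_sub, Finset.sum_sub_distrib,
    ← sub_eq_add_neg]

lemma eventually_isNormalAt_meanCurv (hF : ContDiffAt ℝ 2 F x) (hx : (metric F x).det ≠ 0) :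
    ∀ᶠ y in 𝓝 x, IsNormalAt F y (meanCurv F y) := by
  filter_upwards [hF.eventually (by simp),
    eventually_det_metric_ne_zero (hF.of_le one_le_two) hx] with y hFy hy
  exact isNormalAt_meanCurv hFy hy

lemma pd_meanCurv_eq_normalProj_add (hF : ContDiffAt ℝ 2 F x) (hx : (metric F x).det ≠ 0)
    (hH : DifferentiableAt ℝ (meanCurv F) x) (hH0 : meanCurv F x ≠ 0) (j : Fin n) :
    pd j (meanCurv F) x = normalProj F x (pd j (meanCurv F) x)
      + ‖meanCurv F x‖ • ∑ m, hPlusMixed F x j m • pd m F x := by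
  have hinner (i) : (inner ℝ (meanCurv F x) (sff F x j i) : ℝ)
      = ‖meanCurv F x‖ * hPlus F x j i := by
    rw [hPlus, real_inner_comm, ← real_inner_smul_right, norm_meanCurv_smul_nuPlus hH0]
  conv_lhs => rw [pd_eq_normalProj_add hF hH (eventually_isNormalAt_meanCurv hF hx) j]
  simp only [hinner, hPlusMixed, Finset.smul_sum, Finset.sum_smul, smul_smul,
    mul_left_comm ‖meanCurv F x‖]
  rw [Finset.sum_comm]
  simp only [metricInv_symm F x]

/-- The normal part of `∂_j ν⁺`, obtained from `∂_j H` by projecting to the normal space and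
then removing the component along `ν⁺`. -/
def nuDefect (F : E n → V) (j : Fin n) (x : E n) : V :=
  ‖meanCurv F x‖⁻¹ • (normalProj F x (pd j (meanCurv F) x)
    - (inner ℝ (normalProj F x (pd j (meanCurv F) x)) (nuPlus F x) : ℝ) • nuPlus F x)

lemma inner_pd_nuPlus_pd (hF : ContDiffAt ℝ 2 F x) (hx : (metric F x).det ≠ 0)
    (hν : DifferentiableAt ℝ (nuPlus F) x) (i j : Fin n) :
    (inner ℝ (pd i (nuPlus F) x) (pd j F x) : ℝ) = hPlus F x i j := by
  rw [inner_pd_of_eventually_isNormalAt hF hν, real_inner_comm, hPlus]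
  filter_upwards [hF.eventually (by simp),
    eventually_det_metric_ne_zero (hF.of_le one_le_two) hx] with y hFy hy
  exact isNormalAt_nuPlus hFy hy

lemma inner_nuPlus_pd_nuPlus (hν : DifferentiableAt ℝ (nuPlus F) x)
    (hH0 : ∀ᶠ y in 𝓝 x, meanCurv F y ≠ 0) (j : Fin n) :
    (inner ℝ (nuPlus F x) (pd j (nuPlus F) x) : ℝ) = 0 := by
  have h0 : pd j (fun y => (inner ℝ (nuPlus F y) (nuPlus F y) : ℝ)) x = 0 := by
    rw [pd_congr (g := fun _ => 1) (hH0.mono fun y hy => ?_), pd_const]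
    rw [real_inner_self_eq_norm_sq, norm_nuPlus hy, one_pow]
  rw [pd_inner hν hν, real_inner_comm] at h0
  linarith

lemma pd_norm_meanCurv (hH : DifferentiableAt ℝ (meanCurv F) x) (hH0 : meanCurv F x ≠ 0)
    (j : Fin n) :
    pd j (fun y => ‖meanCurv F y‖) x = inner ℝ (pd j (meanCurv F) x) (nuPlus F x) := by
  have hN : DifferentiableAt ℝ (fun y => ‖meanCurv F y‖) x := hH.norm ℝ hH0
  have hsq : pd j (fun y => (inner ℝ (meanCurv F y) (meanCurv F y) : ℝ)) x
      = pd j (fun y => ‖meanCurv F y‖ * ‖meanCurv F y‖) x := by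
    simp only [real_inner_self_eq_norm_mul_norm]
  rw [pd_inner hH hH, pd_mul hN hN, real_inner_comm (pd j (meanCurv F) x)] at hsq
  have hH1 : ‖meanCurv F x‖ ≠ 0 := norm_ne_zero_iff.2 hH0
  rw [nuPlus, real_inner_smul_right]
  field_simp
  linarith

lemma pd_nuPlus_eq_smul_pd_meanCurv (hH : DifferentiableAt ℝ (meanCurv F) x)
    (hH0 : meanCurv F x ≠ 0) (j : Fin n) :
    pd j (nuPlus F) x = ‖meanCurv F x‖⁻¹ • (pd j (meanCurv F) x
      - (inner ℝ (pd j (meanCurv F) x) (nuPlus F x) : ℝ) • nuPlus F x) := by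
  have hN : DifferentiableAt ℝ (fun y => ‖meanCurv F y‖) x := hH.norm ℝ hH0
  have hν : DifferentiableAt ℝ (nuPlus F) x := (hN.inv (norm_ne_zero_iff.2 hH0)).smul hH
  have hprod : pd j (meanCurv F) x = ‖meanCurv F x‖ • pd j (nuPlus F) x
      + pd j (fun y => ‖meanCurv F y‖) x • nuPlus F x := by
    rw [← pd_smul hN hν]
    exact pd_congr ((hH.continuousAt.eventually_ne hH0).mono fun y hy =>
      (norm_meanCurv_smul_nuPlus hy).symm)
  rw [← pd_norm_meanCurv hH hH0, hprod, add_sub_cancel_right, smul_smul,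
    inv_mul_cancel₀ (norm_ne_zero_iff.2 hH0), one_smul]

lemma pd_nuPlus (hF : ContDiffAt ℝ 2 F x) (hx : (metric F x).det ≠ 0)
    (hH : DifferentiableAt ℝ (meanCurv F) x) (hH0 : meanCurv F x ≠ 0) (j : Fin n) :
    pd j (nuPlus F) x = ∑ m, hPlusMixed F x j m • pd m F x + nuDefect F j x := by
  rw [pd_nuPlus_eq_smul_pd_meanCurv hH hH0, nuDefect,
    (isNormalAt_nuPlus hF hx).inner_normalProj, smul_sub, smul_sub]
  conv_lhs => enter [1, 2]; rw [pd_meanCurv_eq_normalProj_add hF hx hH hH0]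
  rw [smul_add, smul_smul, inv_mul_cancel₀ (norm_ne_zero_iff.2 hH0), one_smul]
  abel

lemma contDiffAt_nuDefect (hF : ContDiffAt ℝ ∞ F x) (hx : (metric F x).det ≠ 0)
    (hH : meanCurv F x ≠ 0) (j : Fin n) : ContDiffAt ℝ ∞ (nuDefect F j) x := by
  have h := contDiffAt_meanCurv hF hx
  have hν := contDiffAt_nuPlus hF hx hH
  have hP := contDiffAt_normalProj hF hx (contDiffAt_pd_infty h j)
  exact ((h.norm ℝ hH).inv (norm_ne_zero_iff.2 hH)).smul (hP.sub ((hP.inner ℝ hν).smul hν))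

lemma eventually_pd_nuPlus (hF : ContDiffAt ℝ ∞ F x) (hx : (metric F x).det ≠ 0)
    (hH : meanCurv F x ≠ 0) (j : Fin n) : ∀ᶠ y in 𝓝 x,
      pd j (nuPlus F) y = ∑ m, hPlusMixed F y j m • pd m F y + nuDefect F j y := by
  have hF2 : ContDiffAt ℝ 2 F x := hF.of_le (by norm_cast)
  filter_upwards [hF2.eventually (by simp),
    eventually_det_metric_ne_zero (hF2.of_le one_le_two) hx,
    eventually_differentiableAt ((contDiffAt_meanCurv hF hx).of_le (by norm_cast)),
    eventually_meanCurv_ne_zero hF hx hH] with y hFy hy hHy hHy0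
  exact pd_nuPlus hFy hy hHy hHy0 j

lemma pd_pd_nuPlus (hF : ContDiffAt ℝ ∞ F x) (hx : (metric F x).det ≠ 0)
    (hH : meanCurv F x ≠ 0) (i j : Fin n) :
    pd i (pd j (nuPlus F)) x = ∑ m, (hPlusMixed F x j m • pd i (pd m F) x
      + pd i (fun y => hPlusMixed F y j m) x • pd m F x) + pd i (nuDefect F j) x := by
  have hh (m) : DifferentiableAt ℝ (fun y => hPlusMixed F y j m) x :=
    (contDiffAt_hPlusMixed hF hx hH j m).differentiableAt (by simp)
  have hm (m) : DifferentiableAt ℝ (pd m F) x :=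
    (contDiffAt_pd_infty hF m).differentiableAt (by simp)
  have hd (m) : DifferentiableAt ℝ (fun y => hPlusMixed F y j m • pd m F y) x :=
    (hh m).fun_smul (hm m)
  rw [pd_congr (eventually_pd_nuPlus hF hx hH j), pd_add (DifferentiableAt.fun_sum fun m _ => hd m)
    ((contDiffAt_nuDefect hF hx hH j).differentiableAt (by simp)), pd_sum fun m _ => hd m]
  simp only [pd_smul (hh _) (hm _)]

lemma pd_normalProj_pd_meanCurv (hF : ContDiffAt ℝ ∞ F x) (hx : (metric F x).det ≠ 0)
    (i j : Fin n) :
    pd i (fun y => normalProj F y (pd j (meanCurv F) y)) x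
      = ∑ a, ∑ b, (metricInv F x a b • pd i (fun y => nablaSff F 1 y ![j, a, b]) x
        + pd i (fun y => metricInv F y a b) x • nablaSff F 1 x ![j, a, b]) := by
  have hI (a b) : DifferentiableAt ℝ (fun y => metricInv F y a b) x :=
    (contDiffAt_metricInv_infty hF hx a b).differentiableAt (by simp)
  have hh (a b) : DifferentiableAt ℝ (fun y => nablaSff F 1 y ![j, a, b]) x :=
    (contDiffAt_nablaSff_one hF hx j a b).differentiableAt (by simp)
  have hIh (a b) := (hI a b).fun_smul (hh a b)
  have hsff : ∀ᶠ y in 𝓝 x, ∀ a b, DifferentiableAt ℝ (fun y => sff F y a b) y :=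
    eventually_all.2 fun a => eventually_all.2 fun b =>
      eventually_differentiableAt ((contDiffAt_sff hF hx a b).of_le (by norm_cast))
  have htrace : ∀ᶠ y in 𝓝 x, normalProj F y (pd j (meanCurv F) y)
      = ∑ a, ∑ b, metricInv F y a b • nablaSff F 1 y ![j, a, b] := by
    have hF2 : ContDiffAt ℝ 2 F x := hF.of_le (by norm_cast)
    filter_upwards [hF2.eventually (by simp),
      eventually_det_metric_ne_zero (hF2.of_le one_le_two) hx, hsff] with y hFy hy hsffy
    exact normalProj_pd_meanCurv hFy hy hsffy j
  rw [pd_congr htrace, pd_sum fun a _ => DifferentiableAt.fun_sum fun b _ => hIh a b]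
  refine Finset.sum_congr rfl fun a _ => ?_
  rw [pd_sum fun b _ => hIh a b]
  exact Finset.sum_congr rfl fun b _ => pd_smul (hI a b) (hh a b)

lemma pd_nuDefect (hF : ContDiffAt ℝ ∞ F x) (hx : (metric F x).det ≠ 0)
    (hH : meanCurv F x ≠ 0) {Y : E n → V} {j : Fin n}
    (hY : Y = fun y => normalProj F y (pd j (meanCurv F) y)) (i : Fin n) :
    pd i (nuDefect F j) x = ‖meanCurv F x‖⁻¹ • ((pd i Y x
      - ((inner ℝ (Y x) (nuPlus F x) : ℝ) • pd i (nuPlus F) x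
        + (inner ℝ (pd i Y x) (nuPlus F x) + inner ℝ (Y x) (pd i (nuPlus F) x) : ℝ) •
          nuPlus F x))
      - pd i (fun y => ‖meanCurv F y‖) x • nuDefect F j x) := by
  have hHd := contDiffAt_meanCurv hF hx
  have hν : DifferentiableAt ℝ (nuPlus F) x :=
    (contDiffAt_nuPlus hF hx hH).differentiableAt (by simp)
  have hYd : DifferentiableAt ℝ Y x := hY ▸
    (contDiffAt_normalProj hF hx (contDiffAt_pd_infty hHd j)).differentiableAt (by simp)
  have hN : DifferentiableAt ℝ (fun y => ‖meanCurv F y‖) x :=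
    (hHd.differentiableAt (by simp)).norm ℝ hH
  have hprod : pd i (fun y => ‖meanCurv F y‖ • nuDefect F j y) x
      = pd i (fun y => Y y - (inner ℝ (Y y) (nuPlus F y) : ℝ) • nuPlus F y) x := by
    refine pd_congr ((eventually_meanCurv_ne_zero hF hx hH).mono fun y hy => ?_)
    simp only [nuDefect, hY]
    rw [smul_smul, mul_inv_cancel₀ (norm_ne_zero_iff.2 hy), one_smul]
  rw [pd_smul hN ((contDiffAt_nuDefect hF hx hH j).differentiableAt (by simp)),
    pd_sub hYd ((hYd.inner ℝ hν).fun_smul hν), pd_smul (hYd.inner ℝ hν) hν,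
    pd_inner hYd hν] at hprod
  rw [← hprod, add_sub_cancel_right, smul_smul, inv_mul_cancel₀ (norm_ne_zero_iff.2 hH), one_smul]

lemma pd_nuDefect_of_finrank (hV : Module.finrank ℝ V = n + 1)
    (hF : ContDiffAt ℝ ∞ F x) (hx : (metric F x).det ≠ 0)
    (hH : meanCurv F x ≠ 0) (i j : Fin n) : pd i (nuDefect F j) x = 0 := by
  have hF2 : ContDiffAt ℝ 2 F x := hF.of_le (by norm_cast)
  rw [pd_congr (g := fun _ => 0), pd_const]
  filter_upwards [hF2.eventually (by simp),
    eventually_det_metric_ne_zero (hF2.of_le one_le_two) hx,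
    eventually_meanCurv_ne_zero hF hx hH] with y hFy hy hHy
  rw [nuDefect, ← (isNormalAt_normalProj hy _).eq_inner_smul_of_finrank hV hy
    (isNormalAt_nuPlus hFy hy) (norm_nuPlus hHy), sub_self, smul_zero]

end NormalFields

section BigO

variable {α : Type*} {l : Filter α} {W : Type*} [NormedAddCommGroup W] [InnerProductSpace ℝ W]
  {e a b : α → ℝ}

lemma isBigO_inner {f g : α → W} (hf : f =O[l] a) (hg : g =O[l] b) :
    (fun x => (inner ℝ (f x) (g x) : ℝ)) =O[l] fun x => a x * b x := by
  refine (isBigO_of_le l fun x => ?_).trans (hf.norm_left.mul hg.norm_left)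
  rw [Real.norm_of_nonneg (by positivity : (0 : ℝ) ≤ ‖f x‖ * ‖g x‖)]
  exact norm_inner_le_norm _ _

lemma isBigO_one_inner {f g : α → W} (hf : f =O[l] fun _ => (1 : ℝ)) (hg : g =O[l] e) :
    (fun x => (inner ℝ (f x) (g x) : ℝ)) =O[l] e := by
  simpa only [one_mul] using isBigO_inner hf hg

lemma isBigO_inner_one {f g : α → W} (hf : f =O[l] e) (hg : g =O[l] fun _ => (1 : ℝ)) :
    (fun x => (inner ℝ (f x) (g x) : ℝ)) =O[l] e := by
  simpa only [mul_one] using isBigO_inner hf hg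

lemma isBigO_one_smul {c : α → ℝ} {f : α → W} (hc : c =O[l] fun _ => (1 : ℝ)) (hf : f =O[l] e) :
    (fun x => c x • f x) =O[l] e := by
  simpa only [smul_eq_mul, one_mul] using hc.smul hf

lemma isBigO_smul_one {c : α → ℝ} {f : α → W} (hc : c =O[l] e) (hf : f =O[l] fun _ => (1 : ℝ)) :
    (fun x => c x • f x) =O[l] e := by
  simpa only [smul_eq_mul, mul_one] using hc.smul hf

lemma isBigO_one_mul {c f : α → ℝ} (hc : c =O[l] fun _ => (1 : ℝ)) (hf : f =O[l] e) :
    (fun x => c x * f x) =O[l] e :=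
  isBigO_one_smul hc hf

lemma isBigO_mul_one {c f : α → ℝ} (hc : c =O[l] e) (hf : f =O[l] fun _ => (1 : ℝ)) :
    (fun x => c x * f x) =O[l] e :=
  isBigO_smul_one hc hf

end BigO

section Coercive

open Matrix

variable {ι : Type*} [Fintype ι] [DecidableEq ι] {A : Matrix ι ι ℝ} {c η : ℝ}

lemma mul_dotProduct_self_le_of_abs_sub_diagonal_le {a : ι → ℝ} (ha : ∀ i, c ≤ a i)
    (hη : 0 ≤ η) (hA : ∀ i j, |A i j - diagonal a i j| ≤ η) (ξ : ι → ℝ) :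
    (c - Fintype.card ι * η) * (ξ ⬝ᵥ ξ) ≤ ξ ⬝ᵥ A *ᵥ ξ := by
  have hdiag : c * (ξ ⬝ᵥ ξ) ≤ ξ ⬝ᵥ diagonal a *ᵥ ξ := by
    simp only [dotProduct, mulVec_diagonal, Finset.mul_sum]
    exact Finset.sum_le_sum fun i _ => by nlinarith [ha i, mul_self_nonneg (ξ i)]
  have hoff : |ξ ⬝ᵥ (A - diagonal a) *ᵥ ξ| ≤ η * (Fintype.card ι * (ξ ⬝ᵥ ξ)) := by
    calc |ξ ⬝ᵥ (A - diagonal a) *ᵥ ξ|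
        ≤ ∑ i, |ξ i| * ∑ j, η * |ξ j| := by
          refine (Finset.abs_sum_le_sum_abs _ _).trans (Finset.sum_le_sum fun i _ => ?_)
          rw [abs_mul]
          refine mul_le_mul_of_nonneg_left ((Finset.abs_sum_le_sum_abs _ _).trans
            (Finset.sum_le_sum fun j _ => ?_)) (abs_nonneg _)
          rw [abs_mul]
          exact mul_le_mul_of_nonneg_right (hA i j) (abs_nonneg _)
      _ = η * (∑ i, |ξ i|) ^ 2 := by rw [← Finset.mul_sum, ← Finset.sum_mul]; ring
      _ ≤ η * (Fintype.card ι * ∑ i, |ξ i| ^ 2) :=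
          mul_le_mul_of_nonneg_left sq_sum_le_card_mul_sum_sq hη
      _ = η * (Fintype.card ι * (ξ ⬝ᵥ ξ)) := by simp only [dotProduct, sq, abs_mul_abs_self]
  have hsplit : ξ ⬝ᵥ A *ᵥ ξ = ξ ⬝ᵥ diagonal a *ᵥ ξ + ξ ⬝ᵥ (A - diagonal a) *ᵥ ξ := by
    rw [← dotProduct_add, ← add_mulVec, add_sub_cancel]
  linarith [(abs_le.1 hoff).1]

lemma det_ne_zero_of_coercive (hc : 0 < c) (hA : ∀ ξ : ι → ℝ, c * (ξ ⬝ᵥ ξ) ≤ ξ ⬝ᵥ A *ᵥ ξ) :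
    A.det ≠ 0 := by
  intro h
  obtain ⟨ξ, hξ, h0⟩ := exists_mulVec_eq_zero_iff.2 h
  have hle : c * (ξ ⬝ᵥ ξ) ≤ 0 := by simpa [h0] using hA ξ
  have hnonneg : 0 ≤ ξ ⬝ᵥ ξ := Finset.sum_nonneg fun i _ => mul_self_nonneg (ξ i)
  exact hξ (dotProduct_self_eq_zero.1 (by nlinarith))

lemma abs_inv_le_of_coercive (hc : 0 < c) (hA : ∀ ξ : ι → ℝ, c * (ξ ⬝ᵥ ξ) ≤ ξ ⬝ᵥ A *ᵥ ξ)
    (i j : ι) : |A⁻¹ i j| ≤ 1 / c := by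
  have hcol : A *ᵥ A⁻¹.col j = Pi.single j 1 := by
    rw [← mulVec_single_one, mulVec_mulVec,
      mul_nonsing_inv _ (isUnit_iff_ne_zero.2 (det_ne_zero_of_coercive hc hA)), one_mulVec]
  have hsq (k : ι) : c * A⁻¹ k j ^ 2 ≤ A⁻¹ j j := by
    have hk : A⁻¹ k j * A⁻¹ k j ≤ A⁻¹.col j ⬝ᵥ A⁻¹.col j :=
      Finset.single_le_sum (f := fun k => A⁻¹.col j k * A⁻¹.col j k)
        (fun k _ => mul_self_nonneg _) (Finset.mem_univ k)
    have hcoercive := hA (A⁻¹.col j)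
    rw [hcol, dotProduct_single_one, col_apply] at hcoercive
    nlinarith
  have hj0 : 0 ≤ A⁻¹ j j := le_trans (by positivity) (hsq j)
  have hj1 : c * A⁻¹ j j ≤ 1 := by
    by_contra! h
    nlinarith [hsq j, hj0]
  rw [le_div_iff₀ hc, mul_comm, ← abs_of_pos hc, ← abs_mul, ← abs_one, ← sq_le_sq]
  nlinarith [hsq i]

lemma inv_apply_sub_inv_apply {B : Matrix ι ι ℝ} (hA : A.det ≠ 0) (hB : B.det ≠ 0) (i j : ι) :
    A⁻¹ i j - B⁻¹ i j = -∑ a, ∑ b, A⁻¹ i a * (A a b - B a b) * B⁻¹ b j := by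
  have h : A⁻¹ - B⁻¹ = -(A⁻¹ * (A - B) * B⁻¹) := by
    rw [mul_sub, nonsing_inv_mul _ (isUnit_iff_ne_zero.2 hA), sub_mul, one_mul, Matrix.mul_assoc,
      mul_nonsing_inv _ (isUnit_iff_ne_zero.2 hB), mul_one, neg_sub]
  rw [← Matrix.sub_apply, h, Matrix.neg_apply, Matrix.mul_apply, Finset.sum_comm]
  simp only [Matrix.mul_apply, Finset.sum_mul, Matrix.sub_apply]

end Coercive

section Bend

/-- The graph deformation `F - τ u(x⁰) ν⁺` of a map `F` along its principal normal, where `x⁰` is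
the axial coordinate. -/
def bend {d : ℕ} {V : Type} [NormedAddCommGroup V] [InnerProductSpace ℝ V] (F : E (d + 1) → V)
    (τ : ℝ) (u : ℝ → ℝ) (x : E (d + 1)) : V :=
  F x - (τ * u (x 0)) • nuPlus F x

lemma sum_cylWeingarten_mul {d : ℕ} (i j : Fin (d + 1)) :
    ∑ k, (cylWeingarten i k : ℝ) * cylWeingarten j k = cylWeingarten i j := by
  have h (i k : Fin (d + 1)) :
      (cylWeingarten i k : ℝ) = if i = k then (if i = 0 then 0 else 1) else 0 := by
    by_cases hi : i = 0 <;> by_cases hk : k = 0 <;> by_cases hik : i = k <;>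
      simp_all [cylWeingarten, dz]
  simp only [h]
  by_cases hi : i = 0 <;> by_cases hij : j = i <;> simp_all [eq_comm]

variable {d : ℕ} {V : Type} [NormedAddCommGroup V] [InnerProductSpace ℝ V] {F : E (d + 1) → V}
  {τ : ℝ} {u : ℝ → ℝ} {x : E (d + 1)}

lemma contDiffAt_comp_apply_zero {k : WithTop ℕ∞} (hu : ContDiffAt ℝ k u (x 0)) :
    ContDiffAt ℝ k (fun y : E (d + 1) => u (y 0)) x :=
  ContDiffAt.comp x hu (EuclideanSpace.proj (𝕜 := ℝ) (0 : Fin (d + 1))).contDiff.contDiffAt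

lemma contDiffAt_bend {k : WithTop ℕ∞} (hF : ContDiffAt ℝ k F x)
    (hν : ContDiffAt ℝ k (nuPlus F) x) (hu : ContDiffAt ℝ k u (x 0)) :
    ContDiffAt ℝ k (bend F τ u) x :=
  hF.sub ((contDiffAt_const.mul (contDiffAt_comp_apply_zero hu)).smul hν)

lemma pd_bend (hF : DifferentiableAt ℝ F x) (hν : DifferentiableAt ℝ (nuPlus F) x)
    (hu : DifferentiableAt ℝ u (x 0)) (i : Fin (d + 1)) :
    pd i (bend F τ u) x = pd i F x - ((τ * u (x 0)) • pd i (nuPlus F) x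
      + (dz i * (τ * deriv u (x 0))) • nuPlus F x) := by
  have hτu : DifferentiableAt ℝ (fun y : E (d + 1) => τ * u (y 0)) x :=
    (DifferentiableAt.comp x hu
      (EuclideanSpace.proj (𝕜 := ℝ) (0 : Fin (d + 1))).differentiableAt).const_mul τ
  unfold bend
  rw [pd_sub hF (hτu.fun_smul hν), pd_smul hτu hν,
    pd_comp_apply_zero (f := fun s => τ * u s) (hu.const_mul τ), deriv_const_mul _ hu]

lemma pd_pd_bend (hF : ContDiffAt ℝ 2 F x) (hν : ContDiffAt ℝ 2 (nuPlus F) x)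
    (hu : ContDiffAt ℝ 2 u (x 0)) (i j : Fin (d + 1)) :
    pd i (pd j (bend F τ u)) x = pd i (pd j F) x
      - ((τ * u (x 0)) • pd i (pd j (nuPlus F)) x
        + (dz i * (τ * deriv u (x 0))) • pd j (nuPlus F) x
        + (dz j * (τ * deriv u (x 0))) • pd i (nuPlus F) x
        + (dz i * dz j * (τ * deriv (deriv u) (x 0))) • nuPlus F x) := by
  have heventually : ∀ᶠ y in 𝓝 x, pd j (bend F τ u) y = pd j F y
      - ((τ * u (y 0)) • pd j (nuPlus F) y + (dz j * (τ * deriv u (y 0))) • nuPlus F y) := by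
    have hx0 : Tendsto (fun y : E (d + 1) => y 0) (𝓝 x) (𝓝 (x 0)) :=
      (EuclideanSpace.proj (𝕜 := ℝ) (0 : Fin (d + 1))).continuous.tendsto x
    filter_upwards [eventually_differentiableAt (hF.of_le one_le_two),
      eventually_differentiableAt (hν.of_le one_le_two),
      hx0.eventually (hu.eventually (by simp))] with y hFy hνy huy
    exact pd_bend hFy hνy (huy.differentiableAt two_ne_zero) j
  have hu' : ContDiffAt ℝ 1 (deriv u) (x 0) :=
    (hu.fderiv_right (m := 1) (by norm_num)).clm_apply contDiffAt_const
  have hc : DifferentiableAt ℝ (fun y : E (d + 1) => τ * u (y 0)) x :=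
    ((contDiffAt_comp_apply_zero hu).differentiableAt two_ne_zero).const_mul τ
  have hc' : DifferentiableAt ℝ (fun y : E (d + 1) => dz j * (τ * deriv u (y 0))) x :=
    (((contDiffAt_comp_apply_zero hu').differentiableAt one_ne_zero).const_mul τ).const_mul _
  have hν₀ := hν.differentiableAt two_ne_zero
  have hν₁ := differentiableAt_pd hν j
  have hu₀ := hu.differentiableAt two_ne_zero
  have hu₁ := hu'.differentiableAt one_ne_zero
  rw [pd_congr heventually, pd_sub (differentiableAt_pd hF j)
    ((hc.fun_smul hν₁).fun_add (hc'.fun_smul hν₀)), pd_add (hc.fun_smul hν₁) (hc'.fun_smul hν₀),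
    pd_smul hc hν₁, pd_smul hc' hν₀,
    pd_comp_apply_zero (f := fun s => τ * u s) (hu₀.const_mul τ), deriv_const_mul _ hu₀,
    pd_comp_apply_zero (f := fun s => dz j * (τ * deriv u s)) ((hu₁.const_mul τ).const_mul _),
    deriv_const_mul _ (hu₁.const_mul τ), deriv_const_mul _ hu₁]
  module

lemma metric_bend (hF : ContDiffAt ℝ 2 F x) (hx : (metric F x).det ≠ 0)
    (hH : DifferentiableAt ℝ (meanCurv F) x) (hH₀ : meanCurv F x ≠ 0)
    (hu : DifferentiableAt ℝ u (x 0)) (i j : Fin (d + 1)) :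
    metric (bend F τ u) x i j = metric F x i j - 2 * (τ * u (x 0)) * hPlus F x i j
      + ((τ * u (x 0)) ^ 2 * inner ℝ (pd i (nuPlus F) x) (pd j (nuPlus F) x)
        + dz i * dz j * (τ * deriv u (x 0)) ^ 2) := by
  have hν : DifferentiableAt ℝ (nuPlus F) x :=
    ((hH.norm ℝ hH₀).inv (norm_ne_zero_iff.2 hH₀)).smul hH
  have hpd := pd_bend (τ := τ) (hF.differentiableAt two_ne_zero) hν hu
  have hνν (k) := inner_nuPlus_pd_nuPlus hν (hH.continuousAt.eventually_ne hH₀) k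
  have hnorm : (inner ℝ (nuPlus F x) (nuPlus F x) : ℝ) = 1 := by
    rw [real_inner_self_eq_norm_sq, norm_nuPlus hH₀, one_pow]
  simp only [metric_apply, hpd, inner_sub_left, inner_sub_right, inner_add_left, inner_add_right,
    real_inner_smul_left, real_inner_smul_right, inner_pd_nuPlus_pd hF hx hν,
    real_inner_comm (pd _ (nuPlus F) x) (pd _ F x), real_inner_comm (nuPlus F x) (pd _ F x),
    real_inner_comm (nuPlus F x) (pd _ (nuPlus F) x), isNormalAt_nuPlus hF hx _, hνν, hnorm,
    hPlus_symm hF j i]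
  ring

end Bend

section BendData

/-- An immersion `F` whose geometry at `0` is `K ε`-close to that of the unit cylinder, together
with the parameter `τ` and the function `u` of a bending deformation. It is a neck seen in
coordinates centred at one of its points, after rescaling to mean radius one. In codimension one
no bound on the second covariant derivative of the curvature is required. -/
structure BendData (d : ℕ) (V : Type) [NormedAddCommGroup V] [InnerProductSpace ℝ V]
    (θ K : ℝ) where
  F : E (d + 1) → V
  ε : ℝ
  τ : ℝ
  u : ℝ → ℝ
  axis : V
  smooth : ContDiffAt ℝ ∞ F 0
  det_ne_zero : (metric F 0).det ≠ 0
  metric_close : ∀ i j, |metric F 0 i j - if i = j then 1 else 0| ≤ K * |ε|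
  deriv_metric : ∀ k i j, |pd k (fun y => metric F y i j) 0| ≤ K * |ε|
  norm_axis : ‖axis‖ = 1
  sff_close : ∀ i j, ‖sff F 0 i j - cylWeingarten i j • axis‖ ≤ K * |ε|
  nabla_one : ∀ I, ‖nablaSff F 1 0 I‖ ≤ K * |ε|
  nabla_two : Module.finrank ℝ V = d + 2 ∨ ∀ I, ‖nablaSff F 2 0 I‖ ≤ K * |ε|
  u_smooth : ContDiffAt ℝ 2 u 0
  u_bound : |τ| * (|u 0| + |deriv u 0|) ≤ θ

end BendData

namespace BendData

variable {d : ℕ} {V : Type} [NormedAddCommGroup V] [InnerProductSpace ℝ V] {θ K : ℝ}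

/-- The filter on bending data along which `ε` tends to zero. An estimate `f =O[nearCylinder] ε` is
a bound whose constant depends only on `d`, `V`, `θ` and `K`. -/
def nearCylinder (d : ℕ) (V : Type) [NormedAddCommGroup V] [InnerProductSpace ℝ V] (θ K : ℝ) :
    Filter (BendData d V θ K) :=
  comap ε (𝓝 0)

local notation "𝓛" => nearCylinder d V θ K

lemma tendsto_ε : Tendsto ε 𝓛 (𝓝 0) := tendsto_comap

lemma isBigO_ε : ε =O[𝓛] fun _ => (1 : ℝ) := tendsto_ε.isBigO_one ℝ

section Regularity

variable (D : BendData d V θ K)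

lemma smooth_two : ContDiffAt ℝ 2 D.F 0 := D.smooth.of_le (by norm_cast)

lemma differentiableAt_metricInv (i j : Fin (d + 1)) :
    DifferentiableAt ℝ (fun y => metricInv D.F y i j) 0 :=
  (contDiffAt_metricInv_infty D.smooth D.det_ne_zero i j).differentiableAt (by simp)

lemma differentiableAt_sff (i j : Fin (d + 1)) : DifferentiableAt ℝ (fun y => sff D.F y i j) 0 :=
  (contDiffAt_sff D.smooth D.det_ne_zero i j).differentiableAt (by simp)

lemma differentiableAt_meanCurv : DifferentiableAt ℝ (meanCurv D.F) 0 :=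
  (contDiffAt_meanCurv D.smooth D.det_ne_zero).differentiableAt (by simp)

variable {D}

lemma differentiableAt_nuPlus (hD : meanCurv D.F 0 ≠ 0) : DifferentiableAt ℝ (nuPlus D.F) 0 :=
  (contDiffAt_nuPlus D.smooth D.det_ne_zero hD).differentiableAt (by simp)

lemma differentiableAt_hPlus (hD : meanCurv D.F 0 ≠ 0) (i j : Fin (d + 1)) :
    DifferentiableAt ℝ (fun y => hPlus D.F y i j) 0 :=
  (contDiffAt_hPlus D.smooth D.det_ne_zero hD i j).differentiableAt (by simp)

end Regularity

lemma isBigO_metric_sub (i j : Fin (d + 1)) :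
    (fun D => metric D.F 0 i j - if i = j then 1 else 0) =O[𝓛] ε :=
  isBigO_of_le' _ fun D => D.metric_close i j

lemma isBigO_metric (i j : Fin (d + 1)) :
    (fun D => metric D.F 0 i j) =O[𝓛] fun _ => (1 : ℝ) := by
  simpa using ((isBigO_metric_sub i j).trans isBigO_ε).add
    (isBigO_const_one ℝ (if i = j then (1 : ℝ) else 0) _)

lemma isBigO_pd_metric (k i j : Fin (d + 1)) :
    (fun D => pd k (fun y => metric D.F y i j) 0) =O[𝓛] ε :=
  isBigO_of_le' _ fun D => D.deriv_metric k i j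

lemma isBigO_pd (i : Fin (d + 1)) : (fun D => pd i D.F 0) =O[𝓛] fun _ => (1 : ℝ) := by
  refine (isBigO_of_le (g := fun D => 1 + metric D.F 0 i i) _ fun D => ?_).trans
    ((isBigO_const_one ℝ (1 : ℝ) _).add (isBigO_metric i i))
  rw [metric_apply, real_inner_self_eq_norm_sq, Real.norm_of_nonneg (by positivity)]
  nlinarith [sq_nonneg (‖pd i D.F 0‖ - 1)]

lemma isBigO_metricInv (i j : Fin (d + 1)) :
    (fun D => metricInv D.F 0 i j) =O[𝓛] fun _ => (1 : ℝ) := by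
  have hsmall : ∀ᶠ D in 𝓛, (Fintype.card (Fin (d + 1)) : ℝ) * (K * |D.ε|) < 1 / 2 := by
    have : Tendsto (fun D => (Fintype.card (Fin (d + 1)) : ℝ) * (K * |D.ε|)) 𝓛 (𝓝 0) := by
      simpa using (tendsto_ε.abs.const_mul K).const_mul (Fintype.card (Fin (d + 1)) : ℝ)
    exact this.eventually_lt_const (by norm_num)
  refine IsBigO.of_bound 2 (hsmall.mono fun D hD => ?_)
  have hcoercive (ξ : Fin (d + 1) → ℝ) :
      1 / 2 * (ξ ⬝ᵥ ξ) ≤ ξ ⬝ᵥ Matrix.mulVec (metric D.F 0) ξ := by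
    refine le_trans ?_ (mul_dotProduct_self_le_of_abs_sub_diagonal_le (a := fun _ => 1) (c := 1)
      (fun _ => le_rfl) ((abs_nonneg _).trans (D.metric_close 0 0)) D.metric_close ξ)
    exact mul_le_mul_of_nonneg_right (by linarith) (Finset.sum_nonneg fun i _ => mul_self_nonneg _)
  simpa [metricInv] using abs_inv_le_of_coercive one_half_pos hcoercive i j

lemma isBigO_metricInv_sub (i j : Fin (d + 1)) :
    (fun D => metricInv D.F 0 i j - if i = j then 1 else 0) =O[𝓛] ε := by
  have h (D : BendData d V θ K) : metricInv D.F 0 i j - (if i = j then 1 else 0)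
      = -∑ k, metricInv D.F 0 i k * (metric D.F 0 k j - if k = j then 1 else 0) := by
    simp [mul_sub, Finset.sum_sub_distrib, sum_metricInv_mul_metric D.det_ne_zero]
  simp only [h]
  exact (IsBigO.fun_sum fun k _ =>
    isBigO_one_mul (isBigO_metricInv i k) (isBigO_metric_sub k j)).neg_left

lemma isBigO_pd_metricInv (k i j : Fin (d + 1)) :
    (fun D => pd k (fun y => metricInv D.F y i j) 0) =O[𝓛] ε := by
  simp only [fun D : BendData d V θ K => pd_metricInv D.smooth_two D.det_ne_zero k i j]
  exact (IsBigO.fun_sum fun a _ => IsBigO.fun_sum fun b _ => isBigO_mul_one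
    (isBigO_one_mul (isBigO_metricInv _ _) (isBigO_pd_metric _ _ _))
    (isBigO_metricInv _ _)).neg_left

lemma isBigO_christoffel (i j k : Fin (d + 1)) :
    (fun D => christoffel (metric D.F) 0 i j k) =O[𝓛] ε := by
  unfold christoffel
  exact isBigO_one_mul (isBigO_const_one ℝ _ _) (IsBigO.fun_sum fun l _ =>
    isBigO_one_mul (isBigO_metricInv k l) (((isBigO_pd_metric _ _ _).add
      (isBigO_pd_metric _ _ _)).sub (isBigO_pd_metric _ _ _)))

lemma isBigO_axis : (fun D => D.axis) =O[𝓛] fun _ => (1 : ℝ) :=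
  isBigO_of_le' (c := 1) _ fun D => by simp [D.norm_axis]

lemma isBigO_sff_sub_axis (i j : Fin (d + 1)) :
    (fun D => sff D.F 0 i j - cylWeingarten i j • D.axis) =O[𝓛] ε :=
  isBigO_of_le' _ fun D => D.sff_close i j

lemma isBigO_sff (i j : Fin (d + 1)) :
    (fun D => sff D.F 0 i j) =O[𝓛] fun _ => (1 : ℝ) := by
  simpa using ((isBigO_sff_sub_axis (V := V) i j).trans isBigO_ε).add
    (isBigO_one_smul (isBigO_const_one ℝ (cylWeingarten i j) 𝓛) isBigO_axis)

lemma isBigO_pd_pd_add_sff (i j : Fin (d + 1)) :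
    (fun D => pd i (pd j D.F) 0 + sff D.F 0 i j) =O[𝓛] ε := by
  simp only [sff, neg_sub, add_sub_cancel]
  exact IsBigO.fun_sum fun k _ => isBigO_smul_one (isBigO_christoffel i j k) (isBigO_pd k)

lemma isBigO_pd_pd (i j : Fin (d + 1)) :
    (fun D => pd i (pd j D.F) 0) =O[𝓛] fun _ => (1 : ℝ) := by
  simpa using ((isBigO_pd_pd_add_sff (V := V) i j).trans isBigO_ε).sub (isBigO_sff i j)

lemma isBigO_inner_pd_pd_pd (i j k : Fin (d + 1)) :
    (fun D => (inner ℝ (pd i (pd j D.F) 0) (pd k D.F 0) : ℝ)) =O[𝓛] ε := by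
  have h (D : BendData d V θ K) : (inner ℝ (pd i (pd j D.F) 0) (pd k D.F 0) : ℝ)
      = inner ℝ (pd i (pd j D.F) 0 + sff D.F 0 i j) (pd k D.F 0) := by
    rw [inner_add_left, isNormalAt_sff D.smooth_two D.det_ne_zero i j k, add_zero]
  simp only [h]
  exact isBigO_inner_one (isBigO_pd_pd_add_sff i j) (isBigO_pd k)

lemma isBigO_meanCurv_sub_axis :
    (fun D => meanCurv D.F 0 - (d : ℝ) • D.axis) =O[𝓛] ε := by
  have htrace : ∑ i : Fin (d + 1), cylWeingarten i i = (d : ℝ) := by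
    simp [cylWeingarten, dz, Finset.sum_sub_distrib]
  have h (D : BendData d V θ K) : meanCurv D.F 0 - (d : ℝ) • D.axis
      = ∑ i, ((∑ l, (metricInv D.F 0 i l - if i = l then 1 else 0) • sff D.F 0 i l)
        + (sff D.F 0 i i - cylWeingarten i i • D.axis)) := by
    simp only [meanCurv, weingarten, sub_smul, Finset.sum_sub_distrib, Finset.sum_add_distrib,
      ite_smul, one_smul, zero_smul, Finset.sum_ite_eq, Finset.mem_univ, if_true,
      ← Finset.sum_smul, htrace]
    abel
  simp only [h]
  exact IsBigO.fun_sum fun i _ => (IsBigO.fun_sum fun l _ =>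
    isBigO_smul_one (isBigO_metricInv_sub i l) (isBigO_sff i l)).add (isBigO_sff_sub_axis i i)

lemma isBigO_meanCurv : (fun D => meanCurv D.F 0) =O[𝓛] fun _ => (1 : ℝ) := by
  simpa using ((isBigO_meanCurv_sub_axis (d := d) (V := V) (θ := θ) (K := K)).trans isBigO_ε).add
    (isBigO_one_smul (isBigO_const_one ℝ (d : ℝ) _) isBigO_axis)

lemma eventually_norm_meanCurv (hd : 1 ≤ d) : ∀ᶠ D in 𝓛, 1 / 2 ≤ ‖meanCurv D.F 0‖ := by
  have hlim : Tendsto (fun D => ‖meanCurv D.F 0 - (d : ℝ) • D.axis‖) 𝓛 (𝓝 0) :=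
    (isBigO_meanCurv_sub_axis.norm_left).trans_tendsto tendsto_ε
  filter_upwards [hlim.eventually_lt_const (show (0 : ℝ) < 1 / 2 by norm_num)] with D hD
  have haxis : ‖(d : ℝ) • D.axis‖ = d := by simp [norm_smul, D.norm_axis]
  have htriangle := norm_sub_norm_le ((d : ℝ) • D.axis) (meanCurv D.F 0)
  rw [norm_sub_rev] at htriangle
  have hd' : (1 : ℝ) ≤ d := by exact_mod_cast hd
  linarith

lemma eventually_meanCurv_ne_zero (hd : 1 ≤ d) : ∀ᶠ D in 𝓛, meanCurv D.F 0 ≠ 0 :=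
  (eventually_norm_meanCurv hd).mono fun _ hD => norm_pos_iff.1 (one_half_pos.trans_le hD)

lemma isBigO_inv_norm_meanCurv (hd : 1 ≤ d) :
    (fun D => ‖meanCurv D.F 0‖⁻¹) =O[𝓛] fun _ => (1 : ℝ) := by
  refine IsBigO.of_bound 2 ((eventually_norm_meanCurv hd).mono fun D hD => ?_)
  rw [norm_inv, norm_norm, norm_one, mul_one]
  exact inv_le_of_inv_le₀ (by norm_num) (by linarith)

lemma isBigO_nuPlus : (fun D => nuPlus D.F 0) =O[𝓛] fun _ => (1 : ℝ) := by
  refine isBigO_of_le' (c := 1) _ fun D => ?_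
  rw [norm_one, mul_one, nuPlus, norm_smul, norm_inv, norm_norm]
  exact inv_mul_le_one

lemma isBigO_nuPlus_sub_axis (hd : 1 ≤ d) :
    (fun D => nuPlus D.F 0 - D.axis) =O[𝓛] ε := by
  have hnorm : (fun D => (d : ℝ) - ‖meanCurv D.F 0‖) =O[𝓛] ε := by
    refine (isBigO_of_le _ fun D => ?_).trans isBigO_meanCurv_sub_axis
    have haxis : ‖(d : ℝ) • D.axis‖ = d := by simp [norm_smul, D.norm_axis]
    have := abs_norm_sub_norm_le ((d : ℝ) • D.axis) (meanCurv D.F 0)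
    rwa [haxis, norm_sub_rev] at this
  have h : (fun D => nuPlus D.F 0 - D.axis) =ᶠ[𝓛] fun D =>
      ‖meanCurv D.F 0‖⁻¹ • ((meanCurv D.F 0 - (d : ℝ) • D.axis)
        + ((d : ℝ) - ‖meanCurv D.F 0‖) • D.axis) := by
    filter_upwards [eventually_meanCurv_ne_zero hd] with D hD
    rw [sub_smul, sub_add_sub_cancel, smul_sub, smul_smul,
      inv_mul_cancel₀ (norm_ne_zero_iff.2 hD), one_smul, nuPlus]
  exact h.trans_isBigO (isBigO_one_smul (isBigO_inv_norm_meanCurv hd)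
    (isBigO_meanCurv_sub_axis.add (isBigO_smul_one hnorm isBigO_axis)))

lemma isBigO_sff_sub (hd : 1 ≤ d) (i j : Fin (d + 1)) :
    (fun D => sff D.F 0 i j - cylWeingarten i j • nuPlus D.F 0) =O[𝓛] ε := by
  have h (D : BendData d V θ K) : sff D.F 0 i j - cylWeingarten i j • nuPlus D.F 0
      = (sff D.F 0 i j - cylWeingarten i j • D.axis)
        - (cylWeingarten i j : ℝ) • (nuPlus D.F 0 - D.axis) := by
    rw [smul_sub]; abel
  simp only [h]
  exact (isBigO_sff_sub_axis i j).sub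
    (isBigO_one_smul (isBigO_const_one ℝ _ _) (isBigO_nuPlus_sub_axis hd))

lemma isBigO_hPlus_sub (hd : 1 ≤ d) (i j : Fin (d + 1)) :
    (fun D => hPlus D.F 0 i j - cylWeingarten i j) =O[𝓛] ε := by
  have h : (fun D => hPlus D.F 0 i j - cylWeingarten i j) =ᶠ[𝓛] fun D =>
      inner ℝ (sff D.F 0 i j - (cylWeingarten i j : ℝ) • nuPlus D.F 0) (nuPlus D.F 0) := by
    filter_upwards [eventually_meanCurv_ne_zero hd] with D hD
    rw [inner_sub_left, real_inner_smul_left, real_inner_self_eq_norm_sq, norm_nuPlus hD, hPlus]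
    ring
  exact h.trans_isBigO (isBigO_inner_one (isBigO_sff_sub hd i j) isBigO_nuPlus)

lemma isBigO_hPlus (i j : Fin (d + 1)) :
    (fun D => hPlus D.F 0 i j) =O[𝓛] fun _ => (1 : ℝ) :=
  isBigO_one_inner (isBigO_sff i j) isBigO_nuPlus

lemma isBigO_hPlusMixed (i j : Fin (d + 1)) :
    (fun D => hPlusMixed D.F 0 i j) =O[𝓛] fun _ => (1 : ℝ) :=
  IsBigO.fun_sum fun _ _ => isBigO_one_mul (isBigO_metricInv _ _) (isBigO_hPlus _ _)

lemma isBigO_hPlusUp (i j : Fin (d + 1)) :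
    (fun D => hPlusUp D.F 0 i j) =O[𝓛] fun _ => (1 : ℝ) :=
  IsBigO.fun_sum fun _ _ => IsBigO.fun_sum fun _ _ => isBigO_one_mul
    (isBigO_one_mul (isBigO_metricInv _ _) (isBigO_metricInv _ _)) (isBigO_hPlus _ _)

lemma isBigO_nablaSff_one (I : Fin 3 → Fin (d + 1)) :
    (fun D => nablaSff D.F 1 0 I) =O[𝓛] ε :=
  isBigO_of_le' _ fun D => D.nabla_one I

lemma isBigO_normalProj_pd_sff (j a b : Fin (d + 1)) :
    (fun D => normalProj D.F 0 (pd j (fun y => sff D.F y a b) 0)) =O[𝓛] ε := by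
  have h (D : BendData d V θ K) : normalProj D.F 0 (pd j (fun y => sff D.F y a b) 0)
      = nablaSff D.F 1 0 ![j, a, b]
        + ((∑ k, christoffel (metric D.F) 0 j a k • sff D.F 0 k b)
          + ∑ k, christoffel (metric D.F) 0 j b k • sff D.F 0 a k) := by
    rw [nablaSff_one, sub_add_cancel]
  simp only [h]
  exact (isBigO_nablaSff_one _).add
    ((IsBigO.fun_sum fun k _ => isBigO_smul_one (isBigO_christoffel _ _ _) (isBigO_sff _ _)).add
      (IsBigO.fun_sum fun k _ => isBigO_smul_one (isBigO_christoffel _ _ _) (isBigO_sff _ _)))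

lemma isBigO_normalProj_pd_meanCurv (j : Fin (d + 1)) :
    (fun D => normalProj D.F 0 (pd j (meanCurv D.F) 0)) =O[𝓛] ε := by
  simp only [fun D : BendData d V θ K =>
    normalProj_pd_meanCurv D.smooth_two D.det_ne_zero D.differentiableAt_sff j]
  exact IsBigO.fun_sum fun a _ => IsBigO.fun_sum fun b _ =>
    isBigO_one_smul (isBigO_metricInv a b) (isBigO_nablaSff_one _)

lemma isBigO_nuDefect (hd : 1 ≤ d) (j : Fin (d + 1)) :
    (fun D => nuDefect D.F j 0) =O[𝓛] ε :=
  isBigO_one_smul (isBigO_inv_norm_meanCurv hd) ((isBigO_normalProj_pd_meanCurv j).sub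
    (isBigO_smul_one (isBigO_inner_one (isBigO_normalProj_pd_meanCurv j) isBigO_nuPlus)
      isBigO_nuPlus))

lemma eventually_pd_nuPlus (hd : 1 ≤ d) (i : Fin (d + 1)) : ∀ᶠ D in 𝓛,
    pd i (nuPlus D.F) 0 = ∑ k, hPlusMixed D.F 0 i k • pd k D.F 0 + nuDefect D.F i 0 := by
  filter_upwards [eventually_meanCurv_ne_zero hd] with D hD
  exact pd_nuPlus D.smooth_two D.det_ne_zero D.differentiableAt_meanCurv hD i

lemma isBigO_pd_nuPlus_sub (hd : 1 ≤ d) (i : Fin (d + 1)) :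
    (fun D => pd i (nuPlus D.F) 0 - ∑ k, hPlusMixed D.F 0 i k • pd k D.F 0) =O[𝓛] ε := by
  have h : (fun D => pd i (nuPlus D.F) 0 - ∑ k, hPlusMixed D.F 0 i k • pd k D.F 0)
      =ᶠ[𝓛] fun D => nuDefect D.F i 0 := by
    filter_upwards [eventually_pd_nuPlus hd i] with D hD
    rw [hD, add_sub_cancel_left]
  exact h.trans_isBigO (isBigO_nuDefect hd i)

lemma isBigO_pd_nuPlus (hd : 1 ≤ d) (i : Fin (d + 1)) :
    (fun D => pd i (nuPlus D.F) 0) =O[𝓛] fun _ => (1 : ℝ) := by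
  simpa using ((isBigO_pd_nuPlus_sub (V := V) hd i).trans isBigO_ε).add
    (IsBigO.fun_sum (s := Finset.univ) fun k _ =>
      isBigO_one_smul (isBigO_hPlusMixed i k) (isBigO_pd k))

lemma isBigO_pd_hPlus (hd : 1 ≤ d) (k i j : Fin (d + 1)) :
    (fun D => pd k (fun y => hPlus D.F y i j) 0) =O[𝓛] ε := by
  have h : (fun D => pd k (fun y => hPlus D.F y i j) 0) =ᶠ[𝓛] fun D =>
      inner ℝ (normalProj D.F 0 (pd k (fun y => sff D.F y i j) 0)) (nuPlus D.F 0)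
        + inner ℝ (sff D.F 0 i j) (nuDefect D.F k 0) := by
    filter_upwards [eventually_meanCurv_ne_zero hd, eventually_pd_nuPlus hd k] with D hD hpd
    unfold hPlus
    rw [pd_inner (D.differentiableAt_sff i j) (differentiableAt_nuPlus hD),
      (isNormalAt_nuPlus D.smooth_two D.det_ne_zero).inner_normalProj, hpd]
    simp [inner_add_right, inner_sum, real_inner_smul_right,
      isNormalAt_sff D.smooth_two D.det_ne_zero i j _]
  exact h.trans_isBigO ((isBigO_inner_one (isBigO_normalProj_pd_sff k i j) isBigO_nuPlus).add
    (isBigO_one_inner (isBigO_sff i j) (isBigO_nuDefect hd k)))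

lemma isBigO_pd_hPlusMixed (hd : 1 ≤ d) (k i j : Fin (d + 1)) :
    (fun D => pd k (fun y => hPlusMixed D.F y i j) 0) =O[𝓛] ε := by
  have h : (fun D => pd k (fun y => hPlusMixed D.F y i j) 0) =ᶠ[𝓛] fun D =>
      ∑ l, (metricInv D.F 0 j l * pd k (fun y => hPlus D.F y i l) 0
        + pd k (fun y => metricInv D.F y j l) 0 * hPlus D.F 0 i l) := by
    filter_upwards [eventually_meanCurv_ne_zero hd] with D hD
    have hI := D.differentiableAt_metricInv
    have hh := differentiableAt_hPlus hD
    unfold hPlusMixed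
    rw [pd_sum fun l _ => (hI j l).fun_mul (hh i l)]
    exact Finset.sum_congr rfl fun l _ => pd_mul (hI j l) (hh i l)
  exact h.trans_isBigO (IsBigO.fun_sum fun l _ =>
    (isBigO_one_mul (isBigO_metricInv _ _) (isBigO_pd_hPlus hd _ _ _)).add
      (isBigO_mul_one (isBigO_pd_metricInv _ _ _) (isBigO_hPlus _ _)))

lemma isBigO_pd_hPlusUp (hd : 1 ≤ d) (k i j : Fin (d + 1)) :
    (fun D => pd k (fun y => hPlusUp D.F y i j) 0) =O[𝓛] ε := by
  have h : (fun D => pd k (fun y => hPlusUp D.F y i j) 0) =ᶠ[𝓛] fun D =>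
      ∑ p, ∑ q, ((metricInv D.F 0 i p * metricInv D.F 0 j q) * pd k (fun y => hPlus D.F y p q) 0
        + (metricInv D.F 0 i p * pd k (fun y => metricInv D.F y j q) 0
          + pd k (fun y => metricInv D.F y i p) 0 * metricInv D.F 0 j q) * hPlus D.F 0 p q) := by
    filter_upwards [eventually_meanCurv_ne_zero hd] with D hD
    have hI := D.differentiableAt_metricInv
    have hh := differentiableAt_hPlus hD
    have hterm (p q) := ((hI i p).fun_mul (hI j q)).fun_mul (hh p q)
    unfold hPlusUp
    rw [pd_sum fun p _ => DifferentiableAt.fun_sum fun q _ => hterm p q]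
    refine Finset.sum_congr rfl fun p _ => ?_
    rw [pd_sum fun q _ => hterm p q]
    refine Finset.sum_congr rfl fun q _ => ?_
    rw [pd_mul ((hI i p).fun_mul (hI j q)) (hh p q), pd_mul (hI i p) (hI j q)]
  exact h.trans_isBigO (IsBigO.fun_sum fun p _ => IsBigO.fun_sum fun q _ =>
    (isBigO_one_mul (isBigO_one_mul (isBigO_metricInv _ _) (isBigO_metricInv _ _))
      (isBigO_pd_hPlus hd _ _ _)).add
    (isBigO_mul_one ((isBigO_one_mul (isBigO_metricInv _ _) (isBigO_pd_metricInv _ _ _)).add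
      (isBigO_mul_one (isBigO_pd_metricInv _ _ _) (isBigO_metricInv _ _))) (isBigO_hPlus _ _)))

lemma isBigO_pd_nablaSff_one (hV : Module.finrank ℝ V ≠ d + 2) (i j a b : Fin (d + 1)) :
    (fun D => pd i (fun y => nablaSff D.F 1 y ![j, a, b]) 0) =O[𝓛] ε := by
  have h (D : BendData d V θ K) : pd i (fun y => nablaSff D.F 1 y ![j, a, b]) 0
      = (nablaSff D.F 2 0 ![i, j, a, b]
        + ((∑ k, christoffel (metric D.F) 0 i j k • nablaSff D.F 1 0 ![k, a, b])
        + (∑ k, christoffel (metric D.F) 0 i a k • nablaSff D.F 1 0 ![j, k, b])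
        + ∑ k, christoffel (metric D.F) 0 i b k • nablaSff D.F 1 0 ![j, a, k]))
        + ∑ p, ∑ q, (metricInv D.F 0 p q *
          inner ℝ (nablaSff D.F 1 0 ![j, a, b]) (sff D.F 0 i p)) • pd q D.F 0 := by
    rw [nablaSff_two, sub_add_cancel]
    refine pd_eq_normalProj_add D.smooth_two
      ((contDiffAt_nablaSff_one D.smooth D.det_ne_zero j a b).differentiableAt (by simp)) ?_ i
    filter_upwards [D.smooth_two.eventually (by simp),
      eventually_det_metric_ne_zero (D.smooth_two.of_le one_le_two) D.det_ne_zero] with y hFy hy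
    exact isNormalAt_nablaSff_one hFy hy j a b
  have hnabla : (fun D => nablaSff D.F 2 0 ![i, j, a, b]) =O[𝓛] ε :=
    isBigO_of_le' _ fun D => (D.nabla_two.resolve_left hV) _
  have hΓ (p q : Fin (d + 1)) (I : Fin (d + 1) → Fin 3 → Fin (d + 1)) :
      (fun D => ∑ k, christoffel (metric D.F) 0 p q k • nablaSff D.F 1 0 (I k)) =O[𝓛] ε :=
    IsBigO.fun_sum fun k _ =>
      isBigO_one_smul ((isBigO_christoffel _ _ _).trans isBigO_ε) (isBigO_nablaSff_one _)
  simp only [h]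
  exact (hnabla.add (((hΓ _ _ _).add (hΓ _ _ _)).add (hΓ _ _ _))).add
    (IsBigO.fun_sum fun p _ => IsBigO.fun_sum fun q _ => isBigO_smul_one
      (isBigO_one_mul (isBigO_metricInv _ _)
        (isBigO_inner_one (isBigO_nablaSff_one _) (isBigO_sff _ _))) (isBigO_pd q))

lemma isBigO_pd_normalProj_pd_meanCurv (hV : Module.finrank ℝ V ≠ d + 2) (i j : Fin (d + 1)) :
    (fun D => pd i (fun y => normalProj D.F y (pd j (meanCurv D.F) y)) 0) =O[𝓛] ε := by
  simp only [fun D : BendData d V θ K =>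
    pd_normalProj_pd_meanCurv D.smooth D.det_ne_zero i j]
  exact IsBigO.fun_sum fun a _ => IsBigO.fun_sum fun b _ =>
    (isBigO_one_smul (isBigO_metricInv _ _) (isBigO_pd_nablaSff_one hV _ _ _ _)).add
      (isBigO_smul_one (isBigO_pd_metricInv _ _ _) ((isBigO_nablaSff_one _).trans isBigO_ε))

lemma isBigO_pd_meanCurv (hd : 1 ≤ d) (j : Fin (d + 1)) :
    (fun D => pd j (meanCurv D.F) 0) =O[𝓛] fun _ => (1 : ℝ) := by
  have h : (fun D => pd j (meanCurv D.F) 0) =ᶠ[𝓛] fun D =>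
      normalProj D.F 0 (pd j (meanCurv D.F) 0)
        + ‖meanCurv D.F 0‖ • ∑ m, hPlusMixed D.F 0 j m • pd m D.F 0 := by
    filter_upwards [eventually_meanCurv_ne_zero hd] with D hD
    exact pd_meanCurv_eq_normalProj_add D.smooth_two D.det_ne_zero D.differentiableAt_meanCurv hD j
  exact h.trans_isBigO (((isBigO_normalProj_pd_meanCurv j).trans isBigO_ε).add
    (isBigO_one_smul isBigO_meanCurv.norm_left
      (IsBigO.fun_sum fun k _ => isBigO_one_smul (isBigO_hPlusMixed j k) (isBigO_pd k))))

lemma isBigO_pd_norm_meanCurv (hd : 1 ≤ d) (j : Fin (d + 1)) :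
    (fun D => pd j (fun y => ‖meanCurv D.F y‖) 0) =O[𝓛] fun _ => (1 : ℝ) := by
  have h : (fun D => pd j (fun y => ‖meanCurv D.F y‖) 0) =ᶠ[𝓛] fun D =>
      inner ℝ (pd j (meanCurv D.F) 0) (nuPlus D.F 0) :=
    (eventually_meanCurv_ne_zero hd).mono fun D hD =>
      pd_norm_meanCurv D.differentiableAt_meanCurv hD j
  exact h.trans_isBigO (isBigO_one_inner (isBigO_pd_meanCurv hd j) isBigO_nuPlus)

lemma isBigO_pd_nuDefect (hd : 1 ≤ d) (i j : Fin (d + 1)) :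
    (fun D => pd i (nuDefect D.F j) 0) =O[𝓛] ε := by
  by_cases hV : Module.finrank ℝ V = d + 2
  · have h : (fun D => pd i (nuDefect D.F j) 0) =ᶠ[𝓛] fun _ => 0 :=
      (eventually_meanCurv_ne_zero hd).mono fun D hD =>
        pd_nuDefect_of_finrank hV D.smooth D.det_ne_zero hD i j
    exact h.trans_isBigO (isBigO_zero _ _)
  have h := (eventually_meanCurv_ne_zero (V := V) (θ := θ) (K := K) hd).mono fun D hD =>
    pd_nuDefect D.smooth D.det_ne_zero hD (j := j) rfl i
  have hY₀ := isBigO_normalProj_pd_meanCurv (V := V) (θ := θ) (K := K) j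
  have hY₁ := isBigO_pd_normalProj_pd_meanCurv (θ := θ) (K := K) hV i j
  exact EventuallyEq.trans_isBigO h (isBigO_one_smul (isBigO_inv_norm_meanCurv hd) ((hY₁.sub
    ((isBigO_smul_one (isBigO_inner_one hY₀ isBigO_nuPlus) (isBigO_pd_nuPlus hd i)).add
      (isBigO_smul_one ((isBigO_inner_one hY₁ isBigO_nuPlus).add
        (isBigO_inner_one hY₀ (isBigO_pd_nuPlus hd i))) isBigO_nuPlus))).sub
    (isBigO_one_smul (isBigO_pd_norm_meanCurv hd i) (isBigO_nuDefect hd j))))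

lemma isBigO_pd_pd_nuPlus_sub (hd : 1 ≤ d) (i j : Fin (d + 1)) :
    (fun D => pd i (pd j (nuPlus D.F)) 0 - ∑ k, hPlusMixed D.F 0 j k • pd i (pd k D.F) 0)
      =O[𝓛] ε := by
  have h : (fun D => pd i (pd j (nuPlus D.F)) 0
      - ∑ k, hPlusMixed D.F 0 j k • pd i (pd k D.F) 0) =ᶠ[𝓛] fun D =>
      ∑ k, pd i (fun y => hPlusMixed D.F y j k) 0 • pd k D.F 0 + pd i (nuDefect D.F j) 0 := by
    filter_upwards [eventually_meanCurv_ne_zero hd] with D hD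
    rw [pd_pd_nuPlus D.smooth D.det_ne_zero hD, Finset.sum_add_distrib]
    abel
  exact h.trans_isBigO ((IsBigO.fun_sum fun k _ =>
    isBigO_smul_one (isBigO_pd_hPlusMixed hd _ _ _) (isBigO_pd k)).add (isBigO_pd_nuDefect hd i j))

lemma isBigO_pd_pd_nuPlus (hd : 1 ≤ d) (i j : Fin (d + 1)) :
    (fun D => pd i (pd j (nuPlus D.F)) 0) =O[𝓛] fun _ => (1 : ℝ) := by
  simpa using ((isBigO_pd_pd_nuPlus_sub (V := V) hd i j).trans isBigO_ε).add
    (IsBigO.fun_sum (s := Finset.univ) fun k _ =>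
      isBigO_one_smul (isBigO_hPlusMixed j k) (isBigO_pd_pd i k))

section Bent

variable (D : BendData d V θ K)

/-- The deformed patch. -/
def bent : E (d + 1) → V := bend D.F D.τ D.u

/-- The value of `τ u` at the centre. -/
def v₀ : ℝ := D.τ * D.u 0

/-- The first derivative of `τ u` at the centre. -/
def v₁ : ℝ := D.τ * deriv D.u 0

/-- The second derivative of `τ u` at the centre. -/
def v₂ : ℝ := D.τ * deriv (deriv D.u) 0

/-- The size of the one-jet of `τ u` at the centre. -/
def size₁ : ℝ := |D.v₀| + |D.v₁|

/-- The size of the two-jet of `τ u` at the centre. -/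
def size₂ : ℝ := |D.v₀| + |D.v₁| + |D.v₂|

/-- The admissible error `e₁ + e₂` of the expansions. -/
def err : ℝ := |D.ε| * D.size₁ + D.size₂ ^ 2

/-- The change `∂ᵢF - ∂ᵢF̃` of the first derivatives at the centre. -/
def dev₁ (i : Fin (d + 1)) : V := D.v₀ • pd i (nuPlus D.F) 0 + (dz i * D.v₁) • nuPlus D.F 0

/-- The change `∂ᵢ∂ⱼF - ∂ᵢ∂ⱼF̃` of the second derivatives at the centre. -/
def dev₂ (i j : Fin (d + 1)) : V :=
  D.v₀ • pd i (pd j (nuPlus D.F)) 0 + (dz i * D.v₁) • pd j (nuPlus D.F) 0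
    + (dz j * D.v₁) • pd i (nuPlus D.F) 0 + (dz i * dz j * D.v₂) • nuPlus D.F 0

lemma size₁_nonneg : 0 ≤ D.size₁ := by unfold size₁; positivity

lemma size₂_nonneg : 0 ≤ D.size₂ := by unfold size₂; positivity

lemma size₁_le_size₂ : D.size₁ ≤ D.size₂ := le_add_of_nonneg_right (abs_nonneg _)

lemma err_nonneg : 0 ≤ D.err :=
  add_nonneg (mul_nonneg (abs_nonneg _) D.size₁_nonneg) (sq_nonneg _)

lemma err_le : D.err ≤ 3 * (|D.ε| * |D.τ| * (|D.u 0| + |deriv D.u 0|)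
    + D.τ ^ 2 * (|D.u 0| ^ 2 + |deriv D.u 0| ^ 2 + |deriv (deriv D.u) 0| ^ 2)) := by
  have hsize₁ : |D.ε| * D.size₁ = |D.ε| * |D.τ| * (|D.u 0| + |deriv D.u 0|) := by
    simp only [size₁, v₀, v₁, abs_mul]
    ring
  have hsize₂ : D.size₂ ^ 2
      ≤ 3 * (D.τ ^ 2 * (|D.u 0| ^ 2 + |deriv D.u 0| ^ 2 + |deriv (deriv D.u) 0| ^ 2)) := by
    have hcauchy (p q s : ℝ) : (p + q + s) ^ 2 ≤ 3 * (p ^ 2 + q ^ 2 + s ^ 2) := by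
      linarith [sq_nonneg (p - q), sq_nonneg (p - s), sq_nonneg (q - s)]
    calc D.size₂ ^ 2
        = D.τ ^ 2 * (|D.u 0| + |deriv D.u 0| + |deriv (deriv D.u) 0|) ^ 2 := by
          simp only [size₂, v₀, v₁, v₂, abs_mul, ← mul_add, mul_pow, sq_abs]
      _ ≤ _ := by
          rw [mul_left_comm]
          exact mul_le_mul_of_nonneg_left (hcauchy _ _ _) (sq_nonneg _)
  have hpos : 0 ≤ |D.ε| * D.size₁ := mul_nonneg (abs_nonneg _) D.size₁_nonneg
  rw [err, ← hsize₁]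
  linarith

variable {D}

lemma contDiffAt_bent (hH : meanCurv D.F 0 ≠ 0) : ContDiffAt ℝ 2 D.bent 0 :=
  contDiffAt_bend D.smooth_two
    ((contDiffAt_nuPlus D.smooth D.det_ne_zero hH).of_le (by norm_cast)) D.u_smooth

lemma pd_bent (hH : meanCurv D.F 0 ≠ 0) (i : Fin (d + 1)) :
    pd i D.bent 0 = pd i D.F 0 - D.dev₁ i :=
  pd_bend (D.smooth.differentiableAt (by simp)) (differentiableAt_nuPlus hH)
    (D.u_smooth.differentiableAt two_ne_zero) i

lemma pd_pd_bent (hH : meanCurv D.F 0 ≠ 0) (i j : Fin (d + 1)) :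
    pd i (pd j D.bent) 0 = pd i (pd j D.F) 0 - D.dev₂ i j :=
  pd_pd_bend D.smooth_two ((contDiffAt_nuPlus D.smooth D.det_ne_zero hH).of_le (by norm_cast))
    D.u_smooth i j

lemma metric_bent (hH : meanCurv D.F 0 ≠ 0) (i j : Fin (d + 1)) :
    metric D.bent 0 i j = metric D.F 0 i j - 2 * D.v₀ * hPlus D.F 0 i j
      + (D.v₀ ^ 2 * inner ℝ (pd i (nuPlus D.F) 0) (pd j (nuPlus D.F) 0)
        + dz i * dz j * D.v₁ ^ 2) :=
  metric_bend D.smooth_two D.det_ne_zero D.differentiableAt_meanCurv hH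
    (D.u_smooth.differentiableAt two_ne_zero) i j

end Bent

lemma isBigO_v₀ : v₀ =O[𝓛] size₁ := isBigO_of_le _ fun D => by
  rw [Real.norm_of_nonneg D.size₁_nonneg]
  exact le_add_of_nonneg_right (abs_nonneg _)

lemma isBigO_v₁ : v₁ =O[𝓛] size₁ := isBigO_of_le _ fun D => by
  rw [Real.norm_of_nonneg D.size₁_nonneg]
  exact le_add_of_nonneg_left (abs_nonneg _)

lemma isBigO_v₂ : v₂ =O[𝓛] size₂ := isBigO_of_le _ fun D => by
  rw [Real.norm_of_nonneg D.size₂_nonneg]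
  exact le_add_of_nonneg_left D.size₁_nonneg

lemma isBigO_size₁ : size₁ =O[𝓛] size₂ := isBigO_of_le _ fun D => by
  rw [Real.norm_of_nonneg D.size₂_nonneg, Real.norm_of_nonneg D.size₁_nonneg]
  exact D.size₁_le_size₂

lemma isBigO_size₁_one : size₁ =O[𝓛] fun _ => (1 : ℝ) := isBigO_of_le' (c := θ) _ fun D => by
  rw [norm_one, mul_one, Real.norm_of_nonneg D.size₁_nonneg, size₁, v₀, v₁, abs_mul, abs_mul,
    ← mul_add]
  exact D.u_bound

lemma isBigO_size₂_mul_size₂ : (fun D => D.size₂ * D.size₂) =O[𝓛] err :=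
  isBigO_of_le _ fun D => by
    rw [← sq, Real.norm_of_nonneg (sq_nonneg _), Real.norm_of_nonneg D.err_nonneg]
    exact le_add_of_nonneg_left (mul_nonneg (abs_nonneg _) D.size₁_nonneg)

lemma isBigO_size₂_mul_size₁ : (fun D => D.size₂ * D.size₁) =O[𝓛] err :=
  ((isBigO_refl _ _).mul isBigO_size₁).trans isBigO_size₂_mul_size₂

lemma isBigO_size₁_mul_size₂ : (fun D => D.size₁ * D.size₂) =O[𝓛] err :=
  (isBigO_size₁.mul (isBigO_refl _ _)).trans isBigO_size₂_mul_size₂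

lemma isBigO_size₁_mul_size₁ : (fun D => D.size₁ * D.size₁) =O[𝓛] err :=
  (isBigO_size₁.mul isBigO_size₁).trans isBigO_size₂_mul_size₂

lemma isBigO_size₁_mul_ε : (fun D => D.size₁ * D.ε) =O[𝓛] err := isBigO_of_le _ fun D => by
  rw [norm_mul, Real.norm_of_nonneg D.size₁_nonneg, Real.norm_of_nonneg D.err_nonneg, mul_comm]
  exact le_add_of_nonneg_right (sq_nonneg _)

lemma isBigO_dev₁ (hd : 1 ≤ d) (i : Fin (d + 1)) : (fun D => D.dev₁ i) =O[𝓛] size₁ :=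
  (isBigO_smul_one isBigO_v₀ (isBigO_pd_nuPlus hd i)).add
    (isBigO_smul_one (isBigO_one_mul (isBigO_const_one ℝ _ _) isBigO_v₁) isBigO_nuPlus)

lemma isBigO_dev₂ (hd : 1 ≤ d) (i j : Fin (d + 1)) : (fun D => D.dev₂ i j) =O[𝓛] size₂ := by
  have hdzv₁ (k : Fin (d + 1)) : (fun D => dz k * D.v₁) =O[𝓛] size₁ :=
    isBigO_one_mul (isBigO_const_one ℝ _ _) isBigO_v₁
  exact ((((isBigO_smul_one isBigO_v₀ (isBigO_pd_pd_nuPlus hd i j)).add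
    (isBigO_smul_one (hdzv₁ i) (isBigO_pd_nuPlus hd j))).add
    (isBigO_smul_one (hdzv₁ j) (isBigO_pd_nuPlus hd i))).trans isBigO_size₁).add
    (isBigO_smul_one (isBigO_one_mul (isBigO_const_one ℝ _ _) isBigO_v₂) isBigO_nuPlus)

lemma isBigO_pd_bent (hd : 1 ≤ d) (i : Fin (d + 1)) :
    (fun D => pd i D.bent 0) =O[𝓛] fun _ => (1 : ℝ) := by
  have h : (fun D => pd i D.bent 0) =ᶠ[𝓛] fun D => pd i D.F 0 - D.dev₁ i :=
    (eventually_meanCurv_ne_zero hd).mono fun D hD => pd_bent hD i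
  exact h.trans_isBigO ((isBigO_pd i).sub ((isBigO_dev₁ hd i).trans isBigO_size₁_one))

lemma isBigO_hPlusMixed_sub (hd : 1 ≤ d) (i j : Fin (d + 1)) :
    (fun D => hPlusMixed D.F 0 i j - cylWeingarten i j) =O[𝓛] ε := by
  have h (D : BendData d V θ K) : hPlusMixed D.F 0 i j - cylWeingarten i j
      = ∑ l, (metricInv D.F 0 j l - if j = l then 1 else 0) * hPlus D.F 0 i l
        + (hPlus D.F 0 i j - cylWeingarten i j) := by
    simp [hPlusMixed, sub_mul, Finset.sum_sub_distrib]
  simp only [h]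
  exact (IsBigO.fun_sum fun l _ => isBigO_mul_one (isBigO_metricInv_sub _ _)
    (isBigO_hPlus _ _)).add (isBigO_hPlus_sub hd i j)

lemma isBigO_inner_pd_nuPlus_sub (hd : 1 ≤ d) (i j : Fin (d + 1)) :
    (fun D => (inner ℝ (pd i (nuPlus D.F) 0) (pd j (nuPlus D.F) 0) : ℝ) - cylWeingarten i j)
      =O[𝓛] ε := by
  have h : (fun D => (inner ℝ (pd i (nuPlus D.F) 0) (pd j (nuPlus D.F) 0) : ℝ)
      - cylWeingarten i j) =ᶠ[𝓛] fun D =>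
      inner ℝ (pd i (nuPlus D.F) 0 - ∑ k, hPlusMixed D.F 0 i k • pd k D.F 0)
        (pd j (nuPlus D.F) 0)
      + ∑ k, ((hPlusMixed D.F 0 i k - cylWeingarten i k) * hPlus D.F 0 j k
        + cylWeingarten i k * (hPlus D.F 0 j k - cylWeingarten j k)) := by
    filter_upwards [eventually_meanCurv_ne_zero hd] with D hD
    have hpd (k) : (inner ℝ (pd k D.F 0) (pd j (nuPlus D.F) 0) : ℝ) = hPlus D.F 0 j k := by
      rw [real_inner_comm,
        inner_pd_nuPlus_pd D.smooth_two D.det_ne_zero (differentiableAt_nuPlus hD)]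
    simp only [inner_sub_left, sum_inner, real_inner_smul_left, hpd, sub_mul, mul_sub,
      Finset.sum_add_distrib, Finset.sum_sub_distrib, sum_cylWeingarten_mul]
    ring
  exact h.trans_isBigO ((isBigO_inner_one (isBigO_pd_nuPlus_sub hd i) (isBigO_pd_nuPlus hd j)).add
    (IsBigO.fun_sum fun k _ => (isBigO_mul_one (isBigO_hPlusMixed_sub hd i k)
      (isBigO_hPlus j k)).add (isBigO_one_mul (isBigO_const_one ℝ _ _) (isBigO_hPlus_sub hd j k))))

lemma isBigO_metric_bent_sub_diagonal (hd : 1 ≤ d) (i j : Fin (d + 1)) :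
    (fun D => metric D.bent 0 i j
      - Matrix.diagonal (fun k => if k = 0 then 1 + D.v₁ ^ 2 else (1 - D.v₀) ^ 2) i j)
      =O[𝓛] ε := by
  have hv₀ : v₀ =O[𝓛] fun _ => (1 : ℝ) := isBigO_v₀.trans isBigO_size₁_one
  have h : (fun D => metric D.bent 0 i j
      - Matrix.diagonal (fun k => if k = 0 then 1 + D.v₁ ^ 2 else (1 - D.v₀) ^ 2) i j)
      =ᶠ[𝓛] fun D => ((metric D.F 0 i j - if i = j then 1 else 0)
        - 2 * D.v₀ * (hPlus D.F 0 i j - cylWeingarten i j))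
        + D.v₀ * (D.v₀ * ((inner ℝ (pd i (nuPlus D.F) 0) (pd j (nuPlus D.F) 0) : ℝ)
          - cylWeingarten i j)) := by
    filter_upwards [eventually_meanCurv_ne_zero hd] with D hD
    rw [metric_bent hD]
    by_cases hi : i = 0 <;> by_cases hj : j = 0 <;> by_cases hij : i = j <;>
      simp_all [cylWeingarten, dz] <;> ring
  exact h.trans_isBigO (((isBigO_metric_sub i j).sub (isBigO_one_mul (isBigO_one_mul
    (isBigO_const_one ℝ _ _) hv₀) (isBigO_hPlus_sub hd i j))).add
    (isBigO_one_mul hv₀ (isBigO_one_mul hv₀ (isBigO_inner_pd_nuPlus_sub hd i j))))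

lemma exists_coercive_metric_bent (hd : 1 ≤ d) (hθ : θ < 1) : ∃ c : ℝ, 0 < c ∧
    ∀ᶠ D in 𝓛, ∀ ξ : Fin (d + 1) → ℝ,
      c * (ξ ⬝ᵥ ξ) ≤ ξ ⬝ᵥ Matrix.mulVec (metric D.bent 0) ξ := by
  have hc : 0 < (1 - θ) ^ 2 := pow_pos (sub_pos.2 hθ) 2
  refine ⟨(1 - θ) ^ 2 / 2, half_pos hc, ?_⟩
  set η : ℝ := (1 - θ) ^ 2 / (2 * ((d + 1 : ℕ) : ℝ)) with hη
  have hη₀ : 0 < η := by positivity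
  have hclose : ∀ᶠ D in 𝓛, ∀ i j, |metric D.bent 0 i j
      - Matrix.diagonal (fun k => if k = 0 then 1 + D.v₁ ^ 2 else (1 - D.v₀) ^ 2) i j| ≤ η := by
    refine eventually_all.2 fun i => eventually_all.2 fun j => ?_
    have hlim := ((isBigO_metric_bent_sub_diagonal (V := V) (θ := θ) (K := K) hd i j).trans_tendsto
      tendsto_ε).abs
    rw [abs_zero] at hlim
    exact hlim.eventually_le_const hη₀
  filter_upwards [hclose] with D hD ξ
  have hhalf : (1 - θ) ^ 2 - Fintype.card (Fin (d + 1)) * η = (1 - θ) ^ 2 / 2 := by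
    rw [hη, Fintype.card_fin]
    field_simp
    ring
  rw [← hhalf]
  refine mul_dotProduct_self_le_of_abs_sub_diagonal_le (fun k => ?_) hη₀.le hD ξ
  have hv : |D.v₀| + |D.v₁| ≤ θ := by
    have := D.u_bound
    rwa [mul_add, ← abs_mul, ← abs_mul] at this
  have h₀ := abs_nonneg D.v₀
  have h₁ := abs_nonneg D.v₁
  by_cases hk : k = 0
  · simp only [hk, if_true]
    nlinarith [sq_nonneg D.v₁]
  · simp only [hk, if_false]
    nlinarith [le_abs_self D.v₀]

lemma eventually_det_bent (hd : 1 ≤ d) (hθ : θ < 1) : ∀ᶠ D in 𝓛, (metric D.bent 0).det ≠ 0 := by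
  obtain ⟨c, hc, h⟩ := exists_coercive_metric_bent (V := V) (K := K) hd hθ
  exact h.mono fun D hD => det_ne_zero_of_coercive hc hD

lemma isBigO_metricInv_bent (hd : 1 ≤ d) (hθ : θ < 1) (i j : Fin (d + 1)) :
    (fun D => metricInv D.bent 0 i j) =O[𝓛] fun _ => (1 : ℝ) := by
  obtain ⟨c, hc, h⟩ := exists_coercive_metric_bent (V := V) (K := K) hd hθ
  refine IsBigO.of_bound (1 / c) (h.mono fun D hD => ?_)
  rw [norm_one, mul_one]
  exact abs_inv_le_of_coercive hc hD i j

lemma isBigO_metric_bent_quadratic (hd : 1 ≤ d) (i j : Fin (d + 1)) :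
    (fun D => D.v₀ ^ 2 * (inner ℝ (pd i (nuPlus D.F) 0) (pd j (nuPlus D.F) 0) : ℝ)
        + dz i * dz j * D.v₁ ^ 2) =O[𝓛] fun D => D.size₁ * D.size₁ := by
  simp only [sq]
  exact (isBigO_mul_one (isBigO_v₀.mul isBigO_v₀)
      (isBigO_one_inner (isBigO_pd_nuPlus hd i) (isBigO_pd_nuPlus hd j))).add
    (isBigO_one_mul (isBigO_const_one ℝ _ _) (isBigO_v₁.mul isBigO_v₁))

lemma isBigO_metric_bent_sub (hd : 1 ≤ d) (i j : Fin (d + 1)) :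
    (fun D => metric D.bent 0 i j - metric D.F 0 i j) =O[𝓛] size₁ := by
  have h : (fun D => metric D.bent 0 i j - metric D.F 0 i j) =ᶠ[𝓛] fun D =>
      (D.v₀ ^ 2 * (inner ℝ (pd i (nuPlus D.F) 0) (pd j (nuPlus D.F) 0) : ℝ)
        + dz i * dz j * D.v₁ ^ 2) - 2 * D.v₀ * hPlus D.F 0 i j := by
    filter_upwards [eventually_meanCurv_ne_zero hd] with D hD
    rw [metric_bent hD]
    ring
  exact h.trans_isBigO (((isBigO_metric_bent_quadratic hd i j).trans
    (isBigO_mul_one (isBigO_refl _ _) isBigO_size₁_one)).sub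
    (isBigO_mul_one (isBigO_one_mul (isBigO_const_one ℝ _ _) isBigO_v₀) (isBigO_hPlus i j)))

lemma eventually_metricInv_bent_sub (hd : 1 ≤ d) (hθ : θ < 1) (i j : Fin (d + 1)) :
    ∀ᶠ D in 𝓛, metricInv D.bent 0 i j - metricInv D.F 0 i j
      = -∑ a, ∑ b, metricInv D.bent 0 i a * (metric D.bent 0 a b - metric D.F 0 a b)
          * metricInv D.F 0 b j :=
  (eventually_det_bent hd hθ).mono fun D hD => inv_apply_sub_inv_apply hD D.det_ne_zero i j

lemma isBigO_metricInv_bent_sub (hd : 1 ≤ d) (hθ : θ < 1) (i j : Fin (d + 1)) :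
    (fun D => metricInv D.bent 0 i j - metricInv D.F 0 i j) =O[𝓛] size₁ :=
  EventuallyEq.trans_isBigO (eventually_metricInv_bent_sub hd hθ i j)
    (IsBigO.fun_sum fun _ _ => IsBigO.fun_sum fun _ _ => isBigO_mul_one (isBigO_one_mul
      (isBigO_metricInv_bent hd hθ _ _) (isBigO_metric_bent_sub hd _ _))
      (isBigO_metricInv _ _)).neg_left

lemma isBigO_metricInv_bent_sub_sub (hd : 1 ≤ d) (hθ : θ < 1) (i j : Fin (d + 1)) :
    (fun D => metricInv D.bent 0 i j - metricInv D.F 0 i j - 2 * D.v₀ * hPlusUp D.F 0 i j)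
      =O[𝓛] err := by
  have h : (fun D => metricInv D.bent 0 i j - metricInv D.F 0 i j
      - 2 * D.v₀ * hPlusUp D.F 0 i j) =ᶠ[𝓛] fun D =>
      ∑ a, ∑ b, (((metricInv D.bent 0 i a - metricInv D.F 0 i a) * (2 * D.v₀ * hPlus D.F 0 a b))
          * metricInv D.F 0 b j
        - (metricInv D.bent 0 i a *
          (D.v₀ ^ 2 * (inner ℝ (pd a (nuPlus D.F) 0) (pd b (nuPlus D.F) 0) : ℝ)
            + dz a * dz b * D.v₁ ^ 2)) * metricInv D.F 0 b j) := by
    filter_upwards [eventually_meanCurv_ne_zero hd, eventually_metricInv_bent_sub hd hθ i j]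
      with D hD hsub
    rw [hsub, hPlusUp]
    simp only [Finset.mul_sum, ← Finset.sum_neg_distrib, ← Finset.sum_sub_distrib]
    refine Finset.sum_congr rfl fun a _ => Finset.sum_congr rfl fun b _ => ?_
    rw [metric_bent hD, metricInv_symm D.F 0 j b]
    ring
  refine h.trans_isBigO (IsBigO.fun_sum fun _ _ => IsBigO.fun_sum fun _ _ => IsBigO.sub
    (isBigO_mul_one ?_ (isBigO_metricInv _ _)) (isBigO_mul_one (isBigO_one_mul
      (isBigO_metricInv_bent hd hθ _ _) ((isBigO_metric_bent_quadratic hd _ _).trans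
        isBigO_size₁_mul_size₁)) (isBigO_metricInv _ _)))
  exact ((isBigO_metricInv_bent_sub hd hθ i _).mul (isBigO_mul_one
    (isBigO_one_mul (isBigO_const_one ℝ _ _) isBigO_v₀) (isBigO_hPlus _ _))).trans
    isBigO_size₁_mul_size₁

end BendData

section Expansion

variable {d : ℕ} {V : Type} [NormedAddCommGroup V] [InnerProductSpace ℝ V]

/-- The first order expansion of `h_{ij}` under the bending deformation, where `u₀`, `u₁`, `u₂` are
the values of `u`, `u'`, `u''`. -/
def sffExpansion (F : E (d + 1) → V) (x : E (d + 1)) (τ u₀ u₁ u₂ : ℝ) (i j : Fin (d + 1)) : V :=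
  sff F x i j
    + (τ * dz i * dz j * u₂) • nuPlus F x
    + (τ * u₀) • ∑ k, hPlusMixed F x j k • pd i (pd k F) x
    + (τ * dz j * u₁) • pd i (nuPlus F) x
    + (τ * dz i * u₁) • ∑ k, hPlusMixed F x j k • pd k F x
    + (τ * u₀) • ∑ k, pd i (fun y => hPlusMixed F y j k) x • pd k F x
    - (τ * u₁) • ∑ k, (dz i * hPlusMixed F x j k + dz j * hPlusMixed F x i k
        - metricInv F x 0 k * hPlus F x i j) • pd k F x

/-- The first order expansion of `h_i^j` under the bending deformation. -/
def weingartenExpansion (F : E (d + 1) → V) (x : E (d + 1)) (τ u₀ u₁ u₂ : ℝ)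
    (i j : Fin (d + 1)) : V :=
  weingarten F x i j
    + (τ * metricInv F x 0 j * dz i * u₂) • nuPlus F x
    - (τ * u₀) • ∑ k, hPlusUp F x j k • pd i (pd k F) x
    + (τ * metricInv F x 0 j * u₁) • pd i (nuPlus F) x
    + (τ * dz i * u₁) • ∑ k, hPlusUp F x j k • pd k F x
    + (τ * u₀) • ∑ k, pd i (fun y => hPlusUp F y j k) x • pd k F x
    - (τ * u₁) • ∑ k, (dz i * hPlusUp F x j k + metricInv F x 0 j * hPlusMixed F x i k
        - metricInv F x 0 k * hPlusMixed F x i j) • pd k F x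

/-- The first order expansion of `H` under the bending deformation. -/
def meanCurvExpansion (F : E (d + 1) → V) (x : E (d + 1)) (τ u₀ u₁ u₂ : ℝ) : V :=
  meanCurv F x
    + (τ * metricInv F x 0 0 * u₂) • nuPlus F x
    - (τ * u₀) • ∑ i, ∑ k, hPlusUp F x i k • pd i (pd k F) x
    + (τ * u₁) • ∑ i, metricInv F x 0 i • pd i (nuPlus F) x
    + (τ * u₁) • ∑ k, hPlusUp F x 0 k • pd k F x
    + (τ * u₀) • ∑ i, ∑ k, pd i (fun y => hPlusUp F y i k) x • pd k F x
    - (τ * u₁) • ∑ i, ∑ k, (dz i * hPlusUp F x i k + metricInv F x 0 i * hPlusMixed F x i k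
        - metricInv F x 0 k * hPlusMixed F x i i) • pd k F x

/-- The first order expansion of `|A|²` under the bending deformation of a neck. -/
def normSqAExpansion (F : E (d + 1) → V) (x : E (d + 1)) (τ u₀ u₂ : ℝ) : ℝ :=
  normSqA F x
    + 2 * τ * u₂ * hPlusUp F x 0 0
    + 2 * τ * u₀ * ∑ i, ∑ j, ∑ k, hPlusMixed F x j k * inner ℝ (sff F x i k) (sffUp F x i j)

/-- The first order expansion of `|H|²` under the bending deformation of a neck. -/
def normSqMeanCurvExpansion (F : E (d + 1) → V) (x : E (d + 1)) (τ u₀ u₂ : ℝ) : ℝ :=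
  ‖meanCurv F x‖ ^ 2
    + 2 * τ * u₂ * metricInv F x 0 0 * ‖meanCurv F x‖
    + 2 * τ * u₀ * (∑ i, ∑ j, ∑ k, hPlusMixed F x j k * hPlus F x i k * metricInv F x i j)
      * ‖meanCurv F x‖

variable {F : E (d + 1) → V} {x : E (d + 1)} {τ u₀ u₁ u₂ : ℝ}

lemma sum_metricInv_smul_sum_hPlusMixed (j : Fin (d + 1)) (X : Fin (d + 1) → V) :
    ∑ l, metricInv F x j l • ∑ k, hPlusMixed F x l k • X k = ∑ k, hPlusUp F x j k • X k := by
  simp only [Finset.smul_sum, smul_smul]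
  rw [Finset.sum_comm]
  simp only [← Finset.sum_smul, sum_metricInv_mul_hPlusMixed]

lemma sum_metricInv_smul_dz (j : Fin (d + 1)) (X : V) :
    ∑ l, metricInv F x j l • dz l • X = metricInv F x 0 j • X := by
  simp [dz, metricInv_symm F x j 0]

lemma sum_metricInv_smul_sum_christoffelVariation (i j : Fin (d + 1)) :
    ∑ l, metricInv F x j l • ∑ k, (dz i * hPlusMixed F x l k + dz l * hPlusMixed F x i k
        - metricInv F x 0 k * hPlus F x i l) • pd k F x
      = ∑ k, (dz i * hPlusUp F x j k + metricInv F x 0 j * hPlusMixed F x i k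
        - metricInv F x 0 k * hPlusMixed F x i j) • pd k F x := by
  simp only [Finset.smul_sum, smul_smul]
  rw [Finset.sum_comm]
  refine Finset.sum_congr rfl fun k _ => ?_
  have hdz : ∑ l, metricInv F x j l * dz l = metricInv F x 0 j := by
    simp [dz, metricInv_symm F x j 0]
  rw [← Finset.sum_smul, ← sum_metricInv_mul_hPlusMixed, hPlusMixed.eq_1 F x i j, ← hdz,
    Finset.mul_sum, Finset.sum_mul, Finset.mul_sum, ← Finset.sum_add_distrib,
    ← Finset.sum_sub_distrib]
  congr 1
  exact Finset.sum_congr rfl fun l _ => by ring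

lemma sum_metricInv_smul_sffExpansion (i j : Fin (d + 1)) :
    ∑ l, metricInv F x j l • sffExpansion F x τ u₀ u₁ u₂ i l
      = weingartenExpansion F x τ u₀ u₁ u₂ i j
        + (τ * u₀) • ((2 : ℝ) • ∑ k, hPlusUp F x j k • pd i (pd k F) x
          + (∑ l, metricInv F x j l • ∑ k, pd i (fun y => hPlusMixed F y l k) x • pd k F x
            - ∑ k, pd i (fun y => hPlusUp F y j k) x • pd k F x)) := by
  have hterm (l : Fin (d + 1)) : metricInv F x j l • sffExpansion F x τ u₀ u₁ u₂ i l
      = metricInv F x j l • sff F x i l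
        + (τ * dz i * u₂) • metricInv F x j l • dz l • nuPlus F x
        + (τ * u₀) • metricInv F x j l • ∑ k, hPlusMixed F x l k • pd i (pd k F) x
        + (τ * u₁) • metricInv F x j l • dz l • pd i (nuPlus F) x
        + (τ * dz i * u₁) • metricInv F x j l • ∑ k, hPlusMixed F x l k • pd k F x
        + (τ * u₀) • metricInv F x j l • ∑ k, pd i (fun y => hPlusMixed F y l k) x • pd k F x
        - (τ * u₁) • metricInv F x j l • ∑ k, (dz i * hPlusMixed F x l k
          + dz l * hPlusMixed F x i k - metricInv F x 0 k * hPlus F x i l) • pd k F x := by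
    rw [sffExpansion]
    module
  simp only [hterm, Finset.sum_add_distrib, Finset.sum_sub_distrib, ← Finset.smul_sum,
    sum_metricInv_smul_sum_hPlusMixed, sum_metricInv_smul_dz,
    sum_metricInv_smul_sum_christoffelVariation]
  rw [weingartenExpansion, weingarten]
  module

lemma sum_weingartenExpansion :
    ∑ i, weingartenExpansion F x τ u₀ u₁ u₂ i i = meanCurvExpansion F x τ u₀ u₁ u₂ := by
  have hdz (X : Fin (d + 1) → V) : ∑ i, dz i • X i = X 0 := by simp [dz]
  have hterm (i : Fin (d + 1)) : weingartenExpansion F x τ u₀ u₁ u₂ i i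
      = weingarten F x i i
        + (τ * u₂) • dz i • metricInv F x 0 i • nuPlus F x
        - (τ * u₀) • ∑ k, hPlusUp F x i k • pd i (pd k F) x
        + (τ * u₁) • metricInv F x 0 i • pd i (nuPlus F) x
        + (τ * u₁) • dz i • ∑ k, hPlusUp F x i k • pd k F x
        + (τ * u₀) • ∑ k, pd i (fun y => hPlusUp F y i k) x • pd k F x
        - (τ * u₁) • ∑ k, (dz i * hPlusUp F x i k + metricInv F x 0 i * hPlusMixed F x i k
          - metricInv F x 0 k * hPlusMixed F x i i) • pd k F x := by
    rw [weingartenExpansion]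
    module
  simp only [hterm, Finset.sum_add_distrib, Finset.sum_sub_distrib, ← Finset.smul_sum, hdz]
  rw [meanCurvExpansion, meanCurv]
  module

lemma IsNormalAt.inner_weingartenExpansion (hF : ContDiffAt ℝ 2 F x) {w : V}
    (hw : IsNormalAt F x w) (i j : Fin (d + 1)) :
    (inner ℝ w (weingartenExpansion F x τ u₀ u₁ u₂ i j) : ℝ) = inner ℝ w (weingarten F x i j)
      + τ * metricInv F x 0 j * dz i * u₂ * inner ℝ w (nuPlus F x)
      + τ * u₀ * ∑ k, hPlusUp F x j k * inner ℝ w (sff F x i k)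
      + τ * metricInv F x 0 j * u₁ * inner ℝ w (pd i (nuPlus F) x) := by
  have hpd_pd (k : Fin (d + 1)) : (inner ℝ w (pd i (pd k F) x) : ℝ) = -inner ℝ w (sff F x i k) := by
    rw [real_inner_comm, hw.inner_pd_pd hF, real_inner_comm]
  have hpd (k : Fin (d + 1)) : (inner ℝ w (pd k F x) : ℝ) = 0 := hw k
  simp only [weingartenExpansion, inner_add_right, inner_sub_right, real_inner_smul_right,
    inner_sum, hpd, hpd_pd, mul_zero, mul_neg, Finset.sum_neg_distrib, Finset.sum_const_zero,
    sub_neg_eq_add, add_zero, sub_zero]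

lemma two_mul_sum_inner_weingartenExpansion (hF : ContDiffAt ℝ 2 F x)
    (hx : (metric F x).det ≠ 0) :
    2 * ∑ i, ∑ j, (inner ℝ (weingarten F x i j) (weingartenExpansion F x τ u₀ u₁ u₂ j i) : ℝ)
      = normSqA F x + normSqAExpansion F x τ u₀ u₂
        + 2 * (τ * u₁ * ∑ i, ∑ j, metricInv F x 0 i *
          inner ℝ (weingarten F x i j) (pd j (nuPlus F) x)) := by
  have hu₂ : ∑ i, ∑ j, τ * metricInv F x 0 i * dz j * u₂ * hPlusMixed F x i j
      = τ * u₂ * hPlusUp F x 0 0 := by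
    rw [← sum_metricInv_mul_hPlusMixed, Finset.mul_sum]
    exact Finset.sum_congr rfl fun i _ => by simp [dz]; ring
  have hu₁ : ∑ i, ∑ j, τ * metricInv F x 0 i * u₁ *
        (inner ℝ (weingarten F x i j) (pd j (nuPlus F) x) : ℝ)
      = τ * u₁ * ∑ i, ∑ j, metricInv F x 0 i *
        inner ℝ (weingarten F x i j) (pd j (nuPlus F) x) := by
    simp only [Finset.mul_sum]
    exact Finset.sum_congr rfl fun i _ => Finset.sum_congr rfl fun j _ => by ring
  simp only [(isNormalAt_weingarten hF hx _ _).inner_weingartenExpansion hF,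
    Finset.sum_add_distrib, inner_weingarten_nuPlus, hu₂, hu₁]
  simp only [← Finset.mul_sum]
  rw [← normSqA_eq_sum_inner_weingarten hF, ← sum_hPlusMixed_mul_inner_sffUp hF, normSqAExpansion]
  ring

lemma sum_hPlusMixed_mul_hPlus_mul_metricInv (F : E (d + 1) → V) (x : E (d + 1)) :
    ∑ i, ∑ j, ∑ k, hPlusMixed F x j k * hPlus F x i k * metricInv F x i j
      = ∑ i, ∑ k, hPlusUp F x i k * hPlus F x i k := by
  refine Finset.sum_congr rfl fun i _ => ?_
  rw [Finset.sum_comm]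
  refine Finset.sum_congr rfl fun k _ => ?_
  rw [← sum_metricInv_mul_hPlusMixed, Finset.sum_mul]
  exact Finset.sum_congr rfl fun j _ => by ring

lemma two_mul_inner_meanCurvExpansion (hF : ContDiffAt ℝ 2 F x) (hx : (metric F x).det ≠ 0)
    (hdiff : DifferentiableAt ℝ (meanCurv F) x) (hH : meanCurv F x ≠ 0) :
    2 * (inner ℝ (meanCurv F x) (meanCurvExpansion F x τ u₀ u₁ u₂) : ℝ)
      = ‖meanCurv F x‖ ^ 2 + normSqMeanCurvExpansion F x τ u₀ u₂ := by
  have hν : DifferentiableAt ℝ (nuPlus F) x :=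
    ((hdiff.norm ℝ hH).inv (norm_ne_zero_iff.2 hH)).smul hdiff
  have hinner (w : V) :
      (inner ℝ (meanCurv F x) w : ℝ) = ‖meanCurv F x‖ * inner ℝ (nuPlus F x) w := by
    rw [← real_inner_smul_left, norm_meanCurv_smul_nuPlus hH]
  have hpd_ν (i : Fin (d + 1)) : (inner ℝ (meanCurv F x) (pd i (nuPlus F) x) : ℝ) = 0 := by
    rw [hinner, inner_nuPlus_pd_nuPlus hν (hdiff.continuousAt.eventually_ne hH), mul_zero]
  have hν_ν : (inner ℝ (meanCurv F x) (nuPlus F x) : ℝ) = ‖meanCurv F x‖ := by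
    rw [hinner, real_inner_self_eq_norm_sq, norm_nuPlus hH, one_pow, mul_one]
  have hsff (i k : Fin (d + 1)) :
      (inner ℝ (meanCurv F x) (sff F x i k) : ℝ) = ‖meanCurv F x‖ * hPlus F x i k := by
    rw [hinner, real_inner_comm, hPlus]
  have hdz : ∑ i : Fin (d + 1), τ * metricInv F x 0 i * dz i * u₂ * ‖meanCurv F x‖
      = τ * u₂ * metricInv F x 0 0 * ‖meanCurv F x‖ := by
    simp [dz, mul_right_comm]
  have hquad : ∑ i, τ * u₀ * ∑ k, hPlusUp F x i k * (‖meanCurv F x‖ * hPlus F x i k)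
      = τ * u₀ * (∑ i, ∑ k, hPlusUp F x i k * hPlus F x i k) * ‖meanCurv F x‖ := by
    simp only [← Finset.mul_sum, mul_left_comm _ ‖meanCurv F x‖]
    ring
  rw [← sum_weingartenExpansion, inner_sum, normSqMeanCurvExpansion,
    sum_hPlusMixed_mul_hPlus_mul_metricInv]
  simp only [IsNormalAt.inner_weingartenExpansion hF (isNormalAt_meanCurv hF hx), hν_ν, hpd_ν,
    hsff, mul_zero, add_zero, Finset.sum_add_distrib, hdz, hquad]
  rw [← inner_sum, ← meanCurv, real_inner_self_eq_norm_sq]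
  ring

end Expansion

namespace BendData

variable {d : ℕ} {V : Type} [NormedAddCommGroup V] [InnerProductSpace ℝ V] {θ K : ℝ}

local notation "𝓛" => nearCylinder d V θ K

section Bent

variable (D : BendData d V θ K)

/-- The first variation of `⟨∂ᵢ∂ⱼF, ∂ₖF⟩`, up to terms which are small for a neck. -/
def innerVariation (i j k : Fin (d + 1)) : ℝ :=
  D.v₁ * (dz k * hPlus D.F 0 i j - dz i * hPlus D.F 0 j k - dz j * hPlus D.F 0 i k)

/-- The first variation of `Γ_{ij}^k`, up to terms which are small for a neck. -/
def christoffelVariation (i j k : Fin (d + 1)) : ℝ :=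
  ∑ l, metricInv D.F 0 k l * D.innerVariation i j l

lemma christoffelVariation_eq (i j k : Fin (d + 1)) : D.christoffelVariation i j k
    = -(D.v₁ * (dz i * hPlusMixed D.F 0 j k + dz j * hPlusMixed D.F 0 i k
      - metricInv D.F 0 0 k * hPlus D.F 0 i j)) := by
  have hdz : ∑ l, metricInv D.F 0 k l * dz l = metricInv D.F 0 0 k := by
    simp [dz, metricInv_symm D.F 0 k 0]
  rw [← hdz, christoffelVariation, hPlusMixed, hPlusMixed]
  simp only [Finset.mul_sum, Finset.sum_mul, ← Finset.sum_add_distrib, ← Finset.sum_sub_distrib,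
    ← Finset.sum_neg_distrib]
  exact Finset.sum_congr rfl fun l _ => by rw [innerVariation]; ring

variable {D}

lemma inner_pd_pd_bent_pd_bent (hH : meanCurv D.F 0 ≠ 0) (i j k : Fin (d + 1)) :
    (inner ℝ (pd i (pd j D.bent) 0) (pd k D.bent 0) : ℝ)
      = inner ℝ (pd i (pd j D.F) 0) (pd k D.F 0) + D.innerVariation i j k
        - D.v₀ * inner ℝ (pd i (pd j D.F) 0) (pd k (nuPlus D.F) 0)
        - D.v₀ * inner ℝ (pd i (pd j (nuPlus D.F)) 0) (pd k D.F 0)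
        + inner ℝ (D.dev₂ i j) (D.dev₁ k) := by
  have hν := isNormalAt_nuPlus D.smooth_two D.det_ne_zero
  have hdev₁ : (inner ℝ (pd i (pd j D.F) 0) (D.dev₁ k) : ℝ)
      = D.v₀ * inner ℝ (pd i (pd j D.F) 0) (pd k (nuPlus D.F) 0)
        - dz k * D.v₁ * hPlus D.F 0 i j := by
    rw [dev₁, inner_add_right, real_inner_smul_right, real_inner_smul_right,
      hν.inner_pd_pd D.smooth_two, hPlus]
    ring
  have hdev₂ : (inner ℝ (D.dev₂ i j) (pd k D.F 0) : ℝ)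
      = D.v₀ * inner ℝ (pd i (pd j (nuPlus D.F)) 0) (pd k D.F 0)
        + dz i * D.v₁ * hPlus D.F 0 j k + dz j * D.v₁ * hPlus D.F 0 i k := by
    simp only [dev₂, inner_add_left, real_inner_smul_left,
      inner_pd_nuPlus_pd D.smooth_two D.det_ne_zero (differentiableAt_nuPlus hH), hν k]
    ring
  rw [pd_pd_bent hH, pd_bent hH, inner_sub_left, inner_sub_right, inner_sub_right, hdev₁, hdev₂,
    innerVariation]
  ring

lemma sff_bent_sub (hH : meanCurv D.F 0 ≠ 0) (i j : Fin (d + 1)) :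
    sff D.bent 0 i j - sff D.F 0 i j = D.dev₂ i j
      + ∑ k, ((christoffel (metric D.bent) 0 i j k - christoffel (metric D.F) 0 i j k) •
          pd k D.bent 0 - christoffel (metric D.F) 0 i j k • D.dev₁ k) := by
  have hterm (k : Fin (d + 1)) :
      (christoffel (metric D.bent) 0 i j k - christoffel (metric D.F) 0 i j k) • pd k D.bent 0
        - christoffel (metric D.F) 0 i j k • D.dev₁ k
      = christoffel (metric D.bent) 0 i j k • pd k D.bent 0
        - christoffel (metric D.F) 0 i j k • pd k D.F 0 := by
    rw [pd_bent hH]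
    module
  simp only [hterm, Finset.sum_sub_distrib]
  rw [sff, sff, pd_pd_bent hH]
  abel

lemma sff_bent_sub_sffExpansion (hH : meanCurv D.F 0 ≠ 0) (i j : Fin (d + 1)) :
    sff D.bent 0 i j - sffExpansion D.F 0 D.τ (D.u 0) (deriv D.u 0) (deriv (deriv D.u) 0) i j
      = (dz i * D.v₁) • (pd j (nuPlus D.F) 0 - ∑ k, hPlusMixed D.F 0 j k • pd k D.F 0)
        + D.v₀ • (pd i (pd j (nuPlus D.F)) 0 - ∑ k, hPlusMixed D.F 0 j k • pd i (pd k D.F) 0)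
        - D.v₀ • ∑ k, pd i (fun x => hPlusMixed D.F x j k) 0 • pd k D.F 0
        + ∑ k, ((christoffel (metric D.bent) 0 i j k - (christoffel (metric D.F) 0 i j k
              + D.christoffelVariation i j k)) • pd k D.bent 0
            - (christoffel (metric D.F) 0 i j k + D.christoffelVariation i j k) • D.dev₁ k) := by
  have hterm (k : Fin (d + 1)) :
      (christoffel (metric D.bent) 0 i j k - (christoffel (metric D.F) 0 i j k
          + D.christoffelVariation i j k)) • pd k D.bent 0
        - (christoffel (metric D.F) 0 i j k + D.christoffelVariation i j k) • D.dev₁ k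
      = ((christoffel (metric D.bent) 0 i j k - christoffel (metric D.F) 0 i j k) •
          pd k D.bent 0 - christoffel (metric D.F) 0 i j k • D.dev₁ k)
        + D.v₁ • (dz i * hPlusMixed D.F 0 j k + dz j * hPlusMixed D.F 0 i k
          - metricInv D.F 0 0 k * hPlus D.F 0 i j) • pd k D.F 0 := by
    rw [christoffelVariation_eq, pd_bent hH]
    module
  rw [← sub_add_cancel (sff D.bent 0 i j) (sff D.F 0 i j), sff_bent_sub hH]
  simp only [hterm, Finset.sum_add_distrib, ← Finset.smul_sum]
  rw [sffExpansion, dev₂]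
  simp only [v₀, v₁, v₂]
  module

end Bent

lemma isBigO_innerVariation (i j k : Fin (d + 1)) :
    (fun D => D.innerVariation i j k) =O[𝓛] size₁ := by
  have hdz (l a b : Fin (d + 1)) :
      (fun D => dz l * hPlus D.F 0 a b) =O[𝓛] fun _ => (1 : ℝ) :=
    isBigO_one_mul (isBigO_const_one ℝ _ _) (isBigO_hPlus _ _)
  exact isBigO_mul_one isBigO_v₁ (((hdz _ _ _).sub (hdz _ _ _)).sub (hdz _ _ _))

lemma isBigO_christoffelVariation (i j k : Fin (d + 1)) :
    (fun D => D.christoffelVariation i j k) =O[𝓛] size₁ :=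
  IsBigO.fun_sum fun _ _ => isBigO_one_mul (isBigO_metricInv _ _) (isBigO_innerVariation _ _ _)

lemma isBigO_inner_pd_pd_pd_nuPlus (hd : 1 ≤ d) (i j k : Fin (d + 1)) :
    (fun D => (inner ℝ (pd i (pd j D.F) 0) (pd k (nuPlus D.F) 0) : ℝ)) =O[𝓛] ε := by
  have h (D : BendData d V θ K) : (inner ℝ (pd i (pd j D.F) 0) (pd k (nuPlus D.F) 0) : ℝ)
      = inner ℝ (pd i (pd j D.F) 0)
          (pd k (nuPlus D.F) 0 - ∑ l, hPlusMixed D.F 0 k l • pd l D.F 0)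
        + ∑ l, hPlusMixed D.F 0 k l * inner ℝ (pd i (pd j D.F) 0) (pd l D.F 0) := by
    simp only [inner_sub_right, inner_sum, real_inner_smul_right, sub_add_cancel]
  simp only [h]
  exact (isBigO_one_inner (isBigO_pd_pd _ _) (isBigO_pd_nuPlus_sub hd k)).add
    (IsBigO.fun_sum fun _ _ => isBigO_one_mul (isBigO_hPlusMixed _ _)
      (isBigO_inner_pd_pd_pd _ _ _))

lemma isBigO_inner_pd_pd_nuPlus_pd (hd : 1 ≤ d) (i j k : Fin (d + 1)) :
    (fun D => (inner ℝ (pd i (pd j (nuPlus D.F)) 0) (pd k D.F 0) : ℝ)) =O[𝓛] ε := by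
  have h (D : BendData d V θ K) : (inner ℝ (pd i (pd j (nuPlus D.F)) 0) (pd k D.F 0) : ℝ)
      = inner ℝ (pd i (pd j (nuPlus D.F)) 0 - ∑ l, hPlusMixed D.F 0 j l • pd i (pd l D.F) 0)
          (pd k D.F 0)
        + ∑ l, hPlusMixed D.F 0 j l * inner ℝ (pd i (pd l D.F) 0) (pd k D.F 0) := by
    simp only [inner_sub_left, sum_inner, real_inner_smul_left, sub_add_cancel]
  simp only [h]
  exact (isBigO_inner_one (isBigO_pd_pd_nuPlus_sub hd i j) (isBigO_pd k)).add
    (IsBigO.fun_sum fun _ _ => isBigO_one_mul (isBigO_hPlusMixed _ _)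
      (isBigO_inner_pd_pd_pd _ _ _))

lemma isBigO_inner_bent_sub_innerVariation (hd : 1 ≤ d) (i j k : Fin (d + 1)) :
    (fun D => (inner ℝ (pd i (pd j D.bent) 0) (pd k D.bent 0) : ℝ)
      - (inner ℝ (pd i (pd j D.F) 0) (pd k D.F 0) + D.innerVariation i j k)) =O[𝓛] err := by
  have h : (fun D => (inner ℝ (pd i (pd j D.bent) 0) (pd k D.bent 0) : ℝ)
      - (inner ℝ (pd i (pd j D.F) 0) (pd k D.F 0) + D.innerVariation i j k)) =ᶠ[𝓛] fun D =>
      inner ℝ (D.dev₂ i j) (D.dev₁ k)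
        - D.v₀ * inner ℝ (pd i (pd j D.F) 0) (pd k (nuPlus D.F) 0)
        - D.v₀ * inner ℝ (pd i (pd j (nuPlus D.F)) 0) (pd k D.F 0) := by
    filter_upwards [eventually_meanCurv_ne_zero hd] with D hD
    rw [inner_pd_pd_bent_pd_bent hD]
    ring
  exact h.trans_isBigO ((((isBigO_inner (isBigO_dev₂ hd i j) (isBigO_dev₁ hd k)).trans
      isBigO_size₂_mul_size₁).sub
    ((isBigO_v₀.mul (isBigO_inner_pd_pd_pd_nuPlus hd _ _ _)).trans isBigO_size₁_mul_ε)).sub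
    ((isBigO_v₀.mul (isBigO_inner_pd_pd_nuPlus_pd hd _ _ _)).trans isBigO_size₁_mul_ε))

lemma isBigO_inner_bent_sub (hd : 1 ≤ d) (i j k : Fin (d + 1)) :
    (fun D => (inner ℝ (pd i (pd j D.bent) 0) (pd k D.bent 0) : ℝ)
      - inner ℝ (pd i (pd j D.F) 0) (pd k D.F 0)) =O[𝓛] size₂ := by
  have h : (fun D => (inner ℝ (pd i (pd j D.bent) 0) (pd k D.bent 0) : ℝ)
      - inner ℝ (pd i (pd j D.F) 0) (pd k D.F 0)) =ᶠ[𝓛] fun D =>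
      -(inner ℝ (D.dev₂ i j) (pd k D.bent 0) : ℝ) - inner ℝ (pd i (pd j D.F) 0) (D.dev₁ k) := by
    filter_upwards [eventually_meanCurv_ne_zero hd] with D hD
    rw [pd_pd_bent hD, pd_bent hD]
    simp only [inner_sub_left, inner_sub_right]
    ring
  exact h.trans_isBigO ((isBigO_inner_one (isBigO_dev₂ hd i j) (isBigO_pd_bent hd k)).neg_left.sub
    (isBigO_one_inner (isBigO_pd_pd i j) ((isBigO_dev₁ hd k).trans isBigO_size₁)))

lemma eventually_christoffel_bent (hd : 1 ≤ d) (i j k : Fin (d + 1)) : ∀ᶠ D in 𝓛,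
    christoffel (metric D.bent) 0 i j k
      = ∑ l, metricInv D.bent 0 k l * inner ℝ (pd i (pd j D.bent) 0) (pd l D.bent 0) :=
  (eventually_meanCurv_ne_zero hd).mono fun _ hD => christoffel_metric (contDiffAt_bent hD) i j k

lemma isBigO_christoffel_bent_sub (hd : 1 ≤ d) (hθ : θ < 1) (i j k : Fin (d + 1)) :
    (fun D => christoffel (metric D.bent) 0 i j k - christoffel (metric D.F) 0 i j k)
      =O[𝓛] size₂ := by
  have h : (fun D => christoffel (metric D.bent) 0 i j k - christoffel (metric D.F) 0 i j k)
      =ᶠ[𝓛] fun D => ∑ l,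
        (metricInv D.bent 0 k l * ((inner ℝ (pd i (pd j D.bent) 0) (pd l D.bent 0) : ℝ)
          - inner ℝ (pd i (pd j D.F) 0) (pd l D.F 0))
        + (metricInv D.bent 0 k l - metricInv D.F 0 k l)
          * inner ℝ (pd i (pd j D.F) 0) (pd l D.F 0)) := by
    filter_upwards [eventually_christoffel_bent hd i j k] with D hD
    rw [hD, christoffel_metric D.smooth_two, ← Finset.sum_sub_distrib]
    exact Finset.sum_congr rfl fun l _ => by ring
  exact h.trans_isBigO (IsBigO.fun_sum fun l _ =>
    (isBigO_one_mul (isBigO_metricInv_bent hd hθ _ _) (isBigO_inner_bent_sub hd _ _ _)).add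
    (isBigO_mul_one ((isBigO_metricInv_bent_sub hd hθ _ _).trans isBigO_size₁)
      ((isBigO_inner_pd_pd_pd _ _ _).trans isBigO_ε)))

lemma isBigO_christoffel_bent_sub_christoffelVariation (hd : 1 ≤ d) (hθ : θ < 1)
    (i j k : Fin (d + 1)) :
    (fun D => christoffel (metric D.bent) 0 i j k
      - (christoffel (metric D.F) 0 i j k + D.christoffelVariation i j k)) =O[𝓛] err := by
  have h : (fun D => christoffel (metric D.bent) 0 i j k
      - (christoffel (metric D.F) 0 i j k + D.christoffelVariation i j k)) =ᶠ[𝓛] fun D => ∑ l,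
        (metricInv D.bent 0 k l * ((inner ℝ (pd i (pd j D.bent) 0) (pd l D.bent 0) : ℝ)
          - (inner ℝ (pd i (pd j D.F) 0) (pd l D.F 0) + D.innerVariation i j l))
        + ((metricInv D.bent 0 k l - metricInv D.F 0 k l)
            * inner ℝ (pd i (pd j D.F) 0) (pd l D.F 0)
          + (metricInv D.bent 0 k l - metricInv D.F 0 k l) * D.innerVariation i j l)) := by
    filter_upwards [eventually_christoffel_bent hd i j k] with D hD
    rw [hD, christoffel_metric D.smooth_two, christoffelVariation, ← Finset.sum_add_distrib,
      ← Finset.sum_sub_distrib]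
    exact Finset.sum_congr rfl fun l _ => by ring
  exact h.trans_isBigO (IsBigO.fun_sum fun l _ =>
    (isBigO_one_mul (isBigO_metricInv_bent hd hθ _ _)
      (isBigO_inner_bent_sub_innerVariation hd _ _ _)).add
    ((((isBigO_metricInv_bent_sub hd hθ _ _).mul (isBigO_inner_pd_pd_pd _ _ _)).trans
      isBigO_size₁_mul_ε).add
    (((isBigO_metricInv_bent_sub hd hθ _ _).mul (isBigO_innerVariation _ _ _)).trans
      isBigO_size₁_mul_size₁)))

lemma isBigO_sff_bent_sub (hd : 1 ≤ d) (hθ : θ < 1) (i j : Fin (d + 1)) :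
    (fun D => sff D.bent 0 i j - sff D.F 0 i j) =O[𝓛] size₂ :=
  EventuallyEq.trans_isBigO
    ((eventually_meanCurv_ne_zero hd).mono fun _ hD => sff_bent_sub hD i j)
    ((isBigO_dev₂ hd i j).add (IsBigO.fun_sum fun _ _ =>
      (isBigO_smul_one (isBigO_christoffel_bent_sub hd hθ _ _ _) (isBigO_pd_bent hd _)).sub
        (isBigO_one_smul ((isBigO_christoffel _ _ _).trans isBigO_ε)
          ((isBigO_dev₁ hd _).trans isBigO_size₁))))

lemma isBigO_sff_bent_sub_sffExpansion (hd : 1 ≤ d) (hθ : θ < 1) (i j : Fin (d + 1)) :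
    (fun D => sff D.bent 0 i j
      - sffExpansion D.F 0 D.τ (D.u 0) (deriv D.u 0) (deriv (deriv D.u) 0) i j) =O[𝓛] err := by
  have hε_mul : (fun D => D.ε * D.size₁) =O[𝓛] err := by
    simpa only [mul_comm] using isBigO_size₁_mul_ε (V := V)
  have hν : (fun D => (dz i * D.v₁) •
      (pd j (nuPlus D.F) 0 - ∑ k, hPlusMixed D.F 0 j k • pd k D.F 0)) =O[𝓛] err :=
    ((isBigO_one_mul (isBigO_const_one ℝ _ _) isBigO_v₁).smul
      (isBigO_pd_nuPlus_sub hd j)).trans isBigO_size₁_mul_ε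
  have hpd_ν : (fun D => D.v₀ •
      (pd i (pd j (nuPlus D.F)) 0 - ∑ k, hPlusMixed D.F 0 j k • pd i (pd k D.F) 0)) =O[𝓛] err :=
    (isBigO_v₀.smul (isBigO_pd_pd_nuPlus_sub hd i j)).trans isBigO_size₁_mul_ε
  have hpd_h : (fun D => D.v₀ • ∑ k, pd i (fun x => hPlusMixed D.F x j k) 0 • pd k D.F 0)
      =O[𝓛] err :=
    (isBigO_v₀.smul (IsBigO.fun_sum fun k _ =>
      isBigO_smul_one (isBigO_pd_hPlusMixed hd _ _ _) (isBigO_pd k))).trans isBigO_size₁_mul_ε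
  have hΓ (k : Fin (d + 1)) : (fun D => (christoffel (metric D.F) 0 i j k
      + D.christoffelVariation i j k) • D.dev₁ k) =O[𝓛] err := by
    simp only [add_smul]
    exact (((isBigO_christoffel _ _ _).smul (isBigO_dev₁ hd _)).trans hε_mul).add
      (((isBigO_christoffelVariation _ _ _).smul (isBigO_dev₁ hd _)).trans isBigO_size₁_mul_size₁)
  exact EventuallyEq.trans_isBigO
    ((eventually_meanCurv_ne_zero hd).mono fun _ hD => sff_bent_sub_sffExpansion hD i j)
    (((hν.add hpd_ν).sub hpd_h).add
      (IsBigO.fun_sum fun k _ => (isBigO_smul_one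
        (isBigO_christoffel_bent_sub_christoffelVariation hd hθ _ _ _) (isBigO_pd_bent hd k)).sub
          (hΓ k)))

lemma isBigO_weingarten (i j : Fin (d + 1)) :
    (fun D => weingarten D.F 0 i j) =O[𝓛] fun _ => (1 : ℝ) :=
  IsBigO.fun_sum fun _ _ => isBigO_one_smul (isBigO_metricInv _ _) (isBigO_sff _ _)

lemma isBigO_weingarten_bent_sub (hd : 1 ≤ d) (hθ : θ < 1) (i j : Fin (d + 1)) :
    (fun D => weingarten D.bent 0 i j - weingarten D.F 0 i j) =O[𝓛] size₂ := by
  have h (D : BendData d V θ K) : weingarten D.bent 0 i j - weingarten D.F 0 i j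
      = ∑ l, (metricInv D.bent 0 j l • (sff D.bent 0 i l - sff D.F 0 i l)
        + (metricInv D.bent 0 j l - metricInv D.F 0 j l) • sff D.F 0 i l) := by
    rw [weingarten, weingarten, ← Finset.sum_sub_distrib]
    exact Finset.sum_congr rfl fun l _ => by module
  simp only [h]
  exact IsBigO.fun_sum fun _ _ =>
    (isBigO_one_smul (isBigO_metricInv_bent hd hθ _ _) (isBigO_sff_bent_sub hd hθ _ _)).add
      (isBigO_smul_one ((isBigO_metricInv_bent_sub hd hθ _ _).trans isBigO_size₁) (isBigO_sff _ _))

lemma weingarten_bent_sub_weingartenExpansion (D : BendData d V θ K) (i j : Fin (d + 1)) :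
    weingarten D.bent 0 i j
        - weingartenExpansion D.F 0 D.τ (D.u 0) (deriv D.u 0) (deriv (deriv D.u) 0) i j
      = ∑ l, ((metricInv D.bent 0 j l - metricInv D.F 0 j l - 2 * D.v₀ * hPlusUp D.F 0 j l) •
            sff D.F 0 i l
          + (metricInv D.bent 0 j l - metricInv D.F 0 j l) • (sff D.bent 0 i l - sff D.F 0 i l)
          + metricInv D.F 0 j l • (sff D.bent 0 i l
            - sffExpansion D.F 0 D.τ (D.u 0) (deriv D.u 0) (deriv (deriv D.u) 0) i l))
        + D.v₀ • ((2 : ℝ) • ∑ k, hPlusUp D.F 0 j k • (pd i (pd k D.F) 0 + sff D.F 0 i k)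
          + (∑ l, metricInv D.F 0 j l • ∑ k, pd i (fun x => hPlusMixed D.F x l k) 0 • pd k D.F 0
            - ∑ k, pd i (fun x => hPlusUp D.F x j k) 0 • pd k D.F 0)) := by
  have hterm (l : Fin (d + 1)) :
      (metricInv D.bent 0 j l - metricInv D.F 0 j l - 2 * D.v₀ * hPlusUp D.F 0 j l) • sff D.F 0 i l
        + (metricInv D.bent 0 j l - metricInv D.F 0 j l) • (sff D.bent 0 i l - sff D.F 0 i l)
        + metricInv D.F 0 j l • (sff D.bent 0 i l
          - sffExpansion D.F 0 D.τ (D.u 0) (deriv D.u 0) (deriv (deriv D.u) 0) i l)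
      = metricInv D.bent 0 j l • sff D.bent 0 i l - (2 * D.v₀) • hPlusUp D.F 0 j l • sff D.F 0 i l
        - metricInv D.F 0 j l •
          sffExpansion D.F 0 D.τ (D.u 0) (deriv D.u 0) (deriv (deriv D.u) 0) i l := by
    module
  simp only [hterm, Finset.sum_sub_distrib, ← Finset.smul_sum, sum_metricInv_smul_sffExpansion]
  rw [weingarten, v₀]
  simp only [smul_add, Finset.sum_add_distrib]
  module

lemma isBigO_weingarten_bent_sub_weingartenExpansion (hd : 1 ≤ d) (hθ : θ < 1)
    (i j : Fin (d + 1)) :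
    (fun D => weingarten D.bent 0 i j
      - weingartenExpansion D.F 0 D.τ (D.u 0) (deriv D.u 0) (deriv (deriv D.u) 0) i j)
      =O[𝓛] err := by
  have hpd_pd : (fun D => (2 : ℝ) • ∑ k, hPlusUp D.F 0 j k • (pd i (pd k D.F) 0 + sff D.F 0 i k))
      =O[𝓛] ε :=
    isBigO_one_smul (isBigO_const_one ℝ _ _) (IsBigO.fun_sum fun _ _ =>
      isBigO_one_smul (isBigO_hPlusUp _ _) (isBigO_pd_pd_add_sff _ _))
  have hpd_hMixed : (fun D => ∑ l, metricInv D.F 0 j l •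
      ∑ k, pd i (fun x => hPlusMixed D.F x l k) 0 • pd k D.F 0) =O[𝓛] ε :=
    IsBigO.fun_sum fun _ _ => isBigO_one_smul (isBigO_metricInv _ _) (IsBigO.fun_sum fun _ _ =>
      isBigO_smul_one (isBigO_pd_hPlusMixed hd _ _ _) (isBigO_pd _))
  have hpd_hUp : (fun D => ∑ k, pd i (fun x => hPlusUp D.F x j k) 0 • pd k D.F 0) =O[𝓛] ε :=
    IsBigO.fun_sum fun _ _ => isBigO_smul_one (isBigO_pd_hPlusUp hd _ _ _) (isBigO_pd _)
  simp only [weingarten_bent_sub_weingartenExpansion]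
  exact (IsBigO.fun_sum fun _ _ =>
    ((isBigO_smul_one (isBigO_metricInv_bent_sub_sub hd hθ _ _) (isBigO_sff _ _)).add
      (((isBigO_metricInv_bent_sub hd hθ _ _).smul (isBigO_sff_bent_sub hd hθ _ _)).trans
        isBigO_size₁_mul_size₂)).add
      (isBigO_one_smul (isBigO_metricInv _ _) (isBigO_sff_bent_sub_sffExpansion hd hθ _ _))).add
    ((isBigO_v₀.smul (hpd_pd.add (hpd_hMixed.sub hpd_hUp))).trans isBigO_size₁_mul_ε)

lemma isBigO_meanCurv_bent_sub (hd : 1 ≤ d) (hθ : θ < 1) :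
    (fun D => meanCurv D.bent 0 - meanCurv D.F 0) =O[𝓛] size₂ := by
  simp only [meanCurv, ← Finset.sum_sub_distrib]
  exact IsBigO.fun_sum fun i _ => isBigO_weingarten_bent_sub hd hθ i i

lemma isBigO_meanCurv_bent_sub_meanCurvExpansion (hd : 1 ≤ d) (hθ : θ < 1) :
    (fun D => meanCurv D.bent 0
      - meanCurvExpansion D.F 0 D.τ (D.u 0) (deriv D.u 0) (deriv (deriv D.u) 0)) =O[𝓛] err := by
  simp only [← sum_weingartenExpansion, meanCurv, ← Finset.sum_sub_distrib]
  exact IsBigO.fun_sum fun i _ => isBigO_weingarten_bent_sub_weingartenExpansion hd hθ i i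

lemma isBigO_inner_weingarten_pd_nuPlus (hd : 1 ≤ d) (i j k : Fin (d + 1)) :
    (fun D => (inner ℝ (weingarten D.F 0 i j) (pd k (nuPlus D.F) 0) : ℝ)) =O[𝓛] ε := by
  have h (D : BendData d V θ K) : (inner ℝ (weingarten D.F 0 i j) (pd k (nuPlus D.F) 0) : ℝ)
      = inner ℝ (weingarten D.F 0 i j)
        (pd k (nuPlus D.F) 0 - ∑ l, hPlusMixed D.F 0 k l • pd l D.F 0) := by
    simp [inner_sub_right, inner_sum, real_inner_smul_right,
      isNormalAt_weingarten D.smooth_two D.det_ne_zero i j _]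
  simp only [h]
  exact isBigO_one_inner (isBigO_weingarten _ _) (isBigO_pd_nuPlus_sub hd k)

lemma normSqA_bent_sub_normSqAExpansion {D : BendData d V θ K} (hH : meanCurv D.F 0 ≠ 0) :
    normSqA D.bent 0 - normSqAExpansion D.F 0 D.τ (D.u 0) (deriv (deriv D.u) 0)
      = 2 * ∑ i, ∑ j, (inner ℝ (weingarten D.F 0 i j) (weingarten D.bent 0 j i
          - weingartenExpansion D.F 0 D.τ (D.u 0) (deriv D.u 0) (deriv (deriv D.u) 0) j i) : ℝ)
        + ∑ i, ∑ j, (inner ℝ (weingarten D.bent 0 i j - weingarten D.F 0 i j)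
          (weingarten D.bent 0 j i - weingarten D.F 0 j i) : ℝ)
        + 2 * (D.v₁ * ∑ i, ∑ j, metricInv D.F 0 0 i *
          inner ℝ (weingarten D.F 0 i j) (pd j (nuPlus D.F) 0)) := by
  have hexp := two_mul_sum_inner_weingartenExpansion (τ := D.τ) (u₀ := D.u 0) (u₁ := deriv D.u 0)
    (u₂ := deriv (deriv D.u) 0) D.smooth_two D.det_ne_zero
  have hcomm : ∑ i, ∑ j, (inner ℝ (weingarten D.bent 0 i j) (weingarten D.F 0 j i) : ℝ)
      = ∑ i, ∑ j, (inner ℝ (weingarten D.F 0 i j) (weingarten D.bent 0 j i) : ℝ) := by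
    rw [Finset.sum_comm]
    exact Finset.sum_congr rfl fun i _ => Finset.sum_congr rfl fun j _ => real_inner_comm _ _
  rw [normSqA_eq_sum_inner_weingarten D.smooth_two] at hexp
  rw [normSqA_eq_sum_inner_weingarten (contDiffAt_bent hH), v₁]
  simp only [inner_sub_left, inner_sub_right, Finset.sum_sub_distrib, hcomm]
  linear_combination hexp

lemma isBigO_normSqA_bent_sub_normSqAExpansion (hd : 1 ≤ d) (hθ : θ < 1) :
    (fun D => normSqA D.bent 0 - normSqAExpansion D.F 0 D.τ (D.u 0) (deriv (deriv D.u) 0))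
      =O[𝓛] err :=
  EventuallyEq.trans_isBigO
    ((eventually_meanCurv_ne_zero hd).mono fun _ hD => normSqA_bent_sub_normSqAExpansion hD)
    (((isBigO_one_mul (isBigO_const_one ℝ _ _) (IsBigO.fun_sum fun _ _ => IsBigO.fun_sum fun _ _ =>
    isBigO_one_inner (isBigO_weingarten _ _)
      (isBigO_weingarten_bent_sub_weingartenExpansion hd hθ _ _))).add
  (IsBigO.fun_sum fun _ _ => IsBigO.fun_sum fun _ _ =>
    (isBigO_inner (isBigO_weingarten_bent_sub hd hθ _ _)
      (isBigO_weingarten_bent_sub hd hθ _ _)).trans isBigO_size₂_mul_size₂)).add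
  (isBigO_one_mul (isBigO_const_one ℝ _ _) ((isBigO_v₁.mul (IsBigO.fun_sum fun _ _ =>
    IsBigO.fun_sum fun _ _ => isBigO_one_mul (isBigO_metricInv _ _)
      (isBigO_inner_weingarten_pd_nuPlus hd _ _ _))).trans isBigO_size₁_mul_ε)))

lemma isBigO_normSq_meanCurv_bent_sub_normSqMeanCurvExpansion (hd : 1 ≤ d) (hθ : θ < 1) :
    (fun D => ‖meanCurv D.bent 0‖ ^ 2
      - normSqMeanCurvExpansion D.F 0 D.τ (D.u 0) (deriv (deriv D.u) 0)) =O[𝓛] err := by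
  have h : (fun D => ‖meanCurv D.bent 0‖ ^ 2
      - normSqMeanCurvExpansion D.F 0 D.τ (D.u 0) (deriv (deriv D.u) 0)) =ᶠ[𝓛] fun D =>
      2 * (inner ℝ (meanCurv D.F 0) (meanCurv D.bent 0
        - meanCurvExpansion D.F 0 D.τ (D.u 0) (deriv D.u 0) (deriv (deriv D.u) 0)) : ℝ)
      + (inner ℝ (meanCurv D.bent 0 - meanCurv D.F 0)
        (meanCurv D.bent 0 - meanCurv D.F 0) : ℝ) := by
    filter_upwards [eventually_meanCurv_ne_zero hd] with D hD
    have hexp := two_mul_inner_meanCurvExpansion (τ := D.τ) (u₀ := D.u 0) (u₁ := deriv D.u 0)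
      (u₂ := deriv (deriv D.u) 0) D.smooth_two D.det_ne_zero D.differentiableAt_meanCurv hD
    rw [real_inner_self_eq_norm_sq, norm_sub_sq_real, inner_sub_right,
      real_inner_comm (meanCurv D.F 0)]
    linear_combination hexp
  exact h.trans_isBigO ((isBigO_one_mul (isBigO_const_one ℝ _ _) (isBigO_one_inner isBigO_meanCurv
    (isBigO_meanCurv_bent_sub_meanCurvExpansion hd hθ))).add
    ((isBigO_inner (isBigO_meanCurv_bent_sub hd hθ) (isBigO_meanCurv_bent_sub hd hθ)).trans
      isBigO_size₂_mul_size₂))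

end BendData

section ConstSMul

variable {n : ℕ} {V : Type} [NormedAddCommGroup V] [InnerProductSpace ℝ V] {F : E n → V} {c : ℝ}

lemma pd_fun_const_smul (i : Fin n) : pd i (c • F) = c • pd i F :=
  funext fun _ => pd_const_smul c F

lemma metric_const_smul (x : E n) : metric (c • F) x = c ^ 2 • metric F x := by
  ext i j
  simp only [metric_apply, pd_fun_const_smul, Pi.smul_apply, real_inner_smul_left,
    real_inner_smul_right, Matrix.smul_apply, smul_eq_mul]
  ring

lemma metricInv_const_smul (hc : c ≠ 0) (x : E n) :
    metricInv (c • F) x = (c ^ 2)⁻¹ • metricInv F x := by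
  have hc2 : c ^ 2 ≠ 0 := pow_ne_zero 2 hc
  rw [metricInv, metric_const_smul, metricInv]
  by_cases hdet : IsUnit (metric F x).det
  · exact Matrix.inv_smul' _ (Units.mk0 _ hc2) hdet
  · have hdet' : ¬ IsUnit (c ^ 2 • metric F x).det := by
      simpa [Matrix.det_smul, isUnit_iff_ne_zero, hc] using hdet
    rw [Matrix.nonsing_inv_apply_not_isUnit _ hdet, Matrix.nonsing_inv_apply_not_isUnit _ hdet',
      smul_zero]

lemma metricInv_const_smul_apply (hc : c ≠ 0) (x : E n) (i j : Fin n) :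
    metricInv (c • F) x i j = (c ^ 2)⁻¹ * metricInv F x i j := by
  rw [metricInv_const_smul hc, Matrix.smul_apply, smul_eq_mul]

lemma christoffel_const_smul (hc : c ≠ 0) (x : E n) (i j k : Fin n) :
    christoffel (metric (c • F)) x i j k = christoffel (metric F) x i j k := by
  have hpd (a i j : Fin n) : pd a (fun y => metric (c • F) y i j) x
      = c ^ 2 * pd a (fun y => metric F y i j) x := by
    simp only [metric_const_smul, Matrix.smul_apply]
    exact pd_const_smul _ _
  have hinv (l : Fin n) : (metric (c • F) x)⁻¹ k l = (c ^ 2)⁻¹ * (metric F x)⁻¹ k l :=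
    metricInv_const_smul_apply hc x k l
  simp only [christoffel, hpd, hinv]
  congr 1
  refine Finset.sum_congr rfl fun l _ => ?_
  field_simp

lemma sff_const_smul (hc : c ≠ 0) (x : E n) (i j : Fin n) :
    sff (c • F) x i j = c • sff F x i j := by
  simp only [sff, christoffel_const_smul hc, pd_fun_const_smul, Pi.smul_apply, smul_neg, smul_sub,
    Finset.smul_sum, smul_comm c]

lemma weingarten_const_smul (hc : c ≠ 0) (x : E n) (i j : Fin n) :
    weingarten (c • F) x i j = c⁻¹ • weingarten F x i j := by
  simp only [weingarten, metricInv_const_smul_apply hc, sff_const_smul hc, Finset.smul_sum,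
    smul_smul]
  refine Finset.sum_congr rfl fun l _ => ?_
  congr 1
  field_simp

lemma meanCurv_const_smul (hc : c ≠ 0) (x : E n) : meanCurv (c • F) x = c⁻¹ • meanCurv F x := by
  simp only [meanCurv, weingarten_const_smul hc, Finset.smul_sum]

lemma nuPlus_const_smul (hc : 0 < c) : nuPlus (c • F) = nuPlus F := by
  ext1 x
  rw [nuPlus, nuPlus, meanCurv_const_smul hc.ne', norm_smul, smul_smul, norm_inv,
    Real.norm_of_nonneg hc.le, mul_inv, inv_inv, mul_right_comm, mul_inv_cancel₀ hc.ne', one_mul]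

lemma hPlus_const_smul (hc : 0 < c) (x : E n) (i j : Fin n) :
    hPlus (c • F) x i j = c * hPlus F x i j := by
  rw [hPlus, nuPlus_const_smul hc, sff_const_smul hc.ne', real_inner_smul_left, hPlus]

lemma hPlusMixed_const_smul (hc : 0 < c) (x : E n) (i j : Fin n) :
    hPlusMixed (c • F) x i j = c⁻¹ * hPlusMixed F x i j := by
  simp only [hPlusMixed, metricInv_const_smul_apply hc.ne', hPlus_const_smul hc, Finset.mul_sum]
  refine Finset.sum_congr rfl fun l _ => ?_
  field_simp

lemma hPlusUp_const_smul (hc : 0 < c) (x : E n) (i j : Fin n) :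
    hPlusUp (c • F) x i j = (c ^ 3)⁻¹ * hPlusUp F x i j := by
  simp only [hPlusUp, metricInv_const_smul_apply hc.ne', hPlus_const_smul hc, Finset.mul_sum]
  refine Finset.sum_congr rfl fun p _ => Finset.sum_congr rfl fun q _ => ?_
  field_simp

lemma sffUp_const_smul (hc : c ≠ 0) (x : E n) (i j : Fin n) :
    sffUp (c • F) x i j = (c ^ 3)⁻¹ • sffUp F x i j := by
  simp only [sffUp, metricInv_const_smul_apply hc, sff_const_smul hc, Finset.smul_sum, smul_smul]
  refine Finset.sum_congr rfl fun p _ => Finset.sum_congr rfl fun q _ => ?_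
  congr 1
  field_simp

lemma normSqA_const_smul (hc : c ≠ 0) (x : E n) :
    normSqA (c • F) x = (c ^ 2)⁻¹ * normSqA F x := by
  simp only [normSqA, metricInv_const_smul_apply hc, sff_const_smul hc, Finset.mul_sum,
    real_inner_smul_left, real_inner_smul_right]
  refine Finset.sum_congr rfl fun i _ => Finset.sum_congr rfl fun j _ =>
    Finset.sum_congr rfl fun k _ => Finset.sum_congr rfl fun l _ => ?_
  field_simp

lemma normalProj_const_smul (hc : c ≠ 0) (x : E n) (v : V) :
    normalProj (c • F) x v = normalProj F x v := by
  simp only [normalProj, metricInv_const_smul_apply hc, pd_fun_const_smul, Pi.smul_apply,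
    real_inner_smul_right, smul_smul]
  congr 1
  refine Finset.sum_congr rfl fun i _ => Finset.sum_congr rfl fun j _ => ?_
  congr 1
  field_simp

lemma nablaSff_const_smul (hc : c ≠ 0) (l : ℕ) (x : E n) (I : Fin (2 + l) → Fin n) :
    nablaSff (c • F) l x I = c • nablaSff F l x I := by
  induction l generalizing x with
  | zero => exact sff_const_smul hc x _ _
  | succ l ih =>
    have hsucc (G : E n → V) : nablaSff G (l + 1) x I
        = normalProj G x (pd (I 0) (fun y => nablaSff G l y (Fin.tail I)) x)
          - ∑ a, ∑ k, christoffel (metric G) x (I 0) (Fin.tail I a) k •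
            nablaSff G l x (Function.update (Fin.tail I) a k) := rfl
    simp only [hsucc, ih, pd_const_smul, normalProj_const_smul hc, christoffel_const_smul hc,
      (isLinearMap_normalProj F x).map_smul, smul_sub, Finset.smul_sum, smul_comm c]

end ConstSMul

section BendingExpansion

variable {d : ℕ} {V : Type} [NormedAddCommGroup V] [InnerProductSpace ℝ V] {F F' : E (d + 1) → V}
  {x : E (d + 1)} {τ u₀ u₁ u₂ δ₀ δ₁ δ₂ c : ℝ} {u : ℝ → ℝ}

lemma bend_const_smul (hc : 0 < c) : bend (c • F) (c * τ) u = c • bend F τ u := by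
  ext1 x
  simp only [bend, nuPlus_const_smul hc, Pi.smul_apply, smul_sub, smul_smul, mul_assoc]

lemma sffExpansion_const_smul (hc : 0 < c) (i j : Fin (d + 1)) :
    sffExpansion (c • F) x (c * τ) u₀ u₁ u₂ i j = c • sffExpansion F x τ u₀ u₁ u₂ i j := by
  have hmixed (j k : Fin (d + 1)) : pd i (fun y => c⁻¹ * hPlusMixed F y j k) x
      = c⁻¹ * pd i (fun y => hPlusMixed F y j k) x := pd_const_smul _ _
  have hcancel (p : ℝ) : c⁻¹ * p * c = p := by field_simp
  have hvar (k : Fin (d + 1)) : (dz i * (c⁻¹ * hPlusMixed F x j k)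
        + dz j * (c⁻¹ * hPlusMixed F x i k)
        - (c ^ 2)⁻¹ * metricInv F x 0 k * (c * hPlus F x i j)) * c
      = dz i * hPlusMixed F x j k + dz j * hPlusMixed F x i k
        - metricInv F x 0 k * hPlus F x i j := by field_simp
  simp only [sffExpansion, nuPlus_const_smul hc, sff_const_smul hc.ne', hmixed,
    hPlusMixed_const_smul hc, metricInv_const_smul_apply hc.ne', hPlus_const_smul hc,
    pd_fun_const_smul, Pi.smul_apply, smul_smul, hcancel, hvar]
  module

lemma weingartenExpansion_const_smul (hc : 0 < c) (i j : Fin (d + 1)) :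
    weingartenExpansion (c • F) x (c * τ) u₀ u₁ u₂ i j
      = c⁻¹ • weingartenExpansion F x τ u₀ u₁ u₂ i j := by
  have hup (j k : Fin (d + 1)) : pd i (fun y => (c ^ 3)⁻¹ * hPlusUp F y j k) x
      = (c ^ 3)⁻¹ * pd i (fun y => hPlusUp F y j k) x := pd_const_smul _ _
  have hcancel (p : ℝ) : (c ^ 3)⁻¹ * p * c = (c ^ 2)⁻¹ * p := by field_simp
  have hvar (k : Fin (d + 1)) : (dz i * ((c ^ 3)⁻¹ * hPlusUp F x j k)
        + (c ^ 2)⁻¹ * metricInv F x 0 j * (c⁻¹ * hPlusMixed F x i k)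
        - (c ^ 2)⁻¹ * metricInv F x 0 k * (c⁻¹ * hPlusMixed F x i j)) * c
      = (c ^ 2)⁻¹ * (dz i * hPlusUp F x j k + metricInv F x 0 j * hPlusMixed F x i k
        - metricInv F x 0 k * hPlusMixed F x i j) := by field_simp
  simp only [weingartenExpansion, nuPlus_const_smul hc, weingarten_const_smul hc.ne', hup,
    hPlusUp_const_smul hc, hPlusMixed_const_smul hc, metricInv_const_smul_apply hc.ne',
    pd_fun_const_smul, Pi.smul_apply, smul_smul, hcancel, hvar]
  simp only [mul_smul (c ^ 2)⁻¹, ← Finset.smul_sum]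
  match_scalars <;> field_simp

lemma meanCurvExpansion_const_smul (hc : 0 < c) :
    meanCurvExpansion (c • F) x (c * τ) u₀ u₁ u₂ = c⁻¹ • meanCurvExpansion F x τ u₀ u₁ u₂ := by
  simp only [← sum_weingartenExpansion, weingartenExpansion_const_smul hc, Finset.smul_sum]

lemma normSqAExpansion_const_smul (hc : 0 < c) :
    normSqAExpansion (c • F) x (c * τ) u₀ u₂ = (c ^ 2)⁻¹ * normSqAExpansion F x τ u₀ u₂ := by
  have hterm (i j k : Fin (d + 1)) : c⁻¹ * hPlusMixed F x j k *
      inner ℝ (c • sff F x i k) ((c ^ 3)⁻¹ • sffUp F x i j)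
      = (c ^ 3)⁻¹ * (hPlusMixed F x j k * inner ℝ (sff F x i k) (sffUp F x i j)) := by
    rw [real_inner_smul_left, real_inner_smul_right]
    field_simp
  simp only [normSqAExpansion, normSqA_const_smul hc.ne', hPlusUp_const_smul hc,
    hPlusMixed_const_smul hc, sff_const_smul hc.ne', sffUp_const_smul hc.ne', hterm,
    ← Finset.mul_sum]
  field_simp

lemma normSqMeanCurvExpansion_const_smul (hc : 0 < c) :
    normSqMeanCurvExpansion (c • F) x (c * τ) u₀ u₂
      = (c ^ 2)⁻¹ * normSqMeanCurvExpansion F x τ u₀ u₂ := by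
  have hterm (i j k : Fin (d + 1)) : c⁻¹ * hPlusMixed F x j k * (c * hPlus F x i k)
      * ((c ^ 2)⁻¹ * metricInv F x i j)
      = (c ^ 2)⁻¹ * (hPlusMixed F x j k * hPlus F x i k * metricInv F x i j) := by
    field_simp
  simp only [normSqMeanCurvExpansion, meanCurv_const_smul hc.ne', norm_smul, norm_inv,
    Real.norm_of_nonneg hc.le, metricInv_const_smul_apply hc.ne', hPlusMixed_const_smul hc,
    hPlus_const_smul hc, hterm, ← Finset.mul_sum]
  field_simp

/-- The map `F'` is immersed at `0` and its curvature there is given by the first order expansions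
for the bending of `F`, up to errors `δ₀` for `h_{ij}`, `δ₁` for `h_i^j` and `H`, and `δ₂` for
`|A|²` and `|H|²`; these three groups scale differently under homotheties. -/
structure BendingExpansion (F F' : E (d + 1) → V) (τ u₀ u₁ u₂ δ₀ δ₁ δ₂ : ℝ) : Prop where
  linearIndependent : LinearIndependent ℝ (fun i => pd i F' 0)
  norm_sff_sub_le : ∀ i j, ‖sff F' 0 i j - sffExpansion F 0 τ u₀ u₁ u₂ i j‖ ≤ δ₀
  norm_weingarten_sub_le : ∀ i j,
    ‖weingarten F' 0 i j - weingartenExpansion F 0 τ u₀ u₁ u₂ i j‖ ≤ δ₁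
  norm_meanCurv_sub_le : ‖meanCurv F' 0 - meanCurvExpansion F 0 τ u₀ u₁ u₂‖ ≤ δ₁
  abs_normSqA_sub_le : |normSqA F' 0 - normSqAExpansion F 0 τ u₀ u₂| ≤ δ₂
  abs_normSqMeanCurv_sub_le : |‖meanCurv F' 0‖ ^ 2 - normSqMeanCurvExpansion F 0 τ u₀ u₂| ≤ δ₂

lemma BendingExpansion.const_smul (h : BendingExpansion F F' τ u₀ u₁ u₂ δ₀ δ₁ δ₂) (hc : 0 < c) :
    BendingExpansion (c • F) (c • F') (c * τ) u₀ u₁ u₂ (c * δ₀) (δ₁ / c) (δ₂ / c ^ 2) := by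
  have hnorm (v : V) : ‖c⁻¹ • v‖ = ‖v‖ / c := by
    rw [norm_smul, norm_inv, Real.norm_of_nonneg hc.le, inv_mul_eq_div]
  have habs (s : ℝ) : |(c ^ 2)⁻¹ * s| = |s| / c ^ 2 := by
    rw [abs_mul, abs_inv, abs_of_pos (pow_pos hc 2), inv_mul_eq_div]
  refine ⟨?_, fun i j => ?_, fun i j => ?_, ?_, ?_, ?_⟩
  · simp only [pd_fun_const_smul]
    exact h.linearIndependent.units_smul fun _ => Units.mk0 c hc.ne'
  · rw [sff_const_smul hc.ne', sffExpansion_const_smul hc, ← smul_sub, norm_smul,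
      Real.norm_of_nonneg hc.le]
    exact mul_le_mul_of_nonneg_left (h.norm_sff_sub_le i j) hc.le
  · rw [weingarten_const_smul hc.ne', weingartenExpansion_const_smul hc, ← smul_sub, hnorm]
    exact div_le_div_of_nonneg_right (h.norm_weingarten_sub_le i j) hc.le
  · rw [meanCurv_const_smul hc.ne', meanCurvExpansion_const_smul hc, ← smul_sub, hnorm]
    exact div_le_div_of_nonneg_right h.norm_meanCurv_sub_le hc.le
  · rw [normSqA_const_smul hc.ne', normSqAExpansion_const_smul hc, ← mul_sub, habs]
    exact div_le_div_of_nonneg_right h.abs_normSqA_sub_le (sq_nonneg c)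
  · rw [meanCurv_const_smul hc.ne', hnorm, div_pow, normSqMeanCurvExpansion_const_smul hc,
      ← inv_mul_eq_div, ← mul_sub, habs]
    exact div_le_div_of_nonneg_right h.abs_normSqMeanCurv_sub_le (sq_nonneg c)

lemma BendingExpansion.mono {ε₀ ε₁ ε₂ : ℝ} (h : BendingExpansion F F' τ u₀ u₁ u₂ δ₀ δ₁ δ₂)
    (h₀ : δ₀ ≤ ε₀) (h₁ : δ₁ ≤ ε₁) (h₂ : δ₂ ≤ ε₂) :
    BendingExpansion F F' τ u₀ u₁ u₂ ε₀ ε₁ ε₂ :=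
  ⟨h.linearIndependent, fun i j => (h.norm_sff_sub_le i j).trans h₀,
    fun i j => (h.norm_weingarten_sub_le i j).trans h₁, h.norm_meanCurv_sub_le.trans h₁,
    h.abs_normSqA_sub_le.trans h₂, h.abs_normSqMeanCurv_sub_le.trans h₂⟩

end BendingExpansion

lemma BendData.exists_bendingExpansion {d : ℕ} (V : Type) [NormedAddCommGroup V]
    [InnerProductSpace ℝ V] {θ : ℝ} (K : ℝ) (hd : 1 ≤ d) (hθ : θ < 1) :
    ∃ δ > 0, ∃ C > 0, ∀ D : BendData d V θ K, |D.ε| < δ →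
      BendingExpansion D.F D.bent D.τ (D.u 0) (deriv D.u 0) (deriv (deriv D.u) 0)
        (C * D.err) (C * D.err) (C * D.err) := by
  have hsff := isBigO_pi.2 fun i => isBigO_pi.2 fun j =>
    isBigO_sff_bent_sub_sffExpansion (V := V) (K := K) hd hθ i j
  have hweingarten := isBigO_pi.2 fun i => isBigO_pi.2 fun j =>
    isBigO_weingarten_bent_sub_weingartenExpansion (V := V) (K := K) hd hθ i j
  have hH := isBigO_meanCurv_bent_sub_meanCurvExpansion (V := V) (K := K) hd hθ
  have hA := isBigO_normSqA_bent_sub_normSqAExpansion (V := V) (K := K) hd hθ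
  have hHsq := isBigO_normSq_meanCurv_bent_sub_normSqMeanCurvExpansion (V := V) (K := K) hd hθ
  obtain ⟨C, hC, hbound⟩ :=
    ((hsff.prod_left hweingarten).prod_left (hH.prod_left (hA.prod_left hHsq))).exists_pos
  have hexp : ∀ᶠ D in nearCylinder d V θ K,
      BendingExpansion D.F D.bent D.τ (D.u 0) (deriv D.u 0) (deriv (deriv D.u) 0)
        (C * D.err) (C * D.err) (C * D.err) := by
    filter_upwards [eventually_det_bent hd hθ, hbound.bound] with D hdet hD
    have herr := mul_nonneg hC.le D.err_nonneg
    simp only [Real.norm_of_nonneg D.err_nonneg, Prod.norm_def, max_le_iff,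
      pi_norm_le_iff_of_nonneg herr] at hD
    obtain ⟨⟨hsff, hweingarten⟩, hH, hA, hHsq⟩ := hD
    exact ⟨det_metric_ne_zero_iff.1 hdet, hsff, hweingarten, hH, hA, hHsq⟩
  obtain ⟨δ, hδ, hball⟩ := Metric.eventually_nhds_iff.1 (eventually_comap.1 hexp)
  exact ⟨δ, hδ, C, hC, fun D hD => hball (by simpa using hD) D rfl⟩

section TensorNorm

variable {n l : ℕ} {V : Type} [NormedAddCommGroup V] [InnerProductSpace ℝ V]

/-- The matrix `B` acting on every index of a tensor: the components of the tensor in the frame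
whose change of basis matrix is `B`. -/
def changeFrame (B : Matrix (Fin n) (Fin n) ℝ) (T : (Fin l → Fin n) → V) (I : Fin l → Fin n) : V :=
  ∑ J : Fin l → Fin n, (∏ a, B (I a) (J a)) • T J

lemma prod_mul_apply (A B : Matrix (Fin n) (Fin n) ℝ) (I J : Fin l → Fin n) :
    ∏ a, (A * B) (I a) (J a)
      = ∑ K : Fin l → Fin n, (∏ a, A (I a) (K a)) * ∏ a, B (K a) (J a) := by
  simp only [Matrix.mul_apply, Finset.prod_univ_sum, Fintype.piFinset_univ, Finset.prod_mul_distrib]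

lemma changeFrame_mul (A B : Matrix (Fin n) (Fin n) ℝ) (T : (Fin l → Fin n) → V) :
    changeFrame (A * B) T = changeFrame A (changeFrame B T) := by
  ext1 I
  simp only [changeFrame, prod_mul_apply, Finset.sum_smul, Finset.smul_sum, mul_smul]
  exact Finset.sum_comm

lemma changeFrame_one (T : (Fin l → Fin n) → V) : changeFrame 1 T = T := by
  ext1 I
  simp only [changeFrame, Matrix.one_apply, Fintype.prod_boole, ← funext_iff, ite_smul, one_smul,
    zero_smul, Finset.sum_ite_eq, Finset.mem_univ, if_true]

lemma sum_inner_changeFrame_transpose (B : Matrix (Fin n) (Fin n) ℝ) (S T : (Fin l → Fin n) → V) :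
    ∑ I, (inner ℝ (S I) (changeFrame B.transpose T I) : ℝ)
      = ∑ I, inner ℝ (changeFrame B S I) (T I) := by
  simp only [changeFrame, inner_sum, sum_inner, real_inner_smul_left, real_inner_smul_right,
    Matrix.transpose_apply]
  exact Finset.sum_comm

lemma tensorNorm_transpose_mul_self (B : Matrix (Fin n) (Fin n) ℝ) (T : (Fin l → Fin n) → V) :
    tensorNorm (B.transpose * B) T = √(∑ K, ‖changeFrame B T K‖ ^ 2) := by
  have h : tensorNorm (B.transpose * B) T
      = √(∑ I, inner ℝ (T I) (changeFrame (B.transpose * B) T I)) := by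
    simp only [tensorNorm, changeFrame, inner_sum, real_inner_smul_right]
  rw [h, changeFrame_mul, sum_inner_changeFrame_transpose]
  simp only [real_inner_self_eq_norm_sq]

lemma norm_changeFrame_le (C : Matrix (Fin n) (Fin n) ℝ) (S : (Fin l → Fin n) → V)
    (I : Fin l → Fin n) :
    ‖changeFrame C S I‖
      ≤ √(∏ a, (C * C.transpose) (I a) (I a)) * √(∑ K, ‖S K‖ ^ 2) := by
  calc ‖changeFrame C S I‖ ≤ ∑ K, ‖(∏ a, C (I a) (K a)) • S K‖ := norm_sum_le _ _
    _ = ∑ K, |∏ a, C (I a) (K a)| * ‖S K‖ := by simp only [norm_smul, Real.norm_eq_abs]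
    _ ≤ √(∑ K : Fin l → Fin n, |∏ a, C (I a) (K a)| ^ 2) * √(∑ K, ‖S K‖ ^ 2) :=
        Real.sum_mul_le_sqrt_mul_sqrt _ _ _
    _ = √(∏ a, (C * C.transpose) (I a) (I a)) * √(∑ K, ‖S K‖ ^ 2) := by
        simp only [prod_mul_apply, Matrix.transpose_apply, sq_abs, ← pow_two]

open scoped MatrixOrder Matrix.Norms.L2Operator in
lemma exists_eq_mul_transpose_of_posSemidef {G : Matrix (Fin n) (Fin n) ℝ} (hG : G.PosSemidef) :
    ∃ C : Matrix (Fin n) (Fin n) ℝ, G = C * C.transpose := by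
  obtain ⟨C, hC⟩ := CStarAlgebra.nonneg_iff_eq_mul_star_self.1 hG.nonneg
  exact ⟨C, by rw [hC, Matrix.star_eq_conjTranspose, Matrix.conjTranspose_eq_transpose_of_trivial]⟩

lemma norm_apply_le_tensorNorm {G : Matrix (Fin n) (Fin n) ℝ} (hG : G.PosDef)
    (T : (Fin l → Fin n) → V) (I : Fin l → Fin n) :
    ‖T I‖ ≤ √(∏ a, G (I a) (I a)) * tensorNorm G⁻¹ T := by
  obtain ⟨C, rfl⟩ := exists_eq_mul_transpose_of_posSemidef hG.posSemidef
  have hC : IsUnit C.det := (left_ne_zero_of_mul (Matrix.det_mul C _ ▸ hG.det_pos.ne')).isUnit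
  have h := norm_changeFrame_le C (changeFrame C⁻¹ T) I
  rwa [← tensorNorm_transpose_mul_self, ← changeFrame_mul, Matrix.mul_nonsing_inv C hC,
    changeFrame_one, Matrix.transpose_nonsing_inv, ← Matrix.mul_inv_rev] at h

end TensorNorm

section CylinderCoordinates

variable {d : ℕ} {σ : E d → E (d + 1)} {z : ℝ}

/-- The linear map `(x¹, …, xⁿ) ↦ (x², …, xⁿ)` extracting the coordinates of the sphere factor. -/
def sphereCoord (d : ℕ) : E (d + 1) →L[ℝ] E d :=
  LinearMap.toContinuousLinearMap
    { toFun := fun x => WithLp.toLp 2 (fun a : Fin d => x a.succ)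
      map_add' := fun _ _ => rfl
      map_smul' := fun _ _ => rfl }

lemma sphereCoord_single_zero : sphereCoord d (EuclideanSpace.single 0 1) = 0 := by
  ext a
  change (EuclideanSpace.single (0 : Fin (d + 1)) (1 : ℝ) : E (d + 1)) a.succ = 0
  simp

lemma sphereCoord_single_succ (a : Fin d) :
    sphereCoord d (EuclideanSpace.single a.succ 1) = EuclideanSpace.single a 1 := by
  ext b
  change (EuclideanSpace.single a.succ (1 : ℝ) : E (d + 1)) b.succ
    = (EuclideanSpace.single a (1 : ℝ) : E d) b
  simp

section

variable {W : Type} [NormedAddCommGroup W] [NormedSpace ℝ W] {f : E d → W} {x : E (d + 1)}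

lemma pd_comp_sphereCoord (hf : DifferentiableAt ℝ f (sphereCoord d x)) (i : Fin (d + 1)) :
    pd i (fun y => f (sphereCoord d y)) x
      = fderiv ℝ f (sphereCoord d x) (sphereCoord d (EuclideanSpace.single i 1)) :=
  congrArg (· (EuclideanSpace.single i 1))
    (hf.hasFDerivAt.comp x (sphereCoord d).hasFDerivAt).fderiv

lemma pd_zero_comp_sphereCoord (hf : DifferentiableAt ℝ f (sphereCoord d x)) :
    pd 0 (fun y => f (sphereCoord d y)) x = 0 := by
  rw [pd_comp_sphereCoord hf, sphereCoord_single_zero, map_zero]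

lemma pd_succ_comp_sphereCoord (hf : DifferentiableAt ℝ f (sphereCoord d x)) (a : Fin d) :
    pd a.succ (fun y => f (sphereCoord d y)) x = pd a f (sphereCoord d x) := by
  rw [pd_comp_sphereCoord hf, sphereCoord_single_succ, pd]

end

lemma pd_const_add_apply_zero (z : ℝ) (x : E (d + 1)) (i : Fin (d + 1)) :
    pd i (fun y : E (d + 1) => z + y 0) x = dz i := by
  rw [pd_comp_apply_zero (f := fun s => z + s) (by fun_prop)]
  simp

lemma cylMetric_apply (x : E (d + 1)) (i j : Fin (d + 1)) :
    cylMetric σ z x i j = metric (fun y => σ (sphereCoord d y)) x i j + dz i * dz j := by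
  rw [← pd_const_add_apply_zero z x i, ← pd_const_add_apply_zero z x j]
  rfl

section

variable {x : E (d + 1)} (hσ : DifferentiableAt ℝ σ (sphereCoord d x))
include hσ

lemma cylMetric_zero_left (j : Fin (d + 1)) : cylMetric σ z x 0 j = dz j := by
  rw [cylMetric_apply, metric_apply, pd_zero_comp_sphereCoord hσ, inner_zero_left]
  simp [dz]

lemma cylMetric_zero_right (i : Fin (d + 1)) : cylMetric σ z x i 0 = dz i := by
  rw [cylMetric_apply, metric_apply, pd_zero_comp_sphereCoord hσ, inner_zero_right]
  simp [dz]

lemma cylMetric_succ_succ (a b : Fin d) :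
    cylMetric σ z x a.succ b.succ = metric σ (sphereCoord d x) a b := by
  rw [cylMetric_apply, metric_apply, pd_succ_comp_sphereCoord hσ, pd_succ_comp_sphereCoord hσ,
    metric_apply]
  simp [dz]

end

lemma IsNormalSphereChart.eventually_differentiableAt (hσ : IsNormalSphereChart σ) :
    ∀ᶠ x in 𝓝 (0 : E (d + 1)), DifferentiableAt ℝ σ (sphereCoord d x) :=
  ((sphereCoord d).continuous.tendsto' 0 0 (map_zero _)).eventually
    (BendNeck.eventually_differentiableAt (hσ.smooth.of_le (by norm_cast)))

lemma cylMetric_zero (hσ : IsNormalSphereChart σ) : cylMetric σ z 0 = 1 := by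
  have hd := hσ.eventually_differentiableAt.self_of_nhds
  ext i j
  cases i using Fin.cases with
  | zero => simp [cylMetric_zero_left hd, dz, Matrix.one_apply, eq_comm]
  | succ a =>
    cases j using Fin.cases with
    | zero => rw [cylMetric_zero_right hd, dz, Matrix.one_apply]
    | succ b =>
      rw [cylMetric_succ_succ hd, map_zero, hσ.metric_eq]
      simp [Matrix.one_apply]

lemma pd_cylMetric_zero (hσ : IsNormalSphereChart σ) (k i j : Fin (d + 1)) :
    pd k (fun y => cylMetric σ z y i j) 0 = 0 := by
  have hd := hσ.eventually_differentiableAt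
  cases i using Fin.cases with
  | zero => rw [pd_congr (hd.mono fun x hx => cylMetric_zero_left hx j), pd_const]
  | succ a =>
    cases j using Fin.cases with
    | zero => rw [pd_congr (hd.mono fun x hx => cylMetric_zero_right hx a.succ), pd_const]
    | succ b =>
      have hm : DifferentiableAt ℝ (fun y => metric σ y a b) (sphereCoord d 0) := by
        rw [map_zero]
        exact (contDiffAt_metric hσ.smooth (p := ∞) (by simp) a b).differentiableAt (by simp)
      rw [pd_congr (hd.mono fun x hx => cylMetric_succ_succ hx a b)]
      cases k using Fin.cases with
      | zero => exact pd_zero_comp_sphereCoord hm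
      | succ c => rw [pd_succ_comp_sphereCoord hm, map_zero, hσ.deriv_metric_eq]

lemma christoffel_cylMetric_zero (hσ : IsNormalSphereChart σ) (i j k : Fin (d + 1)) :
    christoffel (cylMetric σ z) 0 i j k = 0 := by
  simp [christoffel, pd_cylMetric_zero hσ]

lemma contDiffAt_patch {m : ℕ} {N : E (d + 1) × ℝ → E (d + 1 + m)} (hσ : IsNormalSphereChart σ)
    (hN : ContDiffAt ℝ ∞ N (σ 0, z)) : ContDiffAt ℝ ∞ (patch N σ z) 0 := by
  have hsphere : ContDiffAt ℝ ∞ (fun x : E (d + 1) => σ (sphereCoord d x)) 0 :=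
    ContDiffAt.comp (0 : E (d + 1)) (g := σ) (by rw [map_zero]; exact hσ.smooth)
      (sphereCoord d).contDiff.contDiffAt
  have haxial : ContDiffAt ℝ ∞ (fun x : E (d + 1) => z + x 0) 0 := by fun_prop
  refine ContDiffAt.comp (0 : E (d + 1)) (g := N) ?_ (hsphere.prodMk haxial)
  have hcenter : (σ (sphereCoord d 0), z + (0 : E (d + 1)) 0) = (σ 0, z) := by simp
  rw [← hcenter] at hN
  exact hN

end CylinderCoordinates

section NeckEstimates

variable {d m k : ℕ} {ε a b z : ℝ} {N : E (d + 1) × ℝ → E (d + 1 + m)} {σ : E d → E (d + 1)}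

lemma IsNormalSphereChart.norm_zero (hσ : IsNormalSphereChart σ) : ‖σ 0‖ = 1 :=
  hσ.mem_sphere.self_of_nhds

lemma abs_cylWeingarten_le_one (i j : Fin (d + 1)) : |cylWeingarten i j| ≤ 1 := by
  by_cases hi : i = 0 <;> by_cases hj : j = 0 <;> by_cases hij : i = j <;>
    simp_all [cylWeingarten, dz]

lemma abs_dz_le_one (i : Fin (d + 1)) : |dz i| ≤ 1 := by
  unfold dz
  split_ifs <;> simp

lemma meanRadius_nonneg (N : E (d + 1) × ℝ → E (d + 1 + m)) (z : ℝ) : 0 ≤ meanRadius N z :=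
  Real.rpow_nonneg (div_nonneg (MeasureTheory.integral_nonneg fun _ => Real.sqrt_nonneg _)
    MeasureTheory.measureReal_nonneg) _

lemma metric_patch_apply {x : E (d + 1)} (hr : meanRadius N (z + x 0) ≠ 0) (i j : Fin (d + 1)) :
    metric (patch N σ z) x i j = meanRadius N (z + x 0) ^ 2 * confMetric N σ z x i j := by
  simp only [confMetric, Matrix.smul_apply, smul_eq_mul]
  field_simp

lemma metric_inv_meanRadius_smul_patch :
    metric ((meanRadius N z)⁻¹ • patch N σ z) 0 = confMetric N σ z 0 := by
  simp [metric_const_smul, confMetric]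

lemma norm_apply_le_tensorNorm_cylMetric (hσ : IsNormalSphereChart σ) {l : ℕ}
    (T : (Fin l → Fin (d + 1)) → ℝ) (I : Fin l → Fin (d + 1)) :
    |T I| ≤ tensorNorm (cylMetric σ z 0)⁻¹ T := by
  simpa [cylMetric_zero hσ] using norm_apply_le_tensorNorm Matrix.PosDef.one T I

namespace IsGeometricNeck

variable (hN : IsGeometricNeck ε k a b N) (hz : z ∈ Set.Icc a b)
include hN hz

lemma abs_deriv_meanRadius_le (hr : 0 < meanRadius N z) (hk : 1 ≤ k) :
    |deriv (meanRadius N) z| ≤ ε * meanRadius N z := by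
  have h := hN.radius_close z hz 1 le_rfl hk
  rwa [iteratedDeriv_one, deriv.log ((hN.radius_smooth z hz).differentiableAt (by simp)) hr.ne',
    abs_div, abs_of_pos hr, div_le_iff₀ hr] at h

variable (hσ : IsNormalSphereChart σ)
include hσ

lemma contDiffAt_patch : ContDiffAt ℝ ∞ (patch N σ z) 0 :=
  BendNeck.contDiffAt_patch hσ (hN.smooth (σ 0) z hσ.norm_zero hz)

lemma posDef_metric_patch : (metric (patch N σ z) 0).PosDef :=
  Matrix.posDef_gram_of_linearIndependent (hN.immersion z hz σ hσ)

lemma abs_confMetric_sub_le (i j : Fin (d + 1)) :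
    |confMetric N σ z 0 i j - if i = j then 1 else 0| ≤ ε := by
  have h := (norm_apply_le_tensorNorm_cylMetric hσ _ ![i, j]).trans (hN.metric_close z hz σ hσ)
  simpa [cylMetric_zero hσ, Matrix.one_apply] using h

lemma abs_confMetric_le (hε : ε < 1) (i j : Fin (d + 1)) : |confMetric N σ z 0 i j| ≤ 2 := by
  have h := hN.abs_confMetric_sub_le hz hσ i j
  rw [abs_le] at h ⊢
  split_ifs at h <;> constructor <;> linarith

lemma meanRadius_pos (hε : ε < 1) : 0 < meanRadius N z := by
  refine (meanRadius_nonneg N z).lt_of_ne fun hr => ?_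
  have h := hN.abs_confMetric_sub_le hz hσ 0 0
  simp only [confMetric, PiLp.zero_apply, add_zero, ← hr, ne_eq, OfNat.ofNat_ne_zero,
    not_false_eq_true, zero_pow, inv_zero, zero_smul, Matrix.zero_apply, if_true, zero_sub,
    abs_neg, abs_one] at h
  linarith

lemma abs_pd_confMetric_le (hk : 1 ≤ k) (l i j : Fin (d + 1)) :
    |pd l (fun y => confMetric N σ z y i j) 0| ≤ ε := by
  have hcov : iterCovDeriv (christoffel (cylMetric σ z)) (fun _ v => v)
      (fun x I => confMetric N σ z x (I 0) (I 1)) 1 0 ![l, i, j]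
      = pd l (fun y => confMetric N σ z y i j) 0 := by
    simp only [iterCovDeriv, covDeriv, christoffel_cylMetric_zero hσ, zero_smul,
      Finset.sum_const_zero, sub_zero]
    rfl
  rw [← hcov]
  exact (norm_apply_le_tensorNorm_cylMetric hσ _ _).trans
    (hN.deriv_metric_close z hz σ hσ 1 le_rfl hk)

lemma pd_metric_patch (hε : ε < 1) (l i j : Fin (d + 1)) :
    pd l (fun y => metric (patch N σ z) y i j) 0
      = meanRadius N z ^ 2 * pd l (fun y => confMetric N σ z y i j) 0
        + dz l * (2 * meanRadius N z * deriv (meanRadius N) z) * confMetric N σ z 0 i j := by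
  have hr := (hN.meanRadius_pos hz hσ hε).ne'
  have hρ : DifferentiableAt ℝ (fun s => meanRadius N (z + s)) ((0 : E (d + 1)) 0) := by
    refine DifferentiableAt.comp (g := meanRadius N) _ ?_ (by fun_prop)
    simpa using (hN.radius_smooth z hz).differentiableAt (by simp)
  have hρ_axial : DifferentiableAt ℝ (fun x : E (d + 1) => meanRadius N (z + x 0)) 0 :=
    DifferentiableAt.comp (g := fun s => meanRadius N (z + s)) (f := fun x : E (d + 1) => x 0)
      (0 : E (d + 1)) hρ (by fun_prop)
  have hconf : DifferentiableAt ℝ (fun y => confMetric N σ z y i j) 0 :=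
    ((hρ_axial.fun_pow 2).fun_inv (by simpa using hr)).fun_mul
      ((contDiffAt_metric (hN.contDiffAt_patch hz hσ) (p := ∞) (by simp) i j).differentiableAt
        (by simp))
  have hmetric : (fun y => metric (patch N σ z) y i j)
      =ᶠ[𝓝 0] fun y => meanRadius N (z + y 0) ^ 2 * confMetric N σ z y i j :=
    (hρ_axial.continuousAt.eventually_ne (by simpa using hr)).mono
      fun _ hy => metric_patch_apply hy i j
  rw [pd_congr hmetric, pd_mul (hρ_axial.fun_pow 2) hconf,
    pd_comp_apply_zero (hρ.fun_pow 2), deriv_fun_pow hρ, deriv_comp_const_add]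
  simp

lemma abs_pd_metric_patch_le (hk : 1 ≤ k) (hε₀ : 0 ≤ ε) (hε : ε < 1) (l i j : Fin (d + 1)) :
    |pd l (fun y => metric (patch N σ z) y i j) 0| ≤ 5 * ε * meanRadius N z ^ 2 := by
  have hr := hN.meanRadius_pos hz hσ hε
  rw [hN.pd_metric_patch hz hσ hε]
  calc _ ≤ meanRadius N z ^ 2 * |pd l (fun y => confMetric N σ z y i j) 0|
        + |dz l| * (2 * meanRadius N z * |deriv (meanRadius N) z|) * |confMetric N σ z 0 i j| := by
        refine (abs_add_le _ _).trans_eq ?_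
        simp only [abs_mul, abs_pow, abs_two, abs_of_pos hr]
    _ ≤ meanRadius N z ^ 2 * ε + 1 * (2 * meanRadius N z * (ε * meanRadius N z)) * 2 := by
        gcongr
        exacts [hN.abs_pd_confMetric_le hz hσ hk l i j, abs_dz_le_one l,
          hN.abs_deriv_meanRadius_le hz hr hk, hN.abs_confMetric_le hz hσ hε i j]
    _ = 5 * ε * meanRadius N z ^ 2 := by ring

lemma norm_apply_le_mul_tensorNorm (hε : ε < 1) {l : ℕ} {V : Type} [NormedAddCommGroup V]
    [InnerProductSpace ℝ V] (T : (Fin l → Fin (d + 1)) → V) (I : Fin l → Fin (d + 1)) :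
    ‖T I‖ ≤ (2 * meanRadius N z) ^ l * tensorNorm (metricInv (patch N σ z) 0) T := by
  have hr := hN.meanRadius_pos hz hσ hε
  have hpos := hN.posDef_metric_patch hz hσ
  have hdiag (i : Fin (d + 1)) : metric (patch N σ z) 0 i i ≤ (2 * meanRadius N z) ^ 2 := by
    rw [metric_patch_apply (by simpa using hr.ne'), PiLp.zero_apply, add_zero]
    nlinarith [(abs_le.1 (hN.abs_confMetric_le hz hσ hε i i)).2, pow_pos hr 2]
  refine (norm_apply_le_tensorNorm hpos T I).trans
    (mul_le_mul_of_nonneg_right ?_ (Real.sqrt_nonneg _))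
  rw [Real.sqrt_le_left (by positivity), ← pow_mul, mul_comm l 2, pow_mul]
  exact (Finset.prod_le_prod (fun a _ => hpos.diag_pos.le) fun a _ => hdiag (I a)).trans_eq
    (by simp)

lemma abs_sum_cylWeingarten_mul_metric_sub_le (hε : ε < 1) (i j : Fin (d + 1)) :
    |(meanRadius N z)⁻¹ * ∑ l, cylWeingarten i l * metric (patch N σ z) 0 l j
      - meanRadius N z * cylWeingarten i j| ≤ ((d : ℝ) + 1) * ε * meanRadius N z := by
  have hr := hN.meanRadius_pos hz hσ hε
  have hmetric (l : Fin (d + 1)) :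
      metric (patch N σ z) 0 l j = meanRadius N z ^ 2 * confMetric N σ z 0 l j := by
    simpa using metric_patch_apply (x := 0) (by simpa using hr.ne') l j
  have hsum : (meanRadius N z)⁻¹ * ∑ l, cylWeingarten i l * metric (patch N σ z) 0 l j
      - meanRadius N z * cylWeingarten i j = meanRadius N z *
        ∑ l, cylWeingarten i l * (confMetric N σ z 0 l j - if l = j then 1 else 0) := by
    simp only [hmetric, mul_sub, Finset.sum_sub_distrib, mul_ite, mul_one, mul_zero,
      Finset.sum_ite_eq', Finset.mem_univ, if_true, Finset.mul_sum]
    congr 1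
    refine Finset.sum_congr rfl fun l _ => ?_
    field_simp
  have hbound (l : Fin (d + 1)) :
      |cylWeingarten i l * (confMetric N σ z 0 l j - if l = j then 1 else 0)| ≤ ε := by
    rw [abs_mul]
    exact (mul_le_of_le_one_left (abs_nonneg _) (abs_cylWeingarten_le_one i l)).trans
      (hN.abs_confMetric_sub_le hz hσ l j)
  rw [hsum, abs_mul, abs_of_pos hr, mul_comm]
  gcongr
  calc _ ≤ ∑ _l : Fin (d + 1), ε :=
        (Finset.abs_sum_le_sum_abs _ _).trans (Finset.sum_le_sum fun l _ => hbound l)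
    _ = ((d : ℝ) + 1) * ε := by simp

end IsGeometricNeck

namespace IsCylindricalNeck

variable (hN : IsCylindricalNeck ε k a b N) (hz : z ∈ Set.Icc a b) (hσ : IsNormalSphereChart σ)
  (hε : ε < 1)
include hN hz hσ hε

lemma exists_axis :
    ∃ ν : E (d + 1 + m), ‖ν‖ = 1 ∧ ∀ i j, ‖sff (patch N σ z) 0 i j
      - (meanRadius N z * cylWeingarten i j) • ν‖ ≤ ((d : ℝ) + 9) * ε * meanRadius N z := by
  have hr := hN.meanRadius_pos hz hσ hε
  obtain ⟨ν', hν'⟩ := hN.curvature_close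
  obtain ⟨hν, -, hparallel, horthogonal⟩ := hν' z hz σ hσ
  refine ⟨ν' (σ 0, z), hν, fun i j => ?_⟩
  set ν := ν' (σ 0, z)
  set h := sff (patch N σ z) 0 i j
  set r := meanRadius N z
  set S := ∑ l, cylWeingarten i l * metric (patch N σ z) 0 l j
  have hcomponent {V : Type} [NormedAddCommGroup V] [InnerProductSpace ℝ V]
      {T : (Fin 2 → Fin (d + 1)) → V}
      (hT : tensorNorm (metricInv (patch N σ z) 0) T ≤ ε * r⁻¹) : ‖T ![i, j]‖ ≤ 4 * ε * r :=
    ((hN.norm_apply_le_mul_tensorNorm hz hσ hε T _).trans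
      (mul_le_mul_of_nonneg_left hT (by positivity))).trans_eq (by field_simp; ring)
  have hsplit : h - (r * cylWeingarten i j) • ν = (inner ℝ h ν - r⁻¹ * S) • ν
      + (r⁻¹ * S - r * cylWeingarten i j) • ν + (h - (inner ℝ h ν : ℝ) • ν) := by module
  calc ‖h - (r * cylWeingarten i j) • ν‖
      ≤ |inner ℝ h ν - r⁻¹ * S| + |r⁻¹ * S - r * cylWeingarten i j|
        + ‖h - (inner ℝ h ν : ℝ) • ν‖ := by
        rw [hsplit]
        refine norm_add₃_le.trans_eq ?_
        simp only [norm_smul, hν, mul_one, Real.norm_eq_abs]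
    _ ≤ 4 * ε * r + ((d : ℝ) + 1) * ε * r + 4 * ε * r := by
        gcongr
        exacts [hcomponent hparallel, hN.abs_sum_cylWeingarten_mul_metric_sub_le hz hσ hε i j,
          hcomponent horthogonal]
    _ = ((d : ℝ) + 9) * ε * r := by ring

lemma norm_nablaSff_le {l : ℕ} (hl : 1 ≤ l) (hlk : l ≤ k) (I : Fin (2 + l) → Fin (d + 1)) :
    ‖nablaSff (patch N σ z) l 0 I‖ ≤ 2 ^ (2 + l) * ε * meanRadius N z := by
  have hr := hN.meanRadius_pos hz hσ hε
  calc _ ≤ (2 * meanRadius N z) ^ (2 + l) * (ε * (meanRadius N z ^ (l + 1))⁻¹) :=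
        (hN.norm_apply_le_mul_tensorNorm hz hσ hε _ I).trans
          (mul_le_mul_of_nonneg_left (hN.deriv_curvature z hz σ hσ l hl hlk) (by positivity))
    _ = 2 ^ (2 + l) * ε * meanRadius N z := by
        rw [mul_pow, show 2 + l = (l + 1) + 1 by ring, pow_succ (meanRadius N z)]
        field_simp

end IsCylindricalNeck

lemma norm_inv_smul_le {V : Type} [NormedAddCommGroup V] [NormedSpace ℝ V] {v : V} {r C K : ℝ}
    (hr : 0 < r) (hε : 0 ≤ ε) (hv : ‖v‖ ≤ C * ε * r) (hCK : C ≤ K) : ‖r⁻¹ • v‖ ≤ K * |ε| := by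
  rw [norm_smul, Real.norm_of_nonneg (inv_pos.2 hr).le, inv_mul_le_iff₀ hr, abs_of_nonneg hε,
    mul_comm r]
  exact hv.trans (by gcongr)

-- The constant `d + 25` only has to dominate `1`, `5`, `d + 9`, `2 ^ 3` and `2 ^ 4` from the estimates
-- above.
lemma IsCylindricalNeck.exists_bendData {θ τ : ℝ} {u : ℝ → ℝ} (hN : IsCylindricalNeck ε k a b N)
    (hz : z ∈ Set.Icc a b) (hσ : IsNormalSphereChart σ) (hε₀ : 0 ≤ ε) (hε : ε < 1) (hk : 1 ≤ k)
    (hkm : 2 ≤ k ∨ m = 1) (hτ : 0 ≤ τ) (hu : ContDiffAt ℝ 2 u z)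
    (hbound : τ * (|u z| + |deriv u z|) ≤ θ * meanRadius N z) :
    ∃ D : BendData d (E (d + 1 + m)) θ (d + 25), D.ε = ε ∧ patch N σ z = meanRadius N z • D.F ∧
      τ = meanRadius N z * D.τ ∧ D.u = fun s => u (z + s) := by
  have hr := hN.meanRadius_pos hz hσ hε
  have hc : (meanRadius N z)⁻¹ ≠ 0 := inv_ne_zero hr.ne'
  have : (0 : ℝ) ≤ d := d.cast_nonneg
  have hnabla {l : ℕ} (hl₁ : 1 ≤ l) (hl₂ : l ≤ 2) (hlk : l ≤ k) (I : Fin (2 + l) → Fin (d + 1)) :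
      ‖nablaSff ((meanRadius N z)⁻¹ • patch N σ z) l 0 I‖ ≤ (d + 25) * |ε| := by
    rw [nablaSff_const_smul hc]
    refine norm_inv_smul_le hr hε₀ (hN.norm_nablaSff_le hz hσ hε hl₁ hlk I) ?_
    interval_cases l <;> norm_num <;> linarith
  obtain ⟨ν, hν, hsff⟩ := hN.exists_axis hz hσ hε
  refine ⟨{
    F := (meanRadius N z)⁻¹ • patch N σ z
    ε := ε
    τ := (meanRadius N z)⁻¹ * τ
    u := fun s => u (z + s)
    axis := ν
    smooth := contDiffAt_const.smul (hN.contDiffAt_patch hz hσ)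
    det_ne_zero := ?_
    metric_close := fun i j => ?_
    deriv_metric := fun l i j => ?_
    norm_axis := hν
    sff_close := fun i j => ?_
    nabla_one := hnabla le_rfl one_le_two hk
    nabla_two := hkm.symm.imp (fun hm => by simp [hm]) (hnabla one_le_two le_rfl)
    u_smooth := ContDiffAt.comp (0 : ℝ) (g := u) (by simpa using hu) (by fun_prop)
    u_bound := ?_ }, rfl, (smul_inv_smul₀ hr.ne' _).symm, (mul_inv_cancel_left₀ hr.ne' τ).symm,
    rfl⟩
  · rw [metric_const_smul, Matrix.det_smul]
    exact mul_ne_zero (pow_ne_zero _ (pow_ne_zero _ hc)) (hN.posDef_metric_patch hz hσ).det_pos.ne'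
  · rw [metric_inv_meanRadius_smul_patch, abs_of_nonneg hε₀]
    exact (hN.abs_confMetric_sub_le hz hσ i j).trans (le_mul_of_one_le_left hε₀ (by linarith))
  · simp only [metric_const_smul, Matrix.smul_apply, pd_const_smul, inv_pow, ← Real.norm_eq_abs]
    exact norm_inv_smul_le (pow_pos hr 2) hε₀ (hN.abs_pd_metric_patch_le hz hσ hk hε₀ hε l i j)
      (by linarith)
  · have hsub : sff ((meanRadius N z)⁻¹ • patch N σ z) 0 i j - cylWeingarten i j • ν
        = (meanRadius N z)⁻¹ • (sff (patch N σ z) 0 i j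
          - (meanRadius N z * cylWeingarten i j) • ν) := by
      rw [sff_const_smul hc, smul_sub, smul_smul, inv_mul_cancel_left₀ hr.ne']
    rw [hsub]
    exact norm_inv_smul_le hr hε₀ (hsff i j) (by linarith)
  · rwa [deriv_comp_const_add, add_zero, abs_of_nonneg (by positivity), mul_assoc,
      inv_mul_le_iff₀ hr, mul_comm _ θ]

end NeckEstimates

lemma BendingExpansion.bend_const_smul {d : ℕ} {V : Type} [NormedAddCommGroup V]
    [InnerProductSpace ℝ V] {θ K C r : ℝ} {D : BendData d V θ K}
    (h : BendingExpansion D.F D.bent D.τ (D.u 0) (deriv D.u 0) (deriv (deriv D.u) 0)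
      (C * D.err) (C * D.err) (C * D.err)) (hC : 0 ≤ C) (hr : 0 < r) :
    let e₁ := |D.ε| * |r * D.τ| * (|D.u 0| + |deriv D.u 0|)
    let e₂ := (r * D.τ) ^ 2 * (|D.u 0| ^ 2 + |deriv D.u 0| ^ 2 + |deriv (deriv D.u) 0| ^ 2)
    BendingExpansion (r • D.F) (bend (r • D.F) (r * D.τ) D.u) (r * D.τ)
      (D.u 0) (deriv D.u 0) (deriv (deriv D.u) 0) (3 * C * (e₁ + e₂ / r))
      (3 * C * (e₁ / r ^ 2 + e₂ / r ^ 3)) (3 * C * (e₁ / r ^ 3 + e₂ / r ^ 4)) := by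
  intro e₁ e₂
  have herr : C * D.err ≤ 3 * C * (e₁ / r + e₂ / r ^ 2) := by
    refine (mul_le_mul_of_nonneg_left D.err_le hC).trans_eq ?_
    simp only [e₁, e₂, abs_mul, abs_of_pos hr]
    field_simp
  rw [BendNeck.bend_const_smul hr]
  refine ((h.mono herr herr herr).const_smul hr).mono ?_ ?_ ?_ <;> refine le_of_eq ?_ <;>
    field_simp

end

end BendNeck

theorem mainTheorem8 (d m : ℕ) (hd : 1 ≤ d) (θ : ℝ) (hθ₀ : 0 < θ) (hθ₁ : θ < 1) :
    ∃ ε₀ : ℝ, 0 < ε₀ ∧ ∃ c : ℝ, 0 < c ∧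
      ∀ (k : ℕ), 1 ≤ k → (2 ≤ k ∨ m = 1) →
      ∀ (ε : ℝ), 0 < ε → ε < ε₀ →
      ∀ (a b : ℝ), a < b →
      ∀ (N : E (d + 1) × ℝ → E (d + 1 + m)), IsCylindricalNeck ε k a b N →
      ∀ (u : ℝ → ℝ) (τ : ℝ), 0 ≤ τ →
      (∀ z ∈ Set.Icc a b, ContDiffAt ℝ 2 u z) →
      (∀ z ∈ Set.Icc a b, τ * (|u z| + |deriv u z|) ≤ θ * meanRadius N z) →
      ∀ z ∈ Set.Icc a b, ∀ σ : E d → E (d + 1), IsNormalSphereChart σ →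
        let F : E (d + 1) → E (d + 1 + m) := patch N σ z
        let F' : E (d + 1) → E (d + 1 + m) := bentPatch N τ u σ z
        let r : ℝ := meanRadius N z
        let u₀ : ℝ := u z
        let u₁ : ℝ := deriv u z
        let u₂ : ℝ := deriv (deriv u) z
        let e₁ : ℝ := ε * τ * (|u₀| + |u₁|)
        let e₂ : ℝ := τ ^ 2 * (|u₀| ^ 2 + |u₁| ^ 2 + |u₂| ^ 2)
        -- the deformed neck is immersed
        LinearIndependent ℝ (fun i => pd i F' 0) ∧
        -- (i)
        (∀ i j : Fin (d + 1),
          ‖sff F' 0 i j -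
            (sff F 0 i j
              + (τ * dz i * dz j * u₂) • nuPlus F 0
              + (τ * u₀) • ∑ k, hPlusMixed F 0 j k • pd i (pd k F) 0
              + (τ * dz j * u₁) • pd i (nuPlus F) 0
              + (τ * dz i * u₁) • ∑ k, hPlusMixed F 0 j k • pd k F 0
              + (τ * u₀) • ∑ k, pd i (fun x => hPlusMixed F x j k) 0 • pd k F 0
              - (τ * u₁) • ∑ k, (dz i * hPlusMixed F 0 j k + dz j * hPlusMixed F 0 i k
                  - metricInv F 0 0 k * hPlus F 0 i j) • pd k F 0)‖
            ≤ c * (e₁ + e₂ / r)) ∧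
        -- (ii)
        (∀ i j : Fin (d + 1),
          ‖weingarten F' 0 i j -
            (weingarten F 0 i j
              + (τ * metricInv F 0 0 j * dz i * u₂) • nuPlus F 0
              - (τ * u₀) • ∑ k, hPlusUp F 0 j k • pd i (pd k F) 0
              + (τ * metricInv F 0 0 j * u₁) • pd i (nuPlus F) 0
              + (τ * dz i * u₁) • ∑ k, hPlusUp F 0 j k • pd k F 0
              + (τ * u₀) • ∑ k, pd i (fun x => hPlusUp F x j k) 0 • pd k F 0
              - (τ * u₁) • ∑ k, (dz i * hPlusUp F 0 j k
                  + metricInv F 0 0 j * hPlusMixed F 0 i k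
                  - metricInv F 0 0 k * hPlusMixed F 0 i j) • pd k F 0)‖
            ≤ c * (e₁ / r ^ 2 + e₂ / r ^ 3)) ∧
        -- (iii)
        ‖meanCurv F' 0 -
            (meanCurv F 0
              + (τ * metricInv F 0 0 0 * u₂) • nuPlus F 0
              - (τ * u₀) • ∑ i, ∑ k, hPlusUp F 0 i k • pd i (pd k F) 0
              + (τ * u₁) • ∑ i, metricInv F 0 0 i • pd i (nuPlus F) 0
              + (τ * u₁) • ∑ k, hPlusUp F 0 0 k • pd k F 0
              + (τ * u₀) • ∑ i, ∑ k, pd i (fun x => hPlusUp F x i k) 0 • pd k F 0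
              - (τ * u₁) • ∑ i, ∑ k, (dz i * hPlusUp F 0 i k
                  + metricInv F 0 0 i * hPlusMixed F 0 i k
                  - metricInv F 0 0 k * hPlusMixed F 0 i i) • pd k F 0)‖
            ≤ c * (e₁ / r ^ 2 + e₂ / r ^ 3) ∧
        -- (iv)
        |normSqA F' 0 -
            (normSqA F 0
              + 2 * τ * u₂ * hPlusUp F 0 0 0
              + 2 * τ * u₀ * ∑ i, ∑ j, ∑ k,
                  hPlusMixed F 0 j k * inner ℝ (sff F 0 i k) (sffUp F 0 i j))|
            ≤ c * (e₁ / r ^ 3 + e₂ / r ^ 4) ∧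
        -- (v)
        |‖meanCurv F' 0‖ ^ 2 -
            (‖meanCurv F 0‖ ^ 2
              + 2 * τ * u₂ * metricInv F 0 0 0 * ‖meanCurv F 0‖
              + 2 * τ * u₀ * (∑ i, ∑ j, ∑ k,
                  hPlusMixed F 0 j k * hPlus F 0 i k * metricInv F 0 i j) * ‖meanCurv F 0‖)|
            ≤ c * (e₁ / r ^ 3 + e₂ / r ^ 4) := by
  obtain ⟨δ, hδ, C, hC, hexp⟩ :=
    BendData.exists_bendingExpansion (E (d + 1 + m)) (d + 25) hd hθ₁
  refine ⟨min δ 1, lt_min hδ one_pos, 3 * C, by positivity, ?_⟩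
  intro k hk hkm ε hε₀ hε a b _ N hN u τ hτ hu hbound z hz σ hσ
  obtain ⟨hεδ, hε₁⟩ := lt_min_iff.1 hε
  have hr : 0 < meanRadius N z := hN.toIsGeometricNeck.meanRadius_pos hz hσ hε₁
  obtain ⟨D, hDε, hDF, hDτ, hDu⟩ :=
    hN.exists_bendData hz hσ hε₀.le hε₁ hk hkm hτ (hu z hz) (hbound z hz)
  have hderiv (f : ℝ → ℝ) : deriv (fun s => f (z + s)) = fun s => deriv f (z + s) :=
    funext fun _ => deriv_comp_const_add ..
  have hD := (hexp D (by rwa [hDε, abs_of_pos hε₀])).bend_const_smul hC.le hr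
  rw [← hDF, ← hDτ, hDε, abs_of_pos hε₀, abs_of_nonneg hτ] at hD
  simp only [hDu, hderiv, add_zero] at hD
  exact ⟨hD.linearIndependent, hD.norm_sff_sub_le, hD.norm_weingarten_sub_le,
    hD.norm_meanCurv_sub_le, hD.abs_normSqA_sub_le, hD.abs_normSqMeanCurv_sub_le⟩
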